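/- Let $(\mathcal M,g_{ab})$ be a quaternionic-Kähler (self-dual Einstein) 4-manifold: a smooth Riemannian 4-manifold with $R_{ab}=\Lambda g_{ab}$ for a constant $\Lambda\neq0$ and $\Psi_{ABCD}=0$, where $R_{ab}$ is positive on round spheres. Let $J^a{}_b$ be an integrable complex structure compatible with $g_{ab}$, the orientation being the one for which $g_{ac}J^c{}_b$ is anti-self-dual. With respect to any local spin frame $\partial_{AA'}$, $g(\partial_{AA'},\partial_{BB'})=\epsilon_{AB}\epsilon_{A'B'}$, $\Psi_{ABCD}=\tfrac14\epsilon^{A'B'}\epsilon^{C'D'}C_{AA'BB'CC'DD'}$ is the anti-self-dual Weyl spinor. Let $o_A,\iota_A$ be local principal spinors of $J$, that is, $J^a{}_b=i(o^A\iota_B+\iota^Ao_B)\delta^{A'}_{B'}$ and $o_A\iota^A=1$. Put $$f_a=-\tfrac12J^b{}_c\nabla_bJ^c{}_a,\qquad \omega_a=\iota_B\nabla_ao^B,\qquad P_a=\omega_a-\tfrac{i}{2}J^b{}_af_b .$$ For a scalar $\psi$ and a covector $v_b$ of weights $(w,p)$ put $$\mathscr C_a\psi=\nabla_a\psi+(wf_a+pP_a)\psi,\qquad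 \mathscr C_av_b=\nabla_av_b+(wf_a+pP_a)v_b-(f_av_b+f_bv_a-g_{ab}f^cv_c),$$ and $\Box^{\mathscr C}\psi=g^{ab}\mathscr C_a\mathscr C_b\psi$. The equation $\Box^{\mathscr C}\psi=0$ is the Teukolsky equation for weights $(w,p)$. Let $h_{ab}$ be an arbitrary smooth symmetric tensor field (complex-valued, in particular real). Let $\dot C_{abcd}[h]=\frac{d}{d\varepsilon}\big|_{\varepsilon=0}C_{abcd}[g+\varepsilon h]$, and let $$\mathcal E_{ab}[h]=-\tfrac12\Box h_{ab}-\tfrac12\nabla_a\nabla_b\mathrm{tr}(h)+\nabla^c\nabla_{(a}h_{b)c}-\tfrac12g_{ab}\big[\nabla^c\nabla^dh_{cd}-\Box\,\mathrm{tr}(h)\big]-\Lambda h_{ab}+\tfrac12\Lambda g_{ab}\mathrm{tr}(h).$$ Let $\mathring\Omega>0$ be a constant (the auxiliary conformal factor) and $W_{\mathbf i}^{abcd}=S_{\mathbf i}^{ABCD}\epsilon^{A'B'}\epsilon^{C'D'}$ for $\mathbf i=0,\dots,4$, where $S_{\mathbf i}^{ABCD}$ is the symmetrised product of $4-\mathbf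 i$ factors $o$ and $\mathbf i$ factors $\iota$. Then, wherever $o_A,\iota_A$ are defined: 1. The metric variation defining $\dot C_{abcd}[h]$ is differentiable, and $\mathcal E_{ab}[h]$ is the linearised Einstein operator: $\mathcal E_{ab}[h]=\frac{d}{d\varepsilon}\big|_{\varepsilon=0}\big(R_{ab}-\tfrac12Rg_{ab}+\Lambda g_{ab}\big)[g+\varepsilon h]$. 2. For $\mathbf i=0,\dots,4$, $$-\mathring\Omega^{-1}W_{\mathbf i}^{abcd}(\nabla_a-4f_a)\nabla_d\mathcal E_{bc}[h]=\tfrac14\Box^{\mathscr C}\big(\mathring\Omega^{-1}W_{\mathbf i}^{abcd}\dot C_{abcd}[h]\big),$$ where $\Box^{\mathscr C}$ acts on scalars of weights $(-3,4-2\mathbf i)$. 3. If $\mathcal E_{ab}[h]=0$ on an open set where $o_A,\iota_A$ are defined, then there each $\chi_{\mathbf i}=\tfrac14\mathring\Omega^{-1}W_{\mathbf i}^{abcd}\dot C_{abcd}[h]$ solves the Teukolsky equation for weights $(-3,4-2\mathbf i)$. -/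

import Mathlib

open scoped Manifold ContDiff
open Bundle

noncomputable section

namespace SDEinstein

/-- The coordinate space of a four-manifold. -/
abbrev E4 := EuclideanSpace ℝ (Fin 4)

/-! ### Tensor calculus in a coordinate chart

Components are complex-valued functions of the real coordinates `y : E4`. Tensor components are
written `T a b y`; all indices are lower ones unless the docstring says otherwise. -/

/-- The coordinate derivative `∂_a f`. -/
def pd (a : Fin 4) (f : E4 → ℂ) (y : E4) : ℂ :=
  fderiv ℝ f y (EuclideanSpace.single a 1)

/-- Components of a covector field. -/
abbrev Tensor1 := Fin 4 → E4 → ℂ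
/-- Components of a tensor field with two indices. -/
abbrev Tensor2 := Fin 4 → Fin 4 → E4 → ℂ
/-- Components of a tensor field with three indices. -/
abbrev Tensor3 := Fin 4 → Fin 4 → Fin 4 → E4 → ℂ
/-- Components of a tensor field with four indices. -/
abbrev Tensor4 := Fin 4 → Fin 4 → Fin 4 → Fin 4 → E4 → ℂ

/-- The inverse metric `g^{ab}`. -/
def ginv (G : Tensor2) : Tensor2 := fun a b y =>
  (Matrix.of fun i j => G i j y)⁻¹ a b

/-- The Christoffel symbols `Γ^a_{bc}` of the metric `G`. -/
def christoffel (G : Tensor2) : Tensor3 := fun a b c y =>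
  (1 / 2) * ∑ d, ginv G a d y * (pd b (G d c) y + pd c (G d b) y - pd d (G b c) y)

/-- The Riemann tensor `R^a_{bcd}`, with
`(∇_c ∇_d - ∇_d ∇_c) v^a = R^a_{bcd} v^b`. -/
def riemannUp (G : Tensor2) : Tensor4 := fun a b c d y =>
  pd c (christoffel G a d b) y - pd d (christoffel G a c b) y
    + ∑ e, (christoffel G a c e y * christoffel G e d b y
        - christoffel G a d e y * christoffel G e c b y)

/-- The Riemann tensor `R_{abcd}`. -/
def riemann (G : Tensor2) : Tensor4 := fun a b c d y =>
  ∑ e, G a e y * riemannUp G e b c d y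

/-- The Ricci tensor `R_{bd} = R^a_{bad}` (positive on round spheres). -/
def ricci (G : Tensor2) : Tensor2 := fun b d y =>
  ∑ a, riemannUp G a b a d y

/-- The scalar curvature. -/
def scalarCurv (G : Tensor2) (y : E4) : ℂ :=
  ∑ a, ∑ b, ginv G a b y * ricci G a b y

/-- The Weyl tensor `C_{abcd}` in dimension four. -/
def weyl (G : Tensor2) : Tensor4 := fun a b c d y =>
  riemann G a b c d y
    - (1 / 2) * (G a c y * ricci G b d y - G a d y * ricci G b c y
        - G b c y * ricci G a d y + G b d y * ricci G a c y)
    + (1 / 6) * scalarCurv G y * (G a c y * G b d y - G a d y * G b c y)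

/-- The Einstein tensor `G_{ab} = R_{ab} - R g_{ab} / 2`. -/
def einstein (G : Tensor2) : Tensor2 := fun a b y =>
  ricci G a b y - (1 / 2) * scalarCurv G y * G a b y

/-- `∇_a v_b`. -/
def nabla1 (G : Tensor2) (v : Tensor1) : Tensor2 := fun a b y =>
  pd a (v b) y - ∑ m, christoffel G m a b y * v m y

/-- `∇_a T_{bc}`. -/
def nabla2 (G : Tensor2) (T : Tensor2) : Tensor3 := fun a b c y =>
  pd a (T b c) y - ∑ m, (christoffel G m a b y * T m c y + christoffel G m a c y * T b m y)

/-- `∇_a T_{bcd}`. -/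
def nabla3 (G : Tensor2) (T : Tensor3) : Tensor4 := fun a b c d y =>
  pd a (T b c d) y - ∑ m, (christoffel G m a b y * T m c d y
    + christoffel G m a c y * T b m d y + christoffel G m a d y * T b c m y)

/-- `∇_a J^c_b` for an endomorphism field with components `J c b = J^c_b`. -/
def nablaEnd (G : Tensor2) (J : Tensor2) : Tensor3 := fun a c b y =>
  pd a (J c b) y + ∑ m, (christoffel G c a m y * J m b y - christoffel G m a b y * J c m y)

/-- `∇_a ∇_b φ` for a function `φ`. -/
def hess (G : Tensor2) (φ : E4 → ℂ) : Tensor2 := nabla1 G (fun b => pd b φ)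

/-- `∇_a ∇_b T_{cd}`. -/
def hess2 (G : Tensor2) (T : Tensor2) : Tensor4 := nabla3 G (nabla2 G T)

/-- The trace `g^{ab} T_{ab}`. -/
def tr (G : Tensor2) (T : Tensor2) (y : E4) : ℂ := ∑ a, ∑ b, ginv G a b y * T a b y

/-- The linearised Einstein operator with cosmological constant `Λ` on a background with
`R_{ab} = Λ g_{ab}`:
`E_{ab}[h] = -½ □h_{ab} - ½ ∇_a ∇_b tr h + ∇^c ∇_{(a} h_{b)c} - ½ g_{ab} (∇^c ∇^d h_{cd} - □ tr h)
  - Λ h_{ab} + ½ Λ g_{ab} tr h`. -/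
def linEinstein (G : Tensor2) (Λ : ℂ) (h : Tensor2) : Tensor2 := fun a b y =>
  -(1 / 2) * (∑ c, ∑ d, ginv G c d y * hess2 G h c d a b y)
    - (1 / 2) * hess G (tr G h) a b y
    + ∑ c, ∑ d, ginv G c d y * ((1 / 2) * (hess2 G h d a b c y + hess2 G h d b a c y))
    - (1 / 2) * G a b y *
        ((∑ c, ∑ d, ∑ e, ∑ k, ginv G c e y * ginv G d k y * hess2 G h c d e k y)
          - tr G (hess G (tr G h)) y)
    - Λ * h a b y + (1 / 2) * Λ * G a b y * tr G h y

/-- The metric `g + ε h`. -/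
def perturb (G h : Tensor2) (ε : ℝ) : Tensor2 := fun a b y => G a b y + (ε : ℂ) * h a b y

/-- The linearised Weyl tensor `d/dε C_{abcd}[g + ε h]` at `ε = 0`. -/
def linWeyl (G h : Tensor2) : Tensor4 := fun a b c d y =>
  deriv (fun ε : ℝ => weyl (perturb G h ε) a b c d y) 0

/-- The Nijenhuis tensor `N^c_{ab}` of the endomorphism field `J c b = J^c_b`. -/
def nijenhuis (J : Tensor2) : Tensor3 := fun c a b y =>
  ∑ d, (J d a y * pd d (J c b) y - J d b y * pd d (J c a) y
    - J c d y * (pd a (J d b) y - pd b (J d a) y))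

/-! ### Two-component spinors

A spin frame identifies complexified tangent vectors with bispinors. Unprimed and primed spinor
indices are both `Fin 2`. Spinor indices are raised and lowered by `ξ_B = ξ^A ε_{AB}` and
`ξ^A = ε^{AB} ξ_B`. -/

/-- The components `ε_{01} = -ε_{10} = 1`, and likewise `ε^{01} = -ε^{10} = 1`. -/
def eps (A B : Fin 2) : ℂ := if A = 0 ∧ B = 1 then 1 else if A = 1 ∧ B = 0 then -1 else 0

/-- A complex tetrad: `e A A' a y` is the component `a` of the complex vector `∂_{AA'}` at `y`. -/
abbrev Tetrad := Fin 2 → Fin 2 → Fin 4 → E4 → ℂ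

/-- An unprimed spinor field `ξ^A`, given by its components in a spin frame. -/
abbrev Spinor := Fin 2 → E4 → ℂ

/-- `e` is (the tetrad of) a smooth spin frame on `V`: `g(∂_{AA'}, ∂_{BB'}) = ε_{AB} ε_{A'B'}`. -/
structure IsSpinFrame (G : Tensor2) (V : Set E4) (e : Tetrad) : Prop where
  smooth : ∀ A A' a, ContDiffOn ℝ ∞ (e A A' a) V
  metric : ∀ y ∈ V, ∀ A A' B B',
    ∑ a, ∑ b, G a b y * e A A' a y * e B B' b y = eps A B * eps A' B'

/-- Lowered spinor components `ξ_B = ξ^A ε_{AB}`. -/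
def lower (ξ : Spinor) : Spinor := fun B y => ∑ A, ξ A y * eps A B

/-- `o, ι` are principal spinors of `J` on `V`: smooth, `o_A ι^A = 1`, and
`J^a_b = i (o^A ι_B + ι^A o_B) δ^{A'}_{B'}`. -/
structure IsPrincipalPair (J : Tensor2) (V : Set E4) (e : Tetrad) (o ι : Spinor) : Prop where
  smooth_o : ∀ A, ContDiffOn ℝ ∞ (o A) V
  smooth_ι : ∀ A, ContDiffOn ℝ ∞ (ι A) V
  normalised : ∀ y ∈ V, ∑ A, lower o A y * ι A y = 1
  principal : ∀ y ∈ V, ∀ B B' a,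
    ∑ b, J a b y * e B B' b y
      = Complex.I * ∑ A, (o A y * lower ι B y + ι A y * lower o B y) * e A B' a y

/-- The unprimed spin connection `γ_{aA}{}^B = ε^{BC} γ_{aAC}`, where
`γ_{aAC} = ½ ε^{A'C'} g(∇_a ∂_{AA'}, ∂_{CC'})`. -/
def spinConn (G : Tensor2) (e : Tetrad) (a : Fin 4) (A B : Fin 2) (y : E4) : ℂ :=
  ∑ C, eps B C * ((1 / 2) * ∑ A', ∑ C', eps A' C' * ∑ b, ∑ c, G b c y *
    (pd a (e A A' b) y + ∑ m, christoffel G b a m y * e A A' m y) * e C C' c y)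

/-- The spinor covariant derivative `∇_a ξ^B`. -/
def nablaSpinor (G : Tensor2) (e : Tetrad) (ξ : Spinor) (a : Fin 4) (B : Fin 2) (y : E4) : ℂ :=
  pd a (ξ B) y + ∑ A, ξ A y * spinConn G e a A B y

/-- The spinor components `Ψ_{ABCD} = ¼ ε^{A'B'} ε^{C'D'} C_{AA'BB'CC'DD'}` of the Weyl tensor. -/
def weylSpinor (G : Tensor2) (e : Tetrad) (A B C D : Fin 2) (y : E4) : ℂ :=
  (1 / 4) * ∑ A', ∑ B', ∑ C', ∑ D', eps A' B' * eps C' D' *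
    ∑ a, ∑ b, ∑ c, ∑ d, weyl G a b c d y
      * e A A' a y * e B B' b y * e C C' c y * e D D' d y

/-! ### The conformally and GHP covariant connection -/

/-- The Lee form `f_a = -½ J^b_c ∇_b J^c_a`. -/
def lee (G J : Tensor2) : Tensor1 := fun a y =>
  -(1 / 2) * ∑ b, ∑ c, J b c y * nablaEnd G J b c a y

/-- The GHP connection form `ω_a = ι_B ∇_a o^B`. -/
def ghp (G : Tensor2) (e : Tetrad) (o ι : Spinor) : Tensor1 := fun a y =>
  ∑ B, lower ι B y * nablaSpinor G e o a B y

/-- `P_a = ω_a - ½ i J^b_a f_b`. -/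
def formP (G J : Tensor2) (e : Tetrad) (o ι : Spinor) : Tensor1 := fun a y =>
  ghp G e o ι a y - (1 / 2) * Complex.I * ∑ b, J b a y * lee G J b y

/-- `𝒞_a ψ` for a scalar `ψ` of weights `(w, p)`. -/
def cScalar (G J : Tensor2) (e : Tetrad) (o ι : Spinor) (w p : ℂ) (ψ : E4 → ℂ) : Tensor1 :=
  fun a y => pd a ψ y + (w * lee G J a y + p * formP G J e o ι a y) * ψ y

/-- `𝒞_a v_b` for a covector `v_b` of weights `(w, p)`. -/
def cCovector (G J : Tensor2) (e : Tetrad) (o ι : Spinor) (w p : ℂ) (v : Tensor1) : Tensor2 :=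
  fun a b y => nabla1 G v a b y + (w * lee G J a y + p * formP G J e o ι a y) * v b y
    - (lee G J a y * v b y + lee G J b y * v a y
        - G a b y * ∑ c, ∑ d, ginv G c d y * lee G J d y * v c y)

/-- The wave operator `□^𝒞 ψ = g^{ab} 𝒞_a 𝒞_b ψ` on scalars of weights `(w, p)`. -/
def boxC (G J : Tensor2) (e : Tetrad) (o ι : Spinor) (w p : ℂ) (ψ : E4 → ℂ) (y : E4) : ℂ :=
  tr G (cCovector G J e o ι w p (cScalar G J e o ι w p ψ)) y

/-- `S_i^{ABCD}`: the symmetrised product of `4 - i` factors `o` and `i` factors `ι`. -/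
def symS (o ι : Spinor) (i : Fin 5) (A B C D : Fin 2) (y : E4) : ℂ :=
  (1 / 24) * ∑ σ : Equiv.Perm (Fin 4),
    ∏ k, (if ((σ k : Fin 4) : ℕ) < (i : ℕ) then ι else o) (![A, B, C, D] k) y

/-- `W_i^{abcd} = S_i^{ABCD} ε^{A'B'} ε^{C'D'}` (upper indices). -/
def tensorW (e : Tetrad) (o ι : Spinor) (i : Fin 5) : Tensor4 := fun a b c d y =>
  ∑ A, ∑ B, ∑ C, ∑ D, ∑ A', ∑ B', ∑ C', ∑ D',
    symS o ι i A B C D y * eps A' B' * eps C' D'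
      * e A A' a y * e B B' b y * e C C' c y * e D D' d y

/-- `W_i^{abcd} Ċ_{abcd}[h]`. -/
def weylComponent (G : Tensor2) (e : Tetrad) (o ι : Spinor) (i : Fin 5) (h : Tensor2)
    (y : E4) : ℂ :=
  ∑ a, ∑ b, ∑ c, ∑ d, tensorW e o ι i a b c d y * linWeyl G h a b c d y

/-- `W_i^{abcd} (∇_a - 4 f_a) ∇_d T_{bc}`. -/
def sourceOp (G J : Tensor2) (e : Tetrad) (o ι : Spinor) (i : Fin 5) (T : Tensor2) (y : E4) : ℂ :=
  ∑ a, ∑ b, ∑ c, ∑ d, tensorW e o ι i a b c d y *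
    (hess2 G T a d b c y - 4 * lee G J a y * nabla2 G T d b c y)

/-! ### Tensor fields on a four-manifold and their components in charts -/

section Manifold

variable {M : Type*} [TopologicalSpace M] [ChartedSpace E4 M]

/-- The coordinate vector `∂_a` of the chart `φ`, at the point with coordinates `y`. -/
def coordVec (φ : OpenPartialHomeomorph M E4) (a : Fin 4) (y : E4) :
    TangentSpace (𝓡 4) (φ.symm y) :=
  mfderiv (𝓡 4) (𝓡 4) φ.symm y (EuclideanSpace.single a (1 : ℝ) : E4)

/-- Components `T(∂_a, ∂_b)` in the chart `φ` of a complex-valued bilinear form field `T`. -/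
def formComp (φ : OpenPartialHomeomorph M E4)
    (T : ∀ x : M, TangentSpace (𝓡 4) x →L[ℝ] TangentSpace (𝓡 4) x →L[ℝ] ℂ) : Tensor2 :=
  fun a b y => T (φ.symm y) (coordVec φ a y) (coordVec φ b y)

variable [IsManifold (𝓡 4) ∞ M]

/-- A smooth Riemannian metric on `M`. -/
abbrev Metric (M : Type*) [TopologicalSpace M] [ChartedSpace E4 M] [IsManifold (𝓡 4) ∞ M] :=
  ContMDiffRiemannianMetric (𝓡 4) ∞ E4 (fun x : M => TangentSpace (𝓡 4) x)

/-- Components `g_{ab}` in the chart `φ` of a Riemannian metric. -/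
def metricComp (φ : OpenPartialHomeomorph M E4) (g : Metric M) : Tensor2 :=
  fun a b y => (g.inner (φ.symm y) (coordVec φ a y) (coordVec φ b y) : ℂ)

/-- Components `J^a_b` in the chart `φ` of an endomorphism field of the tangent bundle. -/
def endComp (φ : OpenPartialHomeomorph M E4)
    (J : ∀ x : M, TangentSpace (𝓡 4) x →L[ℝ] TangentSpace (𝓡 4) x) : Tensor2 :=
  fun a b y =>
    let u : E4 := mfderiv (𝓡 4) (𝓡 4) φ (φ.symm y) (J (φ.symm y) (coordVec φ b y))
    ((u a : ℝ) : ℂ)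

/-- A smooth (complex-valued) symmetric tensor field `h_{ab}`. -/
structure IsSymmTensorField
    (h : ∀ x : M, TangentSpace (𝓡 4) x →L[ℝ] TangentSpace (𝓡 4) x →L[ℝ] ℂ) : Prop where
  smooth : ContMDiff (𝓡 4) ((𝓡 4).prod 𝓘(ℝ, E4 →L[ℝ] E4 →L[ℝ] ℂ)) ∞
    (fun x => TotalSpace.mk' (E4 →L[ℝ] E4 →L[ℝ] ℂ) x (h x))
  symm : ∀ x v w, h x v w = h x w v

/-- `J` is an integrable complex structure on `M` compatible with the metric `g`: a smooth
endomorphism field with `J² = -1`, `g(J·, J·) = g` and vanishing Nijenhuis tensor. -/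
structure IsComplexStructure (g : Metric M)
    (J : ∀ x : M, TangentSpace (𝓡 4) x →L[ℝ] TangentSpace (𝓡 4) x) : Prop where
  smooth : ContMDiff (𝓡 4) ((𝓡 4).prod 𝓘(ℝ, E4 →L[ℝ] E4)) ∞
    (fun x => TotalSpace.mk' (E4 →L[ℝ] E4) x (J x))
  sq : ∀ x v, J x (J x v) = -v
  compatible : ∀ x v w, g.inner x (J x v) (J x w) = g.inner x v w
  integrable : ∀ φ ∈ IsManifold.maximalAtlas (𝓡 4) ∞ M, ∀ y ∈ φ.target, ∀ c a b,
    nijenhuis (endComp φ J) c a b y = 0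

/-- `(M, g)` is quaternionic-Kähler (self-dual Einstein): `R_{ab} = Λ g_{ab}` with `Λ ≠ 0`, and
`Ψ_{ABCD} = 0`. The orientation is the one for which the two-form of `J` is anti-self-dual, i.e. the
unprimed spinors are those of which `J` has principal spinors. -/
structure IsQuaternionicKahler (g : Metric M)
    (J : ∀ x : M, TangentSpace (𝓡 4) x →L[ℝ] TangentSpace (𝓡 4) x) (Λ : ℝ) : Prop where
  ne_zero : Λ ≠ 0
  einstein : ∀ φ ∈ IsManifold.maximalAtlas (𝓡 4) ∞ M, ∀ y ∈ φ.target, ∀ a b,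
    ricci (metricComp φ g) a b y = Λ * metricComp φ g a b y
  selfDual : ∀ φ ∈ IsManifold.maximalAtlas (𝓡 4) ∞ M, ∀ V ⊆ φ.target, IsOpen V →
    ∀ (e : Tetrad) (o ι : Spinor), IsSpinFrame (metricComp φ g) V e →
      IsPrincipalPair (endComp φ J) V e o ι →
      ∀ y ∈ V, ∀ A B C D, weylSpinor (metricComp φ g) e A B C D y = 0

end Manifold

end SDEinstein

end

/-! The identity is the linearised Bianchi identity for the unprimed Weyl spinor followed by a
factorisation of the wave operator, both read in the frame `E_{0A'} = o^A ∂_{AA'}`, `E_{1A'} = ι^A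
∂_{AA'}` of eigenvectors of `J`.

Geometry of the frame. Write `u` for the unprimed spin connection. Integrability of `J` says that `u
(0,k') 0 1` and `u (1,k') 1 0` vanish (`IsHatFrame.integrable`); the other off-diagonal coefficients
are minus the Lee form (`IsSDEinsteinFrame.lee`), and `-u k 0 0` is the GHP form
(`IsHatFrame.con_aGhp`). The twisted derivative of weights `(-3, 2r)` is therefore expressed by `u`
alone (`wCoef`). The Einstein equation and `Ψ = 0` determine the curvature `F` of `u` completely in
terms of `L = Λ/6` (`IsSDEinsteinCurv.unprimed`); only the self-dual Weyl spinor stays free.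

Bianchi identity. Let `Y_{AB}` be the one-form obtained as the unprimed part of the antisymmetrised
`∇h`. Up to a constant and the choice of variation of the frame it is the variation of `u`. Its
exterior covariant derivative `X = d^∇ Y` (`asdX_cov3`) contains two things. The symmetrisation of
its unprimed two-form part is the linearised Weyl spinor `φ_i` (`fullSym12_dblContr`,
`IsSDEinsteinFrame.symContr_aLinWeyl`). Its primed two-form part is the trace-free part of the
linearised Einstein tensor, up to a multiple of `L h` (`IsSDEinsteinCurv.selfDual_asdX`). In `d^∇ X
= F ∧ Y` (`extCov2_extCov1`) the terms with `L ∇h` cancel, and what remains (`bianchi_aux`) is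
`𝒞_{0B'} φ_{i+1} - 𝒞_{1B'} φ_i = (symmetrised divergence of the Einstein tensor)_{iB'}`.

Decoupling. Applying a divergence along `o` or `ι` removes one of the two neighbouring components,
because two derivatives along the same eigenspace compose to zero (`div0_wDer0`, `div1_wDer1`),
while a mixed composition is half the wave operator up to sign (`wBox_eq_div0`, `wBox_eq_div1`).
`wBox_fullSym12` adds the results. The third statement of the theorem follows, since the source is a
differential operator applied to the linearised Einstein tensor.

All of this is polynomial in derivatives, so it is carried out over an arbitrary commutative
`ℂ`-algebra with commuting derivations. The ring used in the end is that of smooth functions on an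
open subset of `E4 × ℝ`. The extra variable is the parameter `ε`, so that linearising means applying
a derivation `δ` which commutes with every `∂_a`. The predicate `Rep` translates between this ring
and the functions in the theorem. -/

noncomputable section

namespace SDEinstein

open TopologicalSpace (Opens)

/-! ### The ring of smooth functions on an open set -/

section SmoothRing

variable {X : Type*}

/-- Extension by zero of a function on an open set. -/
def zeroExt [TopologicalSpace X] (U : Opens X) (f : U → ℂ) : X → ℂ := Function.extend Subtype.val f 0

lemma zeroExt_apply [TopologicalSpace X] {U : Opens X} (f : U → ℂ) (x : U) : zeroExt U f x = f x :=
  Subtype.val_injective.extend_apply _ _ _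

lemma zeroExt_of_mem [TopologicalSpace X] {U : Opens X} (f : U → ℂ) {x : X} (hx : x ∈ U) :
    zeroExt U f x = f ⟨x, hx⟩ := zeroExt_apply f ⟨x, hx⟩

lemma zeroExt_eventuallyEq [TopologicalSpace X] {U : Opens X} {f : U → ℂ} {F : X → ℂ} (h : ∀ x : U, F x = f x) {x : X} (hx : x ∈ U) :
    F =ᶠ[nhds x] zeroExt U f := by
  filter_upwards [U.isOpen.mem_nhds hx] with z hz
  rw [zeroExt_of_mem _ hz]; exact h ⟨z, hz⟩

variable [NormedAddCommGroup X] [NormedSpace ℝ X]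

/-- The algebra of smooth complex-valued functions on an open set. -/
def SmoothRing (U : Opens X) : Subalgebra ℂ (U → ℂ) where
  carrier := {f | ContDiffOn ℝ ∞ (zeroExt U f) U}
  mul_mem' {f g} hf hg := (hf.mul hg).congr fun x hx => by
    simp [zeroExt_of_mem _ hx]
  add_mem' {f g} hf hg := (hf.add hg).congr fun x hx => by
    simp [zeroExt_of_mem _ hx]
  algebraMap_mem' c := (contDiffOn_const (c := c)).congr fun x hx => by
    simp [zeroExt_of_mem _ hx]

namespace SmoothRing

variable {U : Opens X}

lemma contDiffAt_zeroExt (f : SmoothRing U) {x : X} (hx : x ∈ U) : ContDiffAt ℝ ∞ (zeroExt U f.1) x :=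
  (f.2 : ContDiffOn ℝ ∞ (zeroExt U f.1) U).contDiffAt (U.isOpen.mem_nhds hx)

lemma differentiableAt_zeroExt (f : SmoothRing U) {x : X} (hx : x ∈ U) :
    DifferentiableAt ℝ (zeroExt U f.1) x :=
  (contDiffAt_zeroExt f hx).differentiableAt (by simp)

/-- The restriction of a function that is smooth on `U`. -/
def of (F : X → ℂ) (hF : ContDiffOn ℝ ∞ F U) : SmoothRing U :=
  ⟨fun x => F x, hF.congr fun x hx => by rw [zeroExt_of_mem _ hx]⟩

@[simp] lemma val_add (f g : SmoothRing U) (x : U) : (f + g).1 x = f.1 x + g.1 x := rfl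
@[simp] lemma val_sub (f g : SmoothRing U) (x : U) : (f - g).1 x = f.1 x - g.1 x := rfl
@[simp] lemma val_neg (f : SmoothRing U) (x : U) : (-f).1 x = -f.1 x := rfl
@[simp] lemma val_mul (f g : SmoothRing U) (x : U) : (f * g).1 x = f.1 x * g.1 x := rfl
@[simp] lemma val_one (x : U) : (1 : SmoothRing U).1 x = 1 := rfl
@[simp] lemma val_zero (x : U) : (0 : SmoothRing U).1 x = 0 := rfl
@[simp] lemma val_algebraMap (c : ℂ) (x : U) : (algebraMap ℂ (SmoothRing U) c).1 x = c := rfl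

/-- Evaluation at a point. -/
def evalHom (x : U) : SmoothRing U →+* ℂ :=
  (Pi.evalRingHom (fun _ : U => ℂ) x).comp (SmoothRing U).val.toRingHom

lemma evalHom_apply (x : U) (f : SmoothRing U) : evalHom x f = f.1 x := rfl

@[simp] lemma val_sum {ι : Type*} (s : Finset ι) (f : ι → SmoothRing U) (x : U) :
    (∑ i ∈ s, f i).1 x = ∑ i ∈ s, (f i).1 x := map_sum (evalHom x) f s

lemma contDiffOn_fderiv (f : SmoothRing U) (v : X) :
    ContDiffOn ℝ ∞ (fun x => fderiv ℝ (zeroExt U f.1) x v) U := by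
  intro x hx
  exact (((contDiffAt_zeroExt f hx).fderiv_right (m := ∞) (by simp)).clm_apply
    contDiffAt_const).contDiffWithinAt

/-- The directional derivative as a derivation of the algebra of smooth functions. -/
def dir (U : Opens X) (v : X) : Derivation ℂ (SmoothRing U) (SmoothRing U) :=
  Derivation.mk'
    { toFun := fun f => of _ (contDiffOn_fderiv f v)
      map_add' := fun f g => by
        ext x
        have h : zeroExt U (f + g).1 =ᶠ[nhds (x : X)] zeroExt U f.1 + zeroExt U g.1 :=
          (zeroExt_eventuallyEq (fun z => by simp [zeroExt_apply]) x.2).symm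
        change fderiv ℝ (zeroExt U (f + g).1) x v = _
        rw [h.fderiv_eq, fderiv_add (SmoothRing.differentiableAt_zeroExt f x.2) (SmoothRing.differentiableAt_zeroExt g x.2)]
        rfl
      map_smul' := fun c f => by
        ext x
        have h : zeroExt U (c • f).1 =ᶠ[nhds (x : X)] c • zeroExt U f.1 :=
          (zeroExt_eventuallyEq (fun z => by simp [zeroExt_apply]) x.2).symm
        change fderiv ℝ (zeroExt U (c • f).1) x v = _
        rw [h.fderiv_eq, fderiv_const_smul (SmoothRing.differentiableAt_zeroExt f x.2)]
        rfl }
    fun f g => by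
      ext x
      have h : zeroExt U (f * g).1 =ᶠ[nhds (x : X)] zeroExt U f.1 * zeroExt U g.1 :=
        (zeroExt_eventuallyEq (fun z => by simp [zeroExt_apply]) x.2).symm
      change fderiv ℝ (zeroExt U (f * g).1) x v = _
      rw [h.fderiv_eq, fderiv_mul (SmoothRing.differentiableAt_zeroExt f x.2) (SmoothRing.differentiableAt_zeroExt g x.2)]
      simp [zeroExt_apply]
      rfl

lemma dir_val (v : X) (f : SmoothRing U) (x : U) :
    (dir U v f).1 x = fderiv ℝ (zeroExt U f.1) x v := rfl

/-- Symmetry of the second derivative. It serves twice: coordinate derivatives commute with one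
another, and the parameter derivative commutes with all of them. -/
lemma dir_comm (v w : X) (f : SmoothRing U) : dir U v (dir U w f) = dir U w (dir U v f) := by
  have key : ∀ v w : X, ∀ x : U, (dir U v (dir U w f)).1 x
      = fderiv ℝ (fderiv ℝ (zeroExt U f.1)) x v w := by
    intro v w x
    have h : zeroExt U (dir U w f).1 =ᶠ[nhds (x : X)] fun z => fderiv ℝ (zeroExt U f.1) z w :=
      (zeroExt_eventuallyEq (f := (dir U w f).1) (fun z => rfl) x.2).symm
    have hd : DifferentiableAt ℝ (fderiv ℝ (zeroExt U f.1)) x :=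
      ((contDiffAt_zeroExt f x.2).fderiv_right (m := ∞) (by simp)).differentiableAt (by simp)
    rw [dir_val, h.fderiv_eq, fderiv_clm_apply hd (by fun_prop)]
    simp
  ext x
  rw [key, key]
  exact ((contDiffAt_zeroExt f x.2).isSymmSndFDerivAt
    (by simpa using show ((2 : ℕ∞) : WithTop ℕ∞) ≤ ((⊤ : ℕ∞) : WithTop ℕ∞) from
      WithTop.coe_le_coe.2 le_top)) v w

lemma isUnit_of_ne_zero (f : SmoothRing U) (hf : ∀ x, f.1 x ≠ 0) : IsUnit f := by
  refine isUnit_iff_exists_inv.2 ⟨of (fun x => (zeroExt U f.1 x)⁻¹) fun x hx =>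
    ((contDiffAt_zeroExt f hx).inv (by rw [zeroExt_of_mem _ hx]; exact hf _)).contDiffWithinAt, ?_⟩
  ext x
  simpa [of, zeroExt_apply] using mul_inv_cancel₀ (hf x)

end SmoothRing

end SmoothRing

/-! ### Families of functions of the coordinates -/

section Family

variable (U : Opens (E4 × ℝ))

/-- The coordinate derivation `∂_a`. -/
def dc (a : Fin 4) : Derivation ℂ (SmoothRing U) (SmoothRing U) :=
  SmoothRing.dir U (EuclideanSpace.single a 1, 0)

/-- The derivation with respect to the parameter. -/
def dp : Derivation ℂ (SmoothRing U) (SmoothRing U) := SmoothRing.dir U (0, 1)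

/-- The one-parameter family `F` of functions of the coordinates is given on `U` by `f`. -/
def Rep (F : ℝ → E4 → ℂ) (f : SmoothRing U) : Prop :=
  ∀ y ε (h : (y, ε) ∈ U), F ε y = f.1 ⟨(y, ε), h⟩

variable {U}

/-- Chain rule for the slice `z ↦ (z, ε)`; openness of `U` makes the representation valid near `y`,
which is all that a derivative sees. -/
lemma Rep.pd {F : ℝ → E4 → ℂ} {f : SmoothRing U} (h : Rep U F f) (a : Fin 4) :
    Rep U (fun ε => pd a (F ε)) (dc U a f) := by
  intro y ε hy
  have hmem : ∀ᶠ z in nhds y, (z, ε) ∈ U :=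
    (by fun_prop : Continuous fun z : E4 => (z, ε)).continuousAt.eventually (U.isOpen.mem_nhds hy)
  have h1 : F ε =ᶠ[nhds y] fun z => zeroExt U f.1 (z, ε) := by
    filter_upwards [hmem] with z hz
    rw [zeroExt_of_mem _ hz, h z ε hz]
  have h2 : HasFDerivAt (fun z : E4 => (z, ε)) (ContinuousLinearMap.inl ℝ E4 ℝ) y :=
    hasFDerivAt_prodMk_left y ε
  have h3 := (SmoothRing.differentiableAt_zeroExt f hy).hasFDerivAt.comp y h2
  change fderiv ℝ (F ε) y _ = fderiv ℝ (zeroExt U f.1) (y, ε) _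
  rw [h1.fderiv_eq, show (fun z => zeroExt U f.1 (z, ε)) = zeroExt U f.1 ∘ fun z => (z, ε) from rfl,
    h3.fderiv]
  rfl

/-- The only passage from the algebraic derivation `dp` back to an honest derivative in `ε`. -/
lemma Rep.hasDerivAt {F : ℝ → E4 → ℂ} {f : SmoothRing U} (h : Rep U F f) {y : E4} {ε : ℝ}
    (hy : (y, ε) ∈ U) : HasDerivAt (fun t => F t y) ((dp U f).1 ⟨(y, ε), hy⟩) ε := by
  have hmem : ∀ᶠ t in nhds ε, (y, t) ∈ U :=
    (by fun_prop : Continuous fun t : ℝ => (y, t)).continuousAt.eventually (U.isOpen.mem_nhds hy)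
  have h1 : (fun t => F t y) =ᶠ[nhds ε] fun t => zeroExt U f.1 (y, t) := by
    filter_upwards [hmem] with t ht
    rw [zeroExt_of_mem _ ht, h y t ht]
  have h2 : HasFDerivAt (fun t : ℝ => (y, t)) (ContinuousLinearMap.inr ℝ E4 ℝ) ε :=
    hasFDerivAt_prodMk_right y ε
  have h3 := ((SmoothRing.differentiableAt_zeroExt f hy).hasFDerivAt.comp ε h2).hasDerivAt
  exact h3.congr_of_eventuallyEq h1

lemma Rep.unique {F : ℝ → E4 → ℂ} {f g : SmoothRing U} (hf : Rep U F f) (hg : Rep U F g) :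
    f = g := by
  ext ⟨⟨y, ε⟩, h⟩
  rw [← hf y ε h, ← hg y ε h]

end Family

end SDEinstein

end

noncomputable section

namespace SDEinstein

set_option linter.unusedSectionVars false

/-! ### Tensor calculus over a commutative ring with derivations -/

section Algebraic

variable {R : Type*} [CommRing R] [Algebra ℂ R]

/-- The element `1/2` of a complex algebra. -/
def half (R : Type*) [CommRing R] [Algebra ℂ R] : R := algebraMap ℂ R (1 / 2)

lemma two_mul_half : 2 * half R = 1 := by
  rw [half, show (2 : R) = algebraMap ℂ R 2 from
    (map_ofNat (algebraMap ℂ R) 2).symm, ← map_mul]; norm_num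

@[simp] lemma derivation_half (d : Derivation ℂ R R) : d (half R) = 0 := d.map_algebraMap _

@[simp] lemma derivation_ofNat (d : Derivation ℂ R R) (k : ℕ) [k.AtLeastTwo] :
    d (OfNat.ofNat k : R) = 0 := by
  rw [← Nat.cast_ofNat]; exact d.map_natCast k

section General

variable {n : Type*} [Fintype n] (D : n → Derivation ℂ R R)

/-- Christoffel symbols of `g` with inverse `gi`. -/
def aChr (g gi : n → n → R) (a b c : n) : R :=
  half R * ∑ d, gi a d * (D b (g d c) + D c (g d b) - D d (g b c))

/-- The curvature of symmetric connection coefficients. -/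
def aRiem (Γ : n → n → n → R) (a b c d : n) : R :=
  D c (Γ a d b) - D d (Γ a c b) + ∑ e, (Γ a c e * Γ e d b - Γ a d e * Γ e c b)

/-- The covariant derivative of a covector. -/
def cov1 (Γ : n → n → n → R) (v : n → R) (a b : n) : R :=
  D a (v b) - ∑ m, Γ m a b * v m

/-- The covariant derivative of a tensor with two lower indices. -/
def cov2 (Γ : n → n → n → R) (T : n → n → R) (a b c : n) : R :=
  D a (T b c) - ∑ m, (Γ m a b * T m c + Γ m a c * T b m)

/-- The covariant derivative of a tensor with three lower indices. -/
def cov3 (Γ : n → n → n → R) (T : n → n → n → R) (a b c d : n) : R :=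
  D a (T b c d) - ∑ m, (Γ m a b * T m c d + Γ m a c * T b m d + Γ m a d * T b c m)

/-- The trace of a tensor with two lower indices. -/
def aTr (gi T : n → n → R) : R := ∑ a, ∑ b, gi a b * T a b

/-- The matrices `g` and `gi` are symmetric and inverse to each other. -/
structure IsMetricPair [DecidableEq n] (g gi : n → n → R) : Prop where
  symm : ∀ a b, g a b = g b a
  symm_inv : ∀ a b, gi a b = gi b a
  mul_inv : ∀ a b, ∑ c, g a c * gi c b = if a = b then 1 else 0

variable [DecidableEq n] {g gi : n → n → R}

lemma IsMetricPair.inv_mul (hg : IsMetricPair g gi) (a b : n) :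
    ∑ c, gi a c * g c b = if a = b then 1 else 0 := by
  rw [show (if a = b then (1 : R) else 0) = if b = a then 1 else 0 by simp [eq_comm],
    ← hg.mul_inv b a]
  exact Finset.sum_congr rfl fun c _ => by rw [hg.symm_inv a c, hg.symm c b, mul_comm]

lemma IsMetricPair.lower_raise (hg : IsMetricPair g gi) (L : n → R) (a : n) :
    ∑ d, g a d * ∑ e, gi d e * L e = L a := by
  simp_rw [Finset.mul_sum, ← mul_assoc]
  rw [Finset.sum_comm]
  simp_rw [← Finset.sum_mul, hg.mul_inv]
  simp

lemma IsMetricPair.raise_lower (hg : IsMetricPair g gi) (L : n → R) (a : n) :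
    ∑ d, gi a d * ∑ e, g d e * L e = L a := by
  simp_rw [Finset.mul_sum, ← mul_assoc]
  rw [Finset.sum_comm]
  simp_rw [← Finset.sum_mul, hg.inv_mul]
  simp

lemma lower_aChr (hg : IsMetricPair g gi) (a b c : n) :
    ∑ d, g a d * aChr D g gi d b c = half R * (D b (g a c) + D c (g a b) - D a (g b c)) := by
  have := hg.lower_raise (fun d => half R * (D b (g d c) + D c (g d b) - D d (g b c))) a
  rw [← this]
  refine Finset.sum_congr rfl fun d _ => ?_
  rw [aChr, Finset.mul_sum]
  congr 1
  exact Finset.sum_congr rfl fun e _ => by ring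

lemma aChr_symm (hg : IsMetricPair g gi) (a b c : n) :
    aChr D g gi a b c = aChr D g gi a c b := by
  unfold aChr
  congr 1
  exact Finset.sum_congr rfl fun d _ => by rw [hg.symm b c]; ring

lemma metric_compat (hg : IsMetricPair g gi) (a b c : n) :
    D c (g a b) = ∑ m, (aChr D g gi m c a * g m b + aChr D g gi m c b * g a m) := by
  rw [Finset.sum_add_distrib]
  have h1 := lower_aChr D hg b c a
  have h2 := lower_aChr D hg a c b
  have e1 : ∑ m, aChr D g gi m c a * g m b = ∑ d, g b d * aChr D g gi d c a :=
    Finset.sum_congr rfl fun d _ => by rw [hg.symm d b, mul_comm]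
  have e2 : ∑ m, aChr D g gi m c b * g a m = ∑ d, g a d * aChr D g gi d c b :=
    Finset.sum_congr rfl fun d _ => by rw [mul_comm]
  rw [e1, e2, h1, h2, hg.symm b a, hg.symm b c, hg.symm c a]
  linear_combination (-D c (g a b)) * two_mul_half (R := R)

/-- Obtained by differentiating `g g⁻¹ = 1`. The derivation is arbitrary because both `∂_c` and the
variation `δ` are needed. -/
lemma derivation_inv (hg : IsMetricPair g gi) (δ : Derivation ℂ R R) (a b : n) :
    δ (gi a b) = -∑ c, ∑ d, gi a c * δ (g c d) * gi d b := by
  have key : ∀ c, ∑ d, g c d * δ (gi d b) = -∑ d, δ (g c d) * gi d b := by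
    intro c
    have h := congrArg δ (hg.mul_inv c b)
    have h0 : δ (if c = b then (1 : R) else 0) = 0 := by split_ifs <;> simp
    rw [h0, map_sum] at h
    simp only [Derivation.leibniz, smul_eq_mul, Finset.sum_add_distrib] at h
    rw [eq_neg_iff_add_eq_zero, ← h]
    congr 1
    exact Finset.sum_congr rfl fun d _ => mul_comm _ _
  have h := hg.raise_lower (fun d => δ (gi d b)) a
  simp only [key] at h
  rw [← h, ← Finset.sum_neg_distrib]
  refine Finset.sum_congr rfl fun c _ => ?_
  rw [mul_neg, Finset.mul_sum]
  simp only [mul_assoc]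

lemma inv_compat (hg : IsMetricPair g gi) (a b c : n) :
    D c (gi a b) = -∑ m, (aChr D g gi a c m * gi m b + aChr D g gi b c m * gi a m) := by
  rw [derivation_inv hg (D c)]
  congr 1
  simp_rw [metric_compat D hg, Finset.mul_sum, Finset.sum_mul, mul_add, add_mul,
    Finset.sum_add_distrib]
  rw [add_comm]
  congr 1
  · calc ∑ k, ∑ d, ∑ m, gi a k * (aChr D g gi m c d * g k m) * gi d b
        = ∑ d, ∑ m, (∑ k, gi a k * g k m) * (aChr D g gi m c d * gi d b) := by
          rw [Finset.sum_comm]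
          refine Finset.sum_congr rfl fun d _ => ?_
          rw [Finset.sum_comm]
          refine Finset.sum_congr rfl fun m _ => ?_
          rw [Finset.sum_mul]
          exact Finset.sum_congr rfl fun k _ => by ring
      _ = _ := by simp [hg.inv_mul]
  · calc ∑ k, ∑ d, ∑ m, gi a k * (aChr D g gi m c k * g m d) * gi d b
        = ∑ k, ∑ m, (∑ d, g m d * gi d b) * (aChr D g gi m c k * gi a k) := by
          refine Finset.sum_congr rfl fun k _ => ?_
          rw [Finset.sum_comm]
          refine Finset.sum_congr rfl fun m _ => ?_
          rw [Finset.sum_mul]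
          exact Finset.sum_congr rfl fun d _ => by ring
      _ = _ := by simp [hg.mul_inv]

/-- Covariant differentiation commutes with contraction because the inverse metric is parallel
(`inv_compat`). -/
lemma derivation_aTr (hg : IsMetricPair g gi) (T : n → n → R) (c : n) :
    D c (aTr gi T) = ∑ a, ∑ b, gi a b * cov2 D (aChr D g gi) T c a b := by
  simp only [aTr, map_sum, Derivation.leibniz, smul_eq_mul, cov2, inv_compat D hg, mul_sub,
    Finset.sum_sub_distrib, Finset.sum_add_distrib, mul_neg, Finset.sum_neg_distrib, mul_add,
    Finset.mul_sum]
  rw [← sub_eq_add_neg]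
  congr 1
  congr 1
  · calc ∑ a, ∑ b, ∑ m, T a b * (aChr D g gi a c m * gi m b)
        = ∑ m, ∑ b, ∑ a, T a b * (aChr D g gi a c m * gi m b) := by
          rw [Finset.sum_comm]
          conv_rhs => rw [Finset.sum_comm]
          exact Finset.sum_congr rfl fun b _ => Finset.sum_comm
      _ = _ := Finset.sum_congr rfl fun a _ => Finset.sum_congr rfl fun b _ =>
          Finset.sum_congr rfl fun m _ => by ring
  · refine Finset.sum_congr rfl fun a _ => ?_
    rw [Finset.sum_comm]
    exact Finset.sum_congr rfl fun b _ => Finset.sum_congr rfl fun m _ => by ring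

lemma cov1_aTr (hg : IsMetricPair g gi) (U : n → n → n → R) (c d : n) :
    cov1 D (aChr D g gi) (fun d => aTr gi (U d)) c d
      = ∑ a, ∑ b, gi a b * cov3 D (aChr D g gi) U c d a b := by
  rw [cov1, derivation_aTr D hg]
  simp only [aTr, cov2, cov3, Finset.mul_sum]
  rw [show ∑ m, ∑ a, ∑ b, aChr D g gi m c d * (gi a b * U m a b)
      = ∑ a, ∑ b, ∑ m, aChr D g gi m c d * (gi a b * U m a b) by
    rw [Finset.sum_comm]; exact Finset.sum_congr rfl fun b _ => Finset.sum_comm]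
  simp only [← Finset.sum_sub_distrib, mul_sub, Finset.mul_sum]
  refine Finset.sum_congr rfl fun a _ => Finset.sum_congr rfl fun b _ => ?_
  rw [sub_sub, ← Finset.sum_add_distrib]
  congr 1
  exact Finset.sum_congr rfl fun m _ => by ring

end General

end Algebraic

end SDEinstein

end

noncomputable section

namespace SDEinstein

set_option linter.unusedSectionVars false

/-! ### Variation of the Christoffel symbols, the Riemann tensor and the Ricci tensor -/

section Linearisation

variable {R : Type*} [CommRing R] [Algebra ℂ R]
variable {D : Fin 4 → Derivation ℂ R R} {δ : Derivation ℂ R R} {g gi h : Fin 4 → Fin 4 → R}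

/-- Second covariant derivatives of a tensor with two indices, for the connection of `g`. -/
def aHess2 (D : Fin 4 → Derivation ℂ R R) (g gi h : Fin 4 → Fin 4 → R) :
    Fin 4 → Fin 4 → Fin 4 → Fin 4 → R :=
  cov3 D (aChr D g gi) (cov2 D (aChr D g gi) h)

/-- The variation of the Riemann tensor (with its first index lowered after the variation). -/
def linRiem (H : Fin 4 → Fin 4 → Fin 4 → Fin 4 → R) (a b c d : Fin 4) : R :=
  half R * (H c d a b + H c b a d - H c a d b - H d c a b - H d b a c + H d a c b)

/-- The variation of the Ricci tensor. -/
def linRicci (D : Fin 4 → Derivation ℂ R R) (g gi h : Fin 4 → Fin 4 → R) (a b : Fin 4) : R :=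
  -(half R * ∑ c, ∑ d, gi c d * aHess2 D g gi h c d a b)
    - half R * cov1 D (aChr D g gi) (fun b => D b (aTr gi h)) a b
    + ∑ c, ∑ d, gi c d * (half R * (aHess2 D g gi h d a b c + aHess2 D g gi h d b a c))

/-- `δ` is applied to the lowered Christoffel formula `lower_aChr`. The term in which `δ` hits the
metric is exactly what turns the partial derivatives of `h` into covariant ones. -/
lemma lower_variation_aChr (hg : IsMetricPair g gi) (hD : ∀ a f, δ (D a f) = D a (δ f))
    (hδ : ∀ a b, δ (g a b) = h a b) (a b c : Fin 4) :
    ∑ d, g a d * δ (aChr D g gi d b c)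
      = half R * (cov2 D (aChr D g gi) h b a c + cov2 D (aChr D g gi) h c a b
          - cov2 D (aChr D g gi) h a b c) := by
  have h1 := congrArg δ (lower_aChr D hg a b c)
  simp only [map_sum, Derivation.leibniz, smul_eq_mul, Finset.sum_add_distrib, map_add, map_sub,
    hD, hδ, derivation_half, mul_zero, add_zero] at h1
  have hs : ∀ a b, h a b = h b a := fun a b => by rw [← hδ, ← hδ, hg.symm]
  have e1 : ∀ x y z w, ∑ m, (aChr D g gi m x y * h m z + aChr D g gi m x w * h y m)
      = ∑ m, aChr D g gi m x y * h m z + ∑ m, aChr D g gi m x w * h y m :=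
    fun x y z w => Finset.sum_add_distrib
  simp only [cov2, e1]
  have s1 : ∀ x y z, ∑ m, aChr D g gi m x y * h m z = ∑ m, h z m * aChr D g gi m x y :=
    fun x y z => Finset.sum_congr rfl fun m _ => by rw [hs m z, mul_comm]
  have s2 : ∀ x y z, ∑ m, aChr D g gi m x y * h z m = ∑ m, h z m * aChr D g gi m x y :=
    fun x y z => Finset.sum_congr rfl fun m _ => by rw [mul_comm]
  have s3 : ∀ x y z, ∑ m, h z m * aChr D g gi m x y = ∑ m, h z m * aChr D g gi m y x :=
    fun x y z => Finset.sum_congr rfl fun m _ => by rw [aChr_symm D hg]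
  have s4 : ∑ m, aChr D g gi m b c * h a m = ∑ m, h a m * aChr D g gi m b c := s2 _ _ _
  simp only [s1, s2]
  rw [s3 b a c, s3 c a b, s3 c b a, hs b c, hs a c, hs a b]
  rw [hs b c, hs a c, hs a b] at h1
  have t : ∑ x, aChr D g gi x b c * h a x = ∑ m, h a m * aChr D g gi m b c := s2 _ _ _
  linear_combination h1 - t + (∑ m, h a m * aChr D g gi m b c) * two_mul_half (R := R)

/-- The Palatini identity: the variation of the curvature is the antisymmetrised covariant
derivative of the tensor `δΓ`. Lowering the index after the variation avoids an additional term `h ·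
Riem`, which is restored in `aLinWeyl`. -/
lemma lower_variation_aRiem (hg : IsMetricPair g gi) (hD : ∀ a f, δ (D a f) = D a (δ f))
    (hδ : ∀ a b, δ (g a b) = h a b) (a b c d : Fin 4) :
    ∑ e, g a e * δ (aRiem D (aChr D g gi) e b c d) = linRiem (aHess2 D g gi h) a b c d := by
  have hA := lower_variation_aChr hg hD hδ
  have hs : ∀ a b, h a b = h b a := fun a b => by rw [← hδ, ← hδ, hg.symm]
  have hΓ := aChr_symm D hg
  have hc := metric_compat D hg
  generalize hN : cov2 D (aChr D g gi) h = N at hA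
  have hNs : ∀ a b c, N a b c = N a c b := by
    intro a b c
    rw [← hN]
    simp only [cov2]
    rw [hs b c]
    congr 1
    refine Finset.sum_congr rfl fun m _ => ?_
    rw [hs m c, hs b m]; ring
  have key : ∀ c d, ∑ e, g a e * (D c (δ (aChr D g gi e d b))
        + ∑ f, δ (aChr D g gi e c f) * aChr D g gi f d b
        + ∑ f, aChr D g gi e c f * δ (aChr D g gi f d b))
      = half R * (D c (N d a b) + D c (N b a d) - D c (N a d b))
        - ∑ m, aChr D g gi m c a * (half R * (N d m b + N b m d - N m d b))
        + ∑ m, aChr D g gi m d b * (half R * (N c a m + N m a c - N a c m)) := by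
    intro c d
    have h1 := congrArg (D c) (hA a d b)
    simp only [← hA]
    simp only [map_sum, map_add, map_sub, Derivation.leibniz, smul_eq_mul, derivation_half, hc]
      at h1
    simp only [Fin.sum_univ_four] at h1 ⊢
    linear_combination h1
  have k1 := key c d
  have k2 := key d c
  simp only [aRiem, map_sub, map_add, map_sum, Derivation.leibniz, smul_eq_mul, hD]
  calc _ = (∑ e, g a e * (D c (δ (aChr D g gi e d b))
        + ∑ f, δ (aChr D g gi e c f) * aChr D g gi f d b
        + ∑ f, aChr D g gi e c f * δ (aChr D g gi f d b)))
      - ∑ e, g a e * (D d (δ (aChr D g gi e c b))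
        + ∑ f, δ (aChr D g gi e d f) * aChr D g gi f c b
        + ∑ f, aChr D g gi e d f * δ (aChr D g gi f c b)) := by
        rw [← Finset.sum_sub_distrib]
        refine Finset.sum_congr rfl fun e _ => ?_
        simp only [Fin.sum_univ_four]
        ring
    _ = _ := by
        rw [k1, k2]
        simp only [linRiem, aHess2, hN, cov3]
        have hdc : ∀ x, aChr D g gi x d c = aChr D g gi x c d := fun x => hΓ x d c
        simp only [Fin.sum_univ_four, hdc]
        ring

lemma aHess2_symm (hs : ∀ a b, h a b = h b a) (a b c d : Fin 4) :
    aHess2 D g gi h a b c d = aHess2 D g gi h a b d c := by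
  have hN : ∀ a b c, cov2 D (aChr D g gi) h a b c = cov2 D (aChr D g gi) h a c b := by
    intro a b c
    simp only [cov2]
    rw [hs b c]
    congr 1
    refine Finset.sum_congr rfl fun m _ => ?_
    rw [hs m c, hs b m]; ring
  simp only [aHess2, cov3]
  rw [hN b c d]
  congr 1
  refine Finset.sum_congr rfl fun m _ => ?_
  rw [hN m c d, hN b m d, hN b c m]; ring

/-- The trace of the Palatini identity. Two of the six second derivatives cancel because the inverse
metric is symmetric, and two others are put in the stated order by symmetry of the Hessian of the
scalar `tr h`. -/
lemma variation_aRicci (hg : IsMetricPair g gi) (hD : ∀ a f, δ (D a f) = D a (δ f))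
    (hDD : ∀ a b f, D a (D b f) = D b (D a f))
    (hδ : ∀ a b, δ (g a b) = h a b) (b d : Fin 4) :
    δ (∑ a, aRiem D (aChr D g gi) a b a d) = linRicci D g gi h b d := by
  have hs : ∀ a b, h a b = h b a := fun a b => by rw [← hδ, ← hδ, hg.symm]
  have h1 : ∀ a, δ (aRiem D (aChr D g gi) a b a d)
      = ∑ c, gi a c * linRiem (aHess2 D g gi h) c b a d := by
    intro a
    simp only [← lower_variation_aRiem hg hD hδ]
    exact (hg.raise_lower (fun e => δ (aRiem D (aChr D g gi) e b a d)) a).symm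
  have htr : ∀ c d, cov1 D (aChr D g gi) (fun b => D b (aTr gi h)) c d
      = ∑ a, ∑ b, gi a b * aHess2 D g gi h c d a b := by
    intro c d
    rw [aHess2, ← cov1_aTr D hg]
    congr 1
    funext b
    rw [derivation_aTr D hg, aTr]
  have hsymm : cov1 D (aChr D g gi) (fun b => D b (aTr gi h)) b d
      = cov1 D (aChr D g gi) (fun b => D b (aTr gi h)) d b := by
    simp only [cov1]
    rw [hDD]
    congr 1
    exact Finset.sum_congr rfl fun m _ => by rw [aChr_symm D hg]
  rw [map_sum]
  simp only [h1, linRicci]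
  rw [hsymm, htr]
  have hHs := aHess2_symm (D := D) (g := g) (gi := gi) hs
  generalize aHess2 D g gi h = H at hHs
  have hsw : ∀ X : Fin 4 → Fin 4 → R, ∑ a, ∑ c, gi a c * X c a = ∑ a, ∑ c, gi a c * X a c := by
    intro X
    rw [Finset.sum_comm]
    exact Finset.sum_congr rfl fun m _ => Finset.sum_congr rfl fun k _ => by
      rw [hg.symm_inv]
  have h6 := hsw (fun a c => H d a b c)
  rw [hsw (fun a c => half R * (H a b d c + H a d b c))]
  simp only [linRiem, hHs _ _ _ b]
  simp only [hHs _ b _ d, hHs d b _ _]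
  simp only [Fin.sum_univ_four] at h6 ⊢
  linear_combination half R * h6

end Linearisation

end SDEinstein

end

noncomputable section

namespace SDEinstein

set_option linter.unusedSectionVars false

open TopologicalSpace (Opens)

/-! ### Curvature over a ring with derivations, and comparison with the chart expressions -/

section Curvature

variable {R : Type*} [CommRing R] [Algebra ℂ R] (D : Fin 4 → Derivation ℂ R R)
  (g gi h : Fin 4 → Fin 4 → R)

/-- The Riemann tensor with lower indices. -/
def aRiemLow (a b c d : Fin 4) : R := ∑ e, g a e * aRiem D (aChr D g gi) e b c d

/-- The Ricci tensor. -/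
def aRicci (b d : Fin 4) : R := ∑ a, aRiem D (aChr D g gi) a b a d

/-- The scalar curvature. -/
def aScal : R := ∑ a, ∑ b, gi a b * aRicci D g gi a b

/-- The Weyl tensor. -/
def aWeyl (a b c d : Fin 4) : R :=
  aRiemLow D g gi a b c d
    - half R * (g a c * aRicci D g gi b d - g a d * aRicci D g gi b c
        - g b c * aRicci D g gi a d + g b d * aRicci D g gi a c)
    + algebraMap ℂ R (1 / 6) * aScal D g gi * (g a c * g b d - g a d * g b c)

/-- The Einstein tensor. -/
def aEinstein (a b : Fin 4) : R := aRicci D g gi a b - half R * aScal D g gi * g a b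

/-- The scalar `∇^c ∇^d h_{cd} - □ tr h`. -/
def linScal : R :=
  (∑ c, ∑ d, ∑ e, ∑ k, gi c e * gi d k * aHess2 D g gi h c d e k)
    - aTr gi (cov1 D (aChr D g gi) (fun b => D b (aTr gi h)))

/-- The linearised Einstein operator. -/
def aLinEinstein (Λ : ℂ) (a b : Fin 4) : R :=
  linRicci D g gi h a b - half R * g a b * linScal D g gi h
    - algebraMap ℂ R Λ * h a b + half R * algebraMap ℂ R Λ * g a b * aTr gi h

end Curvature

/-! ### Chart expressions as elements of the ring of smooth functions -/

section Rep

variable {U : Opens (E4 × ℝ)}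

lemma val_half (x : U) : (half (SmoothRing U)).1 x = 1 / 2 := SmoothRing.val_algebraMap _ _

variable {G : ℝ → Tensor2} {g gi : Fin 4 → Fin 4 → SmoothRing U}

lemma rep_ginv (hG : ∀ a b, Rep U (fun ε => G ε a b) (g a b)) (hg : IsMetricPair g gi)
    (a b : Fin 4) : Rep U (fun ε => ginv (G ε) a b) (gi a b) := by
  intro y ε hy
  have : (Matrix.of fun i j => G ε i j y)⁻¹ = Matrix.of fun i j => (gi i j).1 ⟨(y, ε), hy⟩ := by
    apply Matrix.inv_eq_right_inv
    ext i j
    have h1 := congrArg (fun f : SmoothRing U => f.1 ⟨(y, ε), hy⟩) (hg.mul_inv i j)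
    simp only [SmoothRing.val_sum, SmoothRing.val_mul] at h1
    simp only [Matrix.mul_apply, Matrix.of_apply, Matrix.one_apply, hG _ _ y ε hy, h1]
    split_ifs <;> rfl
  simp only [ginv, this, Matrix.of_apply]

lemma rep_christoffel (hG : ∀ a b, Rep U (fun ε => G ε a b) (g a b)) (hg : IsMetricPair g gi)
    (a b c : Fin 4) : Rep U (fun ε => christoffel (G ε) a b c) (aChr (dc U) g gi a b c) := by
  intro y ε hy
  simp only [christoffel, aChr, SmoothRing.val_mul, SmoothRing.val_sum, SmoothRing.val_add,
    SmoothRing.val_sub, val_half, rep_ginv hG hg _ _ y ε hy, (hG _ _).pd _ y ε hy]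

lemma rep_nabla1 {v : ℝ → Tensor1} {f : Fin 4 → SmoothRing U}
    (hG : ∀ a b, Rep U (fun ε => G ε a b) (g a b)) (hg : IsMetricPair g gi)
    (hv : ∀ b, Rep U (fun ε => v ε b) (f b)) (a b : Fin 4) :
    Rep U (fun ε => nabla1 (G ε) (v ε) a b) (cov1 (dc U) (aChr (dc U) g gi) f a b) := by
  intro y ε hy
  simp only [nabla1, cov1, SmoothRing.val_mul, SmoothRing.val_sum, SmoothRing.val_sub,
    rep_christoffel hG hg _ _ _ y ε hy, (hv _).pd _ y ε hy, hv _ y ε hy]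

lemma rep_nabla2 {T : ℝ → Tensor2} {f : Fin 4 → Fin 4 → SmoothRing U}
    (hG : ∀ a b, Rep U (fun ε => G ε a b) (g a b)) (hg : IsMetricPair g gi)
    (hT : ∀ b c, Rep U (fun ε => T ε b c) (f b c)) (a b c : Fin 4) :
    Rep U (fun ε => nabla2 (G ε) (T ε) a b c) (cov2 (dc U) (aChr (dc U) g gi) f a b c) := by
  intro y ε hy
  simp only [nabla2, cov2, SmoothRing.val_mul, SmoothRing.val_sum, SmoothRing.val_sub,
    SmoothRing.val_add, rep_christoffel hG hg _ _ _ y ε hy, (hT _ _).pd _ y ε hy, hT _ _ y ε hy]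

lemma rep_nabla3 {T : ℝ → Tensor3} {f : Fin 4 → Fin 4 → Fin 4 → SmoothRing U}
    (hG : ∀ a b, Rep U (fun ε => G ε a b) (g a b)) (hg : IsMetricPair g gi)
    (hT : ∀ b c d, Rep U (fun ε => T ε b c d) (f b c d)) (a b c d : Fin 4) :
    Rep U (fun ε => nabla3 (G ε) (T ε) a b c d)
      (cov3 (dc U) (aChr (dc U) g gi) f a b c d) := by
  intro y ε hy
  simp only [nabla3, cov3, SmoothRing.val_mul, SmoothRing.val_sum, SmoothRing.val_sub,
    SmoothRing.val_add, rep_christoffel hG hg _ _ _ y ε hy, (hT _ _ _).pd _ y ε hy,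
    hT _ _ _ y ε hy]

lemma rep_hess2 {T : ℝ → Tensor2} {f : Fin 4 → Fin 4 → SmoothRing U}
    (hG : ∀ a b, Rep U (fun ε => G ε a b) (g a b)) (hg : IsMetricPair g gi)
    (hT : ∀ b c, Rep U (fun ε => T ε b c) (f b c)) (a b c d : Fin 4) :
    Rep U (fun ε => hess2 (G ε) (T ε) a b c d) (aHess2 (dc U) g gi f a b c d) :=
  rep_nabla3 hG hg (rep_nabla2 hG hg hT) a b c d

lemma rep_tr {T : ℝ → Tensor2} {f : Fin 4 → Fin 4 → SmoothRing U}
    (hG : ∀ a b, Rep U (fun ε => G ε a b) (g a b)) (hg : IsMetricPair g gi)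
    (hT : ∀ b c, Rep U (fun ε => T ε b c) (f b c)) :
    Rep U (fun ε => tr (G ε) (T ε)) (aTr gi f) := by
  intro y ε hy
  simp only [tr, aTr, SmoothRing.val_mul, SmoothRing.val_sum, rep_ginv hG hg _ _ y ε hy,
    hT _ _ y ε hy]

lemma rep_hess {F : ℝ → E4 → ℂ} {f : SmoothRing U}
    (hG : ∀ a b, Rep U (fun ε => G ε a b) (g a b)) (hg : IsMetricPair g gi)
    (hF : Rep U F f) (a b : Fin 4) :
    Rep U (fun ε => hess (G ε) (F ε) a b)
      (cov1 (dc U) (aChr (dc U) g gi) (fun b => dc U b f) a b) :=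
  rep_nabla1 hG hg (v := fun ε b => pd b (F ε)) (fun b => hF.pd b) a b

lemma rep_riemannUp (hG : ∀ a b, Rep U (fun ε => G ε a b) (g a b)) (hg : IsMetricPair g gi)
    (a b c d : Fin 4) :
    Rep U (fun ε => riemannUp (G ε) a b c d) (aRiem (dc U) (aChr (dc U) g gi) a b c d) := by
  intro y ε hy
  simp only [riemannUp, aRiem, SmoothRing.val_mul, SmoothRing.val_sum, SmoothRing.val_sub,
    SmoothRing.val_add, rep_christoffel hG hg _ _ _ y ε hy,
    (rep_christoffel hG hg _ _ _).pd _ y ε hy]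

lemma rep_riemann (hG : ∀ a b, Rep U (fun ε => G ε a b) (g a b)) (hg : IsMetricPair g gi)
    (a b c d : Fin 4) :
    Rep U (fun ε => riemann (G ε) a b c d) (aRiemLow (dc U) g gi a b c d) := by
  intro y ε hy
  simp only [riemann, aRiemLow, SmoothRing.val_mul, SmoothRing.val_sum, hG _ _ y ε hy,
    rep_riemannUp hG hg _ _ _ _ y ε hy]

lemma rep_ricci (hG : ∀ a b, Rep U (fun ε => G ε a b) (g a b)) (hg : IsMetricPair g gi)
    (a b : Fin 4) : Rep U (fun ε => ricci (G ε) a b) (aRicci (dc U) g gi a b) := by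
  intro y ε hy
  simp only [ricci, aRicci, SmoothRing.val_sum, rep_riemannUp hG hg _ _ _ _ y ε hy]

lemma rep_scalarCurv (hG : ∀ a b, Rep U (fun ε => G ε a b) (g a b)) (hg : IsMetricPair g gi) :
    Rep U (fun ε => scalarCurv (G ε)) (aScal (dc U) g gi) := by
  intro y ε hy
  simp only [scalarCurv, aScal, SmoothRing.val_mul, SmoothRing.val_sum,
    rep_ginv hG hg _ _ y ε hy, rep_ricci hG hg _ _ y ε hy]

lemma rep_weyl (hG : ∀ a b, Rep U (fun ε => G ε a b) (g a b)) (hg : IsMetricPair g gi)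
    (a b c d : Fin 4) :
    Rep U (fun ε => weyl (G ε) a b c d) (aWeyl (dc U) g gi a b c d) := by
  intro y ε hy
  simp only [weyl, aWeyl, SmoothRing.val_mul, SmoothRing.val_sub, SmoothRing.val_add, val_half,
    SmoothRing.val_algebraMap, hG _ _ y ε hy, rep_riemann hG hg _ _ _ _ y ε hy,
    rep_ricci hG hg _ _ y ε hy, rep_scalarCurv hG hg y ε hy]

lemma rep_einstein (hG : ∀ a b, Rep U (fun ε => G ε a b) (g a b)) (hg : IsMetricPair g gi)
    (a b : Fin 4) : Rep U (fun ε => einstein (G ε) a b) (aEinstein (dc U) g gi a b) := by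
  intro y ε hy
  simp only [einstein, aEinstein, SmoothRing.val_mul, SmoothRing.val_sub, val_half,
    hG _ _ y ε hy, rep_ricci hG hg _ _ y ε hy, rep_scalarCurv hG hg y ε hy]

lemma rep_linEinstein {T : ℝ → Tensor2} {f : Fin 4 → Fin 4 → SmoothRing U}
    (hG : ∀ a b, Rep U (fun ε => G ε a b) (g a b)) (hg : IsMetricPair g gi)
    (hT : ∀ b c, Rep U (fun ε => T ε b c) (f b c)) (Λ : ℂ) (a b : Fin 4) :
    Rep U (fun ε => linEinstein (G ε) Λ (T ε) a b) (aLinEinstein (dc U) g gi f Λ a b) := by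
  intro y ε hy
  have htr := rep_tr hG hg hT
  have h2 : ∀ a b, hess (G ε) (tr (G ε) (T ε)) a b y = _ :=
    fun a b => rep_hess hG hg htr a b y ε hy
  have h3 : tr (G ε) (hess (G ε) (tr (G ε) (T ε))) y = _ :=
    rep_tr hG hg (fun a b => rep_hess hG hg htr a b) y ε hy
  simp only [linEinstein, aLinEinstein, linRicci, linScal, SmoothRing.val_mul,
    SmoothRing.val_sub, SmoothRing.val_neg,
    SmoothRing.val_add, val_half, SmoothRing.val_sum, SmoothRing.val_algebraMap,
    rep_ginv hG hg _ _ y ε hy, h2, h3, rep_hess2 hG hg hT _ _ _ _ y ε hy, htr y ε hy,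
    hG _ _ y ε hy, hT _ _ y ε hy]
  ring

end Rep

end SDEinstein

end

noncomputable section

namespace SDEinstein

set_option linter.unusedSectionVars false

open TopologicalSpace (Opens)

/-! ### Linearisation of the curvature -/

section Variation

variable {R : Type*} [CommRing R] [Algebra ℂ R]
variable {D : Fin 4 → Derivation ℂ R R} {δ : Derivation ℂ R R} {g gi h : Fin 4 → Fin 4 → R}

lemma hessian_trace (hg : IsMetricPair g gi) (c d : Fin 4) :
    cov1 D (aChr D g gi) (fun b => D b (aTr gi h)) c d
      = ∑ a, ∑ b, gi a b * aHess2 D g gi h c d a b := by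
  rw [aHess2, ← cov1_aTr D hg]
  congr 1
  funext b
  rw [derivation_aTr D hg, aTr]

lemma sum_comm_pairs (X : Fin 4 → Fin 4 → Fin 4 → Fin 4 → R) :
    ∑ a, ∑ b, ∑ c, ∑ d, X a b c d = ∑ c, ∑ d, ∑ a, ∑ b, X a b c d := by
  have := Finset.sum_comm (s := Finset.univ) (t := Finset.univ)
    (f := fun p q : Fin 4 × Fin 4 => X p.1 p.2 q.1 q.2)
  simpa only [Fintype.sum_prod_type] using this

/-- Identifies the derivative part of the variation of the scalar curvature. The two mixed terms
have equal traces, and so do `□ h` and the Hessian of `tr h`, hence the halves add up. -/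
lemma trace_linRicci (hg : IsMetricPair g gi) (hs : ∀ a b, h a b = h b a) :
    aTr gi (linRicci D g gi h) = linScal D g gi h := by
  have hH := aHess2_symm (D := D) (g := g) (gi := gi) hs
  have e1 : aTr gi (cov1 D (aChr D g gi) (fun b => D b (aTr gi h)))
      = ∑ a, ∑ b, gi a b * ∑ c, ∑ d, gi c d * aHess2 D g gi h c d a b := by
    simp only [aTr, Finset.mul_sum]
    rw [sum_comm_pairs]
    refine Finset.sum_congr rfl fun c _ => Finset.sum_congr rfl fun d _ => ?_
    have := hessian_trace (D := D) (h := h) hg c d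
    simp only [aTr] at this
    rw [this, Finset.mul_sum]
    refine Finset.sum_congr rfl fun a _ => ?_
    rw [Finset.mul_sum]
    exact Finset.sum_congr rfl fun b _ => by ring
  have e2 : ∑ a, ∑ b, gi a b * ∑ c, ∑ d, gi c d * aHess2 D g gi h d a b c
      = ∑ c, ∑ d, ∑ e, ∑ k, gi c e * gi d k * aHess2 D g gi h c d e k := by
    simp only [Finset.mul_sum]
    calc _ = ∑ a, ∑ b, ∑ d, ∑ c, gi d c * gi a b * aHess2 D g gi h d a c b := by
          refine Finset.sum_congr rfl fun a _ => Finset.sum_congr rfl fun b _ => ?_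
          rw [Finset.sum_comm]
          refine Finset.sum_congr rfl fun d _ => Finset.sum_congr rfl fun c _ => ?_
          rw [hg.symm_inv c d, hH d a b c]; ring
      _ = ∑ d, ∑ c, ∑ a, ∑ b, gi d c * gi a b * aHess2 D g gi h d a c b := sum_comm_pairs _
      _ = _ := Finset.sum_congr rfl fun d _ => Finset.sum_comm
  have e3 : ∑ a, ∑ b, gi a b * ∑ c, ∑ d, gi c d * aHess2 D g gi h d b a c
      = ∑ c, ∑ d, ∑ e, ∑ k, gi c e * gi d k * aHess2 D g gi h c d e k := by
    rw [← e2, Finset.sum_comm]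
    exact Finset.sum_congr rfl fun a _ => Finset.sum_congr rfl fun b _ => by
      rw [hg.symm_inv]
  have e4 : aTr gi (linRicci D g gi h)
      = -(half R * ∑ a, ∑ b, gi a b * ∑ c, ∑ d, gi c d * aHess2 D g gi h c d a b)
        - half R * aTr gi (cov1 D (aChr D g gi) (fun b => D b (aTr gi h)))
        + half R * (∑ a, ∑ b, gi a b * ∑ c, ∑ d, gi c d * aHess2 D g gi h d a b c)
        + half R * (∑ a, ∑ b, gi a b * ∑ c, ∑ d, gi c d * aHess2 D g gi h d b a c) := by
    rw [aTr]
    conv_rhs => rw [aTr]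
    simp only [Finset.mul_sum (s := Finset.univ) (a := half R), ← Finset.sum_sub_distrib,
      ← Finset.sum_add_distrib, ← Finset.sum_neg_distrib]
    refine Finset.sum_congr rfl fun a _ => Finset.sum_congr rfl fun b _ => ?_
    rw [linRicci]
    simp only [mul_left_comm _ (half R), mul_add, Finset.sum_add_distrib, ← Finset.mul_sum]
    ring
  rw [e4, linScal, e1, e2, e3]
  linear_combination (-(∑ a, ∑ b, gi a b * ∑ c, ∑ d, gi c d * aHess2 D g gi h c d a b)
    + ∑ c, ∑ d, ∑ e, ∑ k, gi c e * gi d k * aHess2 D g gi h c d e k) * two_mul_half (R := R)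

lemma variation_aScal (hg : IsMetricPair g gi) (hD : ∀ a f, δ (D a f) = D a (δ f))
    (hDD : ∀ a b f, D a (D b f) = D b (D a f)) (hδ : ∀ a b, δ (g a b) = h a b) :
    δ (aScal D g gi) = linScal D g gi h
      - ∑ a, ∑ b, (∑ c, ∑ d, gi a c * h c d * gi d b) * aRicci D g gi a b := by
  have hs : ∀ a b, h a b = h b a := fun a b => by rw [← hδ, ← hδ, hg.symm]
  have hric : ∀ a b, δ (aRicci D g gi a b) = linRicci D g gi h a b :=
    variation_aRicci hg hD hDD hδ
  rw [← trace_linRicci hg hs]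
  simp only [aScal, aTr, map_sum, Derivation.leibniz, smul_eq_mul, hric, derivation_inv hg δ, hδ,
    Finset.sum_add_distrib, mul_neg, Finset.sum_neg_distrib, sub_eq_add_neg]
  congr 2
  exact Finset.sum_congr rfl fun a _ => Finset.sum_congr rfl fun b _ => mul_comm (aRicci D g gi a b) _

/-- The variation of the Weyl tensor. -/
def aLinWeyl (D : Fin 4 → Derivation ℂ R R) (g gi h : Fin 4 → Fin 4 → R) (a b c d : Fin 4) : R :=
  ∑ e, h a e * aRiem D (aChr D g gi) e b c d + linRiem (aHess2 D g gi h) a b c d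
    - half R * (h a c * aRicci D g gi b d + g a c * linRicci D g gi h b d
        - (h a d * aRicci D g gi b c + g a d * linRicci D g gi h b c)
        - (h b c * aRicci D g gi a d + g b c * linRicci D g gi h a d)
        + (h b d * aRicci D g gi a c + g b d * linRicci D g gi h a c))
    + algebraMap ℂ R (1 / 6) * ((linScal D g gi h
        - ∑ a, ∑ b, (∑ c, ∑ d, gi a c * h c d * gi d b) * aRicci D g gi a b)
          * (g a c * g b d - g a d * g b c)
        + aScal D g gi * (h a c * g b d + g a c * h b d - (h a d * g b c + g a d * h b c)))

lemma variation_aWeyl (hg : IsMetricPair g gi) (hD : ∀ a f, δ (D a f) = D a (δ f))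
    (hDD : ∀ a b f, D a (D b f) = D b (D a f)) (hδ : ∀ a b, δ (g a b) = h a b)
    (a b c d : Fin 4) : δ (aWeyl D g gi a b c d) = aLinWeyl D g gi h a b c d := by
  have hric : ∀ a b, δ (aRicci D g gi a b) = linRicci D g gi h a b :=
    variation_aRicci hg hD hDD hδ
  have h6 : δ (algebraMap ℂ R (1 / 6)) = 0 := δ.map_algebraMap _
  rw [aLinWeyl, ← lower_variation_aRiem hg hD hδ, ← variation_aScal hg hD hDD hδ]
  simp only [aWeyl, aRiemLow, map_add, map_sub, map_sum, Derivation.leibniz, smul_eq_mul, hric, hδ,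
    derivation_half, h6, Finset.sum_add_distrib]
  rw [show ∑ e, aRiem D (aChr D g gi) e b c d * h a e = ∑ e, h a e * aRiem D (aChr D g gi) e b c d
    from Finset.sum_congr rfl fun _ _ => mul_comm _ _]
  ring

/-- The Einstein equation is assumed only after evaluation by `ev`, at one point with `ε = 0`. The
perturbed metrics need not be Einstein, so the equation is substituted only after `δ` has been
applied. -/
lemma variation_aEinstein (hg : IsMetricPair g gi) (hD : ∀ a f, δ (D a f) = D a (δ f))
    (hDD : ∀ a b f, D a (D b f) = D b (D a f)) (hδ : ∀ a b, δ (g a b) = h a b)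
    (ev : R →+* ℂ) (hev : ∀ c, ev (algebraMap ℂ R c) = c) (Λ : ℂ)
    (hric : ∀ a b, ev (aRicci D g gi a b) = Λ * ev (g a b)) (a b : Fin 4) :
    ev (δ (aEinstein D g gi a b + algebraMap ℂ R Λ * g a b))
      = ev (aLinEinstein D g gi h Λ a b) := by
  have hδric : ∀ a b, δ (aRicci D g gi a b) = linRicci D g gi h a b :=
    variation_aRicci hg hD hDD hδ
  have hs : ∀ a b, h a b = h b a := fun a b => by rw [← hδ, ← hδ, hg.symm]
  have hh : ev (half R) = 1 / 2 := hev _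
  have hsc : ev (aScal D g gi) = 4 * Λ := by
    have : ∀ a, ∑ b, gi a b * g b a = 1 := fun a => by simpa using hg.inv_mul a a
    have h2 : ∀ a, ∑ b, ev (gi a b) * ev (g a b) = 1 := fun a => by
      have := congrArg ev (this a)
      simpa [map_sum, hg.symm a] using this
    simp only [aScal, map_sum, map_mul, hric]
    simp only [mul_left_comm _ Λ, ← Finset.mul_sum, h2]
    simp; ring
  have htr : ev (∑ a, ∑ b, (∑ c, ∑ d, gi a c * h c d * gi d b) * aRicci D g gi a b)
      = Λ * ev (aTr gi h) := by
    have h1 : ∑ a, ∑ b, (∑ c, ∑ d, gi a c * h c d * gi d b) * g a b = aTr gi h := by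
      simp only [Finset.sum_mul]
      calc ∑ a, ∑ b, ∑ c, ∑ d, gi a c * h c d * gi d b * g a b
          = ∑ a, ∑ c, ∑ d, gi a c * h c d * ∑ b, gi d b * g b a := by
            refine Finset.sum_congr rfl fun a _ => ?_
            rw [Finset.sum_comm]
            refine Finset.sum_congr rfl fun c _ => ?_
            rw [Finset.sum_comm]
            refine Finset.sum_congr rfl fun d _ => ?_
            rw [Finset.mul_sum]
            exact Finset.sum_congr rfl fun b _ => by rw [hg.symm a b]; ring
        _ = _ := by
            simp only [hg.inv_mul, aTr]
            refine Finset.sum_congr rfl fun a _ => Finset.sum_congr rfl fun c _ => ?_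
            simp [hs c a]
    rw [← h1]
    simp only [map_sum, map_mul, hric, Finset.mul_sum]
    exact Finset.sum_congr rfl fun a _ => Finset.sum_congr rfl fun c _ => by ring
  have hΛ : δ (algebraMap ℂ R Λ) = 0 := δ.map_algebraMap _
  simp only [aEinstein, aLinEinstein, map_add, map_sub, Derivation.leibniz, smul_eq_mul,
    derivation_half, hΛ, hδric, hδ, variation_aScal hg hD hDD hδ, map_mul, hev, hh, hsc, htr,
    map_zero]
  ring

end Variation

end SDEinstein

end

noncomputable section

namespace SDEinstein

set_option linter.unusedSectionVars false

open TopologicalSpace (Opens)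

/-! ### The metric `g + ε h` near `ε = 0`, and derivatives of its curvature -/

section Perturbation

lemma perturb_zero (G h : Tensor2) : perturb G h 0 = G := by
  funext a b y; simp [perturb]

/-- A nowhere vanishing determinant is a unit of the ring of smooth functions, so the matrix inverse
exists inside that ring. -/
lemma exists_isMetricPair {U : Opens (E4 × ℝ)} (g : Fin 4 → Fin 4 → SmoothRing U)
    (hs : ∀ a b, g a b = g b a)
    (hdet : ∀ x, (Matrix.of fun i j => (g i j).1 x).det ≠ 0) : ∃ gi, IsMetricPair g gi := by
  have hu : IsUnit (Matrix.of g).det := by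
    apply SmoothRing.isUnit_of_ne_zero
    intro x
    have := hdet x
    rw [show (Matrix.of fun i j => (g i j).1 x) = (SmoothRing.evalHom x).mapMatrix (Matrix.of g)
      from rfl, ← RingHom.map_det] at this
    exact this
  have hsym : (Matrix.of g).transpose = Matrix.of g := by ext1 i j; exact hs j i
  refine ⟨fun i j => (Matrix.of g)⁻¹ i j, hs, fun a b => ?_, fun a b => ?_⟩
  · rw [← Matrix.transpose_apply (Matrix.of g)⁻¹, Matrix.transpose_nonsing_inv, hsym]
  · have := congrFun (congrFun (Matrix.mul_nonsing_inv _ hu) a) b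
    simpa [Matrix.mul_apply, Matrix.one_apply] using this

variable {U : Opens (E4 × ℝ)} {G h : Tensor2} {g gi k : Fin 4 → Fin 4 → SmoothRing U}

/-- The parameter as a smooth function. -/
def param (U : Opens (E4 × ℝ)) : SmoothRing U :=
  SmoothRing.of (fun p => (p.2 : ℂ))
    ((Complex.ofRealCLM.contDiff.comp contDiff_snd).contDiffOn)

lemma rep_perturb (hG : ∀ a b, Rep U (fun _ => G a b) (g a b))
    (hh : ∀ a b, Rep U (fun _ => h a b) (k a b)) (a b : Fin 4) :
    Rep U (fun ε => perturb G h ε a b) (g a b + param U * k a b) := by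
  intro y ε hy
  simp only [perturb, SmoothRing.val_add, SmoothRing.val_mul]
  rw [← hG a b y ε hy, ← hh a b y ε hy]
  rfl

lemma dp_perturb (hG : ∀ a b, Rep U (fun _ => G a b) (g a b))
    (hh : ∀ a b, Rep U (fun _ => h a b) (k a b)) (a b : Fin 4) :
    dp U (g a b + param U * k a b) = k a b := by
  ext ⟨⟨y, ε⟩, hy⟩
  have h1 := (rep_perturb hG hh a b).hasDerivAt hy
  have h2 : HasDerivAt (fun t : ℝ => perturb G h t a b y) (h a b y) ε := by
    have h3 : HasDerivAt (fun t : ℝ => (t : ℂ)) 1 ε := by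
      simpa using (hasDerivAt_id ε).ofReal_comp
    simpa [perturb] using (h3.mul_const (h a b y)).const_add (G a b y)
  rw [h1.unique h2]
  exact hh a b y ε hy

/-- The cylinder over an open set of the chart. -/
def cylinder (V : Opens E4) : Opens (E4 × ℝ) := ⟨V ×ˢ Set.univ, V.isOpen.prod isOpen_univ⟩

/-- The restriction of smooth functions to a smaller open set. -/
def SmoothRing.restrict {X : Type*} [NormedAddCommGroup X] [NormedSpace ℝ X] {U W : Opens X}
    (hWU : W ≤ U) (f : SmoothRing U) : SmoothRing W :=
  SmoothRing.of (zeroExt U f.1) (f.2.mono hWU)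

lemma Rep.restrict {W : Opens (E4 × ℝ)} {F : ℝ → E4 → ℂ} {f : SmoothRing U} (hf : Rep U F f)
    (hWU : W ≤ U) : Rep W F (SmoothRing.restrict hWU f) := by
  intro y ε hy
  rw [hf y ε (hWU hy)]
  exact (zeroExt_of_mem _ _).symm

/-- The matrix `g + ε h` may degenerate for large `ε`, with a bound that varies with the point. The
set `W` is where its determinant does not vanish; it contains the whole slice `ε = 0` of `U`, and
there the derivation `dp` of the metric is `h`. -/
lemma exists_perturbed (hG : ∀ a b, Rep U (fun _ => G a b) (g a b))
    (hh : ∀ a b, Rep U (fun _ => h a b) (k a b)) (hg : IsMetricPair g gi)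
    (hk : ∀ a b, k a b = k b a) :
    ∃ (W : Opens (E4 × ℝ)) (_ : W ≤ U) (g' gi' k' : Fin 4 → Fin 4 → SmoothRing W),
      (∀ y, (y, 0) ∈ U → (y, 0) ∈ W) ∧ IsMetricPair g' gi' ∧
      (∀ a b, Rep W (fun ε => perturb G h ε a b) (g' a b)) ∧
      (∀ a b, Rep W (fun _ => h a b) (k' a b)) ∧ (∀ a b, dp W (g' a b) = k' a b) := by
  set q : Fin 4 → Fin 4 → SmoothRing U := fun a b => g a b + param U * k a b
  set d : SmoothRing U := (Matrix.of q).det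
  have hval : ∀ x, d.1 x = (Matrix.of fun i j => (q i j).1 x).det := fun x =>
    RingHom.map_det (SmoothRing.evalHom x) (Matrix.of q)
  -- This open set is the `W` of the statement.
  have hopen : IsOpen ((U : Set (E4 × ℝ)) ∩ zeroExt U d.1 ⁻¹' {0}ᶜ) :=
    ContinuousOn.isOpen_inter_preimage (ContDiffOn.continuousOn d.2) U.isOpen
      isOpen_compl_singleton
  have hWU : (⟨_, hopen⟩ : Opens (E4 × ℝ)) ≤ U := fun x hx => hx.1
  set W : Opens (E4 × ℝ) := ⟨_, hopen⟩
  have hG' := fun a b => (hG a b).restrict hWU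
  have hh' := fun a b => (hh a b).restrict hWU
  have hq : ∀ a b (x : W), (SmoothRing.restrict hWU (g a b)
      + param W * SmoothRing.restrict hWU (k a b)).1 x = (q a b).1 ⟨x, hWU x.2⟩ := by
    rintro a b ⟨⟨y, ε⟩, hx⟩
    rw [← rep_perturb hG' hh' a b y ε hx, ← rep_perturb hG hh a b y ε (hWU hx)]
  obtain ⟨gi', hgi'⟩ := exists_isMetricPair (U := W)
    (fun a b => SmoothRing.restrict hWU (g a b) + param W * SmoothRing.restrict hWU (k a b))
    (fun a b => by rw [hg.symm a b, hk a b]) (fun x => by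
      simp only [hq]
      have := x.2.2
      rw [Set.mem_preimage, zeroExt_of_mem _ (hWU x.2), hval] at this
      exact this)
  refine ⟨W, hWU, _, gi', _, ?_, hgi', rep_perturb hG' hh', hh', dp_perturb hG' hh'⟩
  intro y hy
  refine ⟨hy, ?_⟩
  rw [Set.mem_preimage, zeroExt_of_mem _ hy, hval]
  have h1 : ∀ i j, (q i j).1 ⟨(y, 0), hy⟩ = (g i j).1 ⟨(y, 0), hy⟩ := fun i j => by
    rw [← rep_perturb hG hh i j y 0 hy]
    simp only [perturb_zero]
    exact hG i j y 0 hy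
  simp only [h1]
  intro h0
  -- At `ε = 0` the given inverse `gi` shows that the determinant is nonzero.
  have hm : (Matrix.of fun i j => (g i j).1 ⟨(y, 0), hy⟩)
      * (Matrix.of fun i j => (gi i j).1 ⟨(y, 0), hy⟩) = 1 := by
    ext i j
    have h1 := congrArg (fun f : SmoothRing U => f.1 ⟨(y, 0), hy⟩) (hg.mul_inv i j)
    simp only [SmoothRing.val_sum, SmoothRing.val_mul] at h1
    simp only [Matrix.mul_apply, Matrix.of_apply, Matrix.one_apply, h1]
    split_ifs <;> rfl
  have := congrArg Matrix.det hm
  rw [Matrix.det_mul, Matrix.det_one] at this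
  rw [Set.mem_singleton_iff.1 h0, zero_mul] at this
  exact zero_ne_one this

lemma hasDerivAt_einstein (hG : ∀ a b, Rep U (fun _ => G a b) (g a b))
    (hh : ∀ a b, Rep U (fun _ => h a b) (k a b)) (hg : IsMetricPair g gi)
    (hk : ∀ a b, k a b = k b a) (Λ : ℂ) {y : E4} (hy : (y, (0 : ℝ)) ∈ U)
    (hric : ∀ a b, ricci G a b y = Λ * G a b y) (a b : Fin 4) :
    HasDerivAt (fun ε : ℝ => einstein (perturb G h ε) a b y + Λ * perturb G h ε a b y)
      (linEinstein G Λ h a b y) 0 := by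
  obtain ⟨W, hWU, g', gi', k', hW, hg', hG', hh', hd⟩ := exists_perturbed hG hh hg hk
  have hyW := hW y hy
  have hrep : Rep W (fun ε y => einstein (perturb G h ε) a b y + Λ * perturb G h ε a b y)
      (aEinstein (dc W) g' gi' a b + algebraMap ℂ _ Λ * g' a b) := by
    intro z ε hz
    simp only [SmoothRing.val_add, SmoothRing.val_mul, SmoothRing.val_algebraMap,
      rep_einstein hG' hg' a b z ε hz, hG' a b z ε hz]
  have h1 := hrep.hasDerivAt hyW
  have h2 := variation_aEinstein hg' (D := dc W) (δ := dp W)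
    (fun a f => SmoothRing.dir_comm _ _ f) (fun a b f => SmoothRing.dir_comm _ _ f) hd
    (SmoothRing.evalHom ⟨(y, 0), hyW⟩) (fun c => rfl) Λ (fun a b => by
      have e1 := rep_ricci hG' hg' a b y 0 hyW
      have e2 := hG' a b y 0 hyW
      simp only [perturb_zero] at e1 e2
      rw [SmoothRing.evalHom_apply, SmoothRing.evalHom_apply, ← e1, ← e2, hric]) a b
  rw [SmoothRing.evalHom_apply, SmoothRing.evalHom_apply,
    ← rep_linEinstein hG' hg' hh' Λ a b y 0 hyW] at h2
  rw [h2] at h1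
  simpa only [perturb_zero] using h1

/-- The values of the linearised Weyl tensor depend only on the metric and its variation. -/
lemma aLinWeyl_val_congr {W : Opens (E4 × ℝ)} {F F' : ℝ → Tensor2}
    {g' gi' k' : Fin 4 → Fin 4 → SmoothRing W}
    (hG : ∀ a b, Rep U (fun ε => F ε a b) (g a b)) (hg : IsMetricPair g gi)
    (hh : ∀ a b, Rep U (fun _ => h a b) (k a b))
    (hG' : ∀ a b, Rep W (fun ε => F' ε a b) (g' a b)) (hg' : IsMetricPair g' gi')
    (hh' : ∀ a b, Rep W (fun _ => h a b) (k' a b)) {y : E4} {ε ε' : ℝ} (hF : F ε = F' ε')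
    (hy : (y, ε) ∈ U) (hyW : (y, ε') ∈ W) (a b c d : Fin 4) :
    (aLinWeyl (dc U) g gi k a b c d).1 ⟨(y, ε), hy⟩
      = (aLinWeyl (dc W) g' gi' k' a b c d).1 ⟨(y, ε'), hyW⟩ := by
  have a1 : ∀ a b, (g a b).1 ⟨(y, ε), hy⟩ = (g' a b).1 ⟨(y, ε'), hyW⟩ := fun a b => by
    rw [← hG a b y ε hy, ← hG' a b y ε' hyW]
    simp only [hF]
  have a2 : ∀ a b, (gi a b).1 ⟨(y, ε), hy⟩ = (gi' a b).1 ⟨(y, ε'), hyW⟩ := fun a b => by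
    rw [← rep_ginv hG hg a b y ε hy, ← rep_ginv hG' hg' a b y ε' hyW]
    simp only [hF]
  have a3 : ∀ a b, (k a b).1 ⟨(y, ε), hy⟩ = (k' a b).1 ⟨(y, ε'), hyW⟩ := fun a b => by
    rw [← hh a b y ε hy, ← hh' a b y ε' hyW]
  have a4 : ∀ a b c d, (aHess2 (dc U) g gi k a b c d).1 ⟨(y, ε), hy⟩
      = (aHess2 (dc W) g' gi' k' a b c d).1 ⟨(y, ε'), hyW⟩ := fun a b c d => by
    rw [← rep_hess2 hG hg hh a b c d y ε hy, ← rep_hess2 hG' hg' hh' a b c d y ε' hyW]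
    simp only [hF]
  have a5 : ∀ a b c d, (aRiem (dc U) (aChr (dc U) g gi) a b c d).1 ⟨(y, ε), hy⟩
      = (aRiem (dc W) (aChr (dc W) g' gi') a b c d).1 ⟨(y, ε'), hyW⟩ := fun a b c d => by
    rw [← rep_riemannUp hG hg a b c d y ε hy, ← rep_riemannUp hG' hg' a b c d y ε' hyW]
    simp only [hF]
  have a6 : ∀ a b, (aRicci (dc U) g gi a b).1 ⟨(y, ε), hy⟩
      = (aRicci (dc W) g' gi' a b).1 ⟨(y, ε'), hyW⟩ := fun a b => by
    rw [← rep_ricci hG hg a b y ε hy, ← rep_ricci hG' hg' a b y ε' hyW]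
    simp only [hF]
  have a7 : (aScal (dc U) g gi).1 ⟨(y, ε), hy⟩ = (aScal (dc W) g' gi').1 ⟨(y, ε'), hyW⟩ := by
    rw [← rep_scalarCurv hG hg y ε hy, ← rep_scalarCurv hG' hg' y ε' hyW]
    simp only [hF]
  have a8 : ∀ a b, (cov1 (dc U) (aChr (dc U) g gi) (fun b => dc U b (aTr gi k)) a b).1 ⟨(y, ε), hy⟩
      = (cov1 (dc W) (aChr (dc W) g' gi') (fun b => dc W b (aTr gi' k')) a b).1 ⟨(y, ε'), hyW⟩ :=
    fun a b => by
      rw [← rep_hess hG hg (rep_tr hG hg hh) a b y ε hy,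
        ← rep_hess hG' hg' (rep_tr hG' hg' hh') a b y ε' hyW]
      simp only [hF]
  have a9 : (aTr gi (cov1 (dc U) (aChr (dc U) g gi) (fun b => dc U b (aTr gi k)))).1 ⟨(y, ε), hy⟩
      = (aTr gi' (cov1 (dc W) (aChr (dc W) g' gi') (fun b => dc W b (aTr gi' k')))).1
        ⟨(y, ε'), hyW⟩ := by
    change (∑ a, ∑ b, gi a b
        * cov1 (dc U) (aChr (dc U) g gi) (fun b => dc U b (aTr gi k)) a b).1 _
      = (∑ a, ∑ b, gi' a b
        * cov1 (dc W) (aChr (dc W) g' gi') (fun b => dc W b (aTr gi' k')) a b).1 _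
    simp only [SmoothRing.val_sum, SmoothRing.val_mul, a2, a8]
  simp only [aLinWeyl, linRiem, linRicci, linScal, SmoothRing.val_add, SmoothRing.val_sub,
    SmoothRing.val_mul, SmoothRing.val_sum, SmoothRing.val_neg, val_half,
    SmoothRing.val_algebraMap, a1, a2, a3, a4, a5, a6, a7, a8, a9]

lemma hasDerivAt_weyl (hG : ∀ a b, Rep U (fun _ => G a b) (g a b))
    (hh : ∀ a b, Rep U (fun _ => h a b) (k a b)) (hg : IsMetricPair g gi)
    (hk : ∀ a b, k a b = k b a) {y : E4} (hy : (y, (0 : ℝ)) ∈ U) (a b c d : Fin 4) :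
    HasDerivAt (fun ε : ℝ => weyl (perturb G h ε) a b c d y)
      ((aLinWeyl (dc U) g gi k a b c d).1 ⟨(y, 0), hy⟩) 0 := by
  obtain ⟨W, hWU, g', gi', k', hW, hg', hG', hh', hd⟩ := exists_perturbed hG hh hg hk
  have hyW := hW y hy
  have h1 := (rep_weyl hG' hg' a b c d).hasDerivAt hyW
  rw [variation_aWeyl hg' (D := dc W) (δ := dp W) (fun a f => SmoothRing.dir_comm _ _ f)
    (fun a b f => SmoothRing.dir_comm _ _ f) hd] at h1
  convert h1 using 1
  -- The derivative was computed from the perturbed metric on `W`. At `ε = 0` its value agrees with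
  -- the one computed from the unperturbed metric, so the auxiliary `W` disappears from the result.
  exact aLinWeyl_val_congr (F := fun _ => G) hG hg hh hG' hg' hh' (perturb_zero G h).symm hy hyW a b c d

end Perturbation

end SDEinstein

end

noncomputable section

namespace SDEinstein

set_option linter.unusedSectionVars false

/-! ### Change of frame -/

section Frame

variable {R : Type*} [CommRing R] [Algebra ℂ R]
variable {n κ : Type*} [Fintype n] [Fintype κ]

/-- The contraction of a covector with the frame vector `E k`. -/
def con (E : κ → n → R) (k : κ) (v : n → R) : R := ∑ a, E k a * v a

variable (E : κ → n → R)

lemma con_sub (k : κ) (v w : n → R) :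
    con E k (fun a => v a - w a) = con E k v - con E k w := by
  simp only [con, mul_sub, Finset.sum_sub_distrib]

lemma con_add (k : κ) (v w : n → R) :
    con E k (fun a => v a + w a) = con E k v + con E k w := by
  simp only [con, mul_add, Finset.sum_add_distrib]

lemma con_mul (k : κ) (c : R) (v : n → R) : con E k (fun a => c * v a) = c * con E k v := by
  simp only [con, Finset.mul_sum]
  exact Finset.sum_congr rfl fun a _ => by ring

lemma con_mul_right (k : κ) (c : R) (v : n → R) :
    con E k (fun a => v a * c) = con E k v * c := by
  simp only [con, Finset.sum_mul, mul_assoc]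

lemma con_sum {ι : Type*} (s : Finset ι) (k : κ) (v : ι → n → R) :
    con E k (fun a => ∑ i ∈ s, v i a) = ∑ i ∈ s, con E k (v i) := by
  simp only [con, Finset.mul_sum]
  exact Finset.sum_comm

lemma con_comm (k l : κ) (X : n → n → R) :
    con E k (fun a => con E l (fun b => X a b)) = con E l (fun b => con E k (fun a => X a b)) := by
  simp only [con, Finset.mul_sum]
  rw [Finset.sum_comm]
  exact Finset.sum_congr rfl fun a _ => Finset.sum_congr rfl fun b _ => by ring

/-- The frame components of a tensor with two lower indices. -/
def con2 (T : n → n → R) (k l : κ) : R := con E k fun a => con E l fun b => T a b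
/-- The frame components of a tensor with three lower indices. -/
def con3 (T : n → n → n → R) (k l p : κ) : R := con E k fun a => con2 E (T a) l p
/-- The frame components of a tensor with four lower indices. -/
def con4 (T : n → n → n → n → R) (k l p q : κ) : R := con E k fun a => con3 E (T a) l p q

variable (D : n → Derivation ℂ R R)

/-- The derivation along a frame vector. -/
def frameD (k : κ) : Derivation ℂ R R := ∑ a, E k a • D a

lemma frameD_apply (k : κ) (f : R) : frameD E D k f = con E k fun a => D a f := by
  simp only [frameD, con, ← Derivation.coeFnAddMonoidHom_apply, map_sum, Finset.sum_apply]
  rfl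

/-- `Γ'` are the connection coefficients of `Γ` with respect to the frame `E`:
`∇_k E_l = Γ'^p_{kl} E_p`. -/
def IsFrameConn (Γ : n → n → n → R) (Γ' : κ → κ → κ → R) : Prop :=
  ∀ k l a, frameD E D k (E l a) + ∑ m, con E k (fun b => Γ a b m) * E l m
    = ∑ p, Γ' p k l * E p a

variable {E D} {Γ : n → n → n → R} {Γ' : κ → κ → κ → R}

/-- A connection acts on each index separately, so tensors of higher rank are converted one slot at
a time; `slot2` and `slot3` iterate this statement. -/
lemma IsFrameConn.slot (h : IsFrameConn E D Γ Γ') (k l : κ) (w : n → R) :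
    con E l (fun b => frameD E D k (w b) - ∑ m, con E k (fun a => Γ m a b) * w m)
      = frameD E D k (con E l w) - ∑ p, Γ' p k l * con E p w := by
  have h1 : ∑ p, Γ' p k l * con E p w = ∑ b, (∑ p, Γ' p k l * E p b) * w b := by
    simp only [con, Finset.mul_sum, Finset.sum_mul]
    rw [Finset.sum_comm]
    exact Finset.sum_congr rfl fun a _ => Finset.sum_congr rfl fun b _ => by ring
  rw [h1]
  simp only [← h k l]
  rw [con, con, map_sum]
  simp only [Derivation.leibniz, smul_eq_mul, mul_sub, add_mul, Finset.sum_sub_distrib,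
    Finset.sum_add_distrib]
  rw [show ∑ x, E l x * ∑ m, con E k (fun a => Γ m a x) * w m
      = ∑ x, (∑ m, con E k (fun b => Γ x b m) * E l m) * w x by
    simp only [Finset.mul_sum, Finset.sum_mul]
    rw [Finset.sum_comm]
    exact Finset.sum_congr rfl fun a _ => Finset.sum_congr rfl fun b _ => by ring]
  rw [show ∑ x, w x * frameD E D k (E l x) = ∑ x, frameD E D k (E l x) * w x from
    Finset.sum_congr rfl fun _ _ => mul_comm _ _]
  ring

lemma IsFrameConn.slot2 (h : IsFrameConn E D Γ Γ') (k l p : κ) (T : n → n → R) :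
    con2 E (fun b c => frameD E D k (T b c) - ∑ m, con E k (fun a => Γ m a b) * T m c
        - ∑ m, con E k (fun a => Γ m a c) * T b m) l p
      = frameD E D k (con2 E T l p) - ∑ q, Γ' q k l * con2 E T q p
        - ∑ q, Γ' q k p * con2 E T l q := by
  have h1 : ∀ b, con E p (fun c => frameD E D k (T b c) - ∑ m, con E k (fun a => Γ m a b) * T m c
        - ∑ m, con E k (fun a => Γ m a c) * T b m)
      = frameD E D k (con E p (T b)) - ∑ m, con E k (fun a => Γ m a b) * con E p (T m)
        - ∑ q, Γ' q k p * con E q (T b) := by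
    intro b
    have := h.slot k p (T b)
    simp only [con_sub, con_sum, con_mul] at this ⊢
    linear_combination this
  simp only [con2, h1]
  have h2 := h.slot k l (fun b => con E p (T b))
  rw [con_sub, h2]
  simp only [con_sum, con_mul]

lemma IsFrameConn.slot3 (h : IsFrameConn E D Γ Γ') (k l p q : κ) (T : n → n → n → R) :
    con3 E (fun b c d => frameD E D k (T b c d) - ∑ m, con E k (fun a => Γ m a b) * T m c d
        - ∑ m, con E k (fun a => Γ m a c) * T b m d
        - ∑ m, con E k (fun a => Γ m a d) * T b c m) l p q
      = frameD E D k (con3 E T l p q) - ∑ r, Γ' r k l * con3 E T r p q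
        - ∑ r, Γ' r k p * con3 E T l r q - ∑ r, Γ' r k q * con3 E T l p r := by
  have h1 : ∀ b, con2 E (fun c d => frameD E D k (T b c d)
          - ∑ m, con E k (fun a => Γ m a b) * T m c d
          - ∑ m, con E k (fun a => Γ m a c) * T b m d
          - ∑ m, con E k (fun a => Γ m a d) * T b c m) p q
      = frameD E D k (con2 E (T b) p q) - ∑ m, con E k (fun a => Γ m a b) * con2 E (T m) p q
        - ∑ r, Γ' r k p * con2 E (T b) r q - ∑ r, Γ' r k q * con2 E (T b) p r := by
    intro b
    have := h.slot2 k p q (T b)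
    simp only [con2, con_sub, con_sum, con_mul] at this ⊢
    linear_combination this
  simp only [con3, h1]
  have h2 := h.slot k l (fun b => con2 E (T b) p q)
  rw [con_sub, con_sub, h2]
  simp only [con_sum, con_mul]

lemma IsFrameConn.cov1 (h : IsFrameConn E D Γ Γ') (v : n → R) (k l : κ) :
    con2 E (cov1 D Γ v) k l = SDEinstein.cov1 (frameD E D) Γ' (fun k => con E k v) k l := by
  rw [SDEinstein.cov1, ← h.slot, con2, con_comm]
  congr 1
  funext b
  simp only [SDEinstein.cov1, con_sub, con_sum, con_mul_right, frameD_apply]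

lemma IsFrameConn.cov2 (h : IsFrameConn E D Γ Γ') (T : n → n → R) (k l p : κ) :
    con3 E (cov2 D Γ T) k l p = SDEinstein.cov2 (frameD E D) Γ' (con2 E T) k l p := by
  rw [SDEinstein.cov2, Finset.sum_add_distrib, ← sub_sub, ← h.slot2, con3]
  simp only [con2]
  rw [con_comm]
  congr 1
  funext b
  rw [con_comm]
  congr 1
  funext c
  simp only [SDEinstein.cov2, con_sub, con_sum, con_mul_right, frameD_apply, con_add,
    Finset.sum_add_distrib, sub_sub]

lemma IsFrameConn.cov3 (h : IsFrameConn E D Γ Γ') (T : n → n → n → R) (k l p q : κ) :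
    con4 E (cov3 D Γ T) k l p q = SDEinstein.cov3 (frameD E D) Γ' (con3 E T) k l p q := by
  rw [SDEinstein.cov3, Finset.sum_add_distrib, Finset.sum_add_distrib, ← sub_sub, ← sub_sub,
    ← h.slot3, con4]
  simp only [con3, con2]
  rw [con_comm]
  congr 1
  funext b
  rw [con_comm]
  congr 1
  funext c
  rw [con_comm]
  congr 1
  funext d
  simp only [SDEinstein.cov3, con_sub, con_sum, con_mul_right, frameD_apply, con_add,
    Finset.sum_add_distrib, sub_sub, add_assoc]

lemma IsFrameConn.torsion (h : IsFrameConn E D Γ Γ') (hΓ : ∀ a b c, Γ a b c = Γ a c b)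
    (k l : κ) (a : n) :
    frameD E D k (E l a) - frameD E D l (E k a) = ∑ p, (Γ' p k l - Γ' p l k) * E p a := by
  simp only [sub_mul, Finset.sum_sub_distrib, ← h k l, ← h l k]
  have : ∑ m, con E k (fun b => Γ a b m) * E l m = ∑ m, con E l (fun b => Γ a b m) * E k m := by
    simp only [con, Finset.sum_mul]
    rw [Finset.sum_comm]
    exact Finset.sum_congr rfl fun b _ => Finset.sum_congr rfl fun c _ => by rw [hΓ a c b]; ring
  rw [this]; ring

/-- Frame vectors do not commute. As `Γ` is torsion-free, their bracket is given by the
antisymmetric part of the frame coefficients. -/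
lemma IsFrameConn.commutator (h : IsFrameConn E D Γ Γ') (hΓ : ∀ a b c, Γ a b c = Γ a c b)
    (hD : ∀ a b f, D a (D b f) = D b (D a f)) (k l : κ) (f : R) :
    frameD E D k (frameD E D l f) - frameD E D l (frameD E D k f)
      = ∑ p, (Γ' p k l - Γ' p l k) * frameD E D p f := by
  have e : ∀ k l, frameD E D k (frameD E D l f)
      = ∑ a, frameD E D k (E l a) * D a f + ∑ a, ∑ b, E k b * E l a * D b (D a f) := by
    intro k l
    rw [frameD_apply E D l, con, map_sum]
    simp only [Derivation.leibniz, smul_eq_mul, Finset.sum_add_distrib]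
    rw [add_comm]
    congr 1
    · exact Finset.sum_congr rfl fun a _ => mul_comm _ _
    · refine Finset.sum_congr rfl fun a _ => ?_
      rw [frameD_apply, con, Finset.mul_sum]
      exact Finset.sum_congr rfl fun b _ => by ring
  rw [e k l, e l k]
  have e2 : ∑ a, ∑ b, E k b * E l a * D b (D a f) = ∑ a, ∑ b, E l b * E k a * D b (D a f) := by
    rw [Finset.sum_comm]
    exact Finset.sum_congr rfl fun b _ => Finset.sum_congr rfl fun a _ => by rw [hD a b]; ring
  have e3 : ∑ p, (Γ' p k l - Γ' p l k) * frameD E D p f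
      = ∑ a, (frameD E D k (E l a) - frameD E D l (E k a)) * D a f := by
    simp only [h.torsion hΓ]
    simp only [frameD_apply, con, Finset.mul_sum, Finset.sum_mul]
    rw [Finset.sum_comm]
    exact Finset.sum_congr rfl fun b _ => Finset.sum_congr rfl fun a _ => by ring
  rw [e3, e2]
  simp only [sub_mul, Finset.sum_sub_distrib]
  ring

/-- The curvature of connection coefficients in a frame. -/
def frameRiem (D : κ → Derivation ℂ R R) (Γ : κ → κ → κ → R) (q l i j : κ) : R :=
  D i (Γ q j l) - D j (Γ q i l) + ∑ p, (Γ p j l * Γ q i p - Γ p i l * Γ q j p)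
    - ∑ p, (Γ p i j - Γ p j i) * Γ q p l

/-- The commutator of two frame derivatives of the component `E_l^a` is evaluated in two ways:
through the defining relation of `Γ'` applied twice, and through the bracket of the frame vectors.
-/
lemma IsFrameConn.riem (h : IsFrameConn E D Γ Γ') (hΓ : ∀ a b c, Γ a b c = Γ a c b)
    (hD : ∀ a b f, D a (D b f) = D b (D a f)) (l i j : κ) (a : n) :
    con3 E (fun b c d => aRiem D Γ a b c d) l i j
      = ∑ q, frameRiem (frameD E D) Γ' q l i j * E q a := by
  have hE : ∀ k l a, frameD E D k (E l a)
      = ∑ p, Γ' p k l * E p a - ∑ m, con E k (fun b => Γ a b m) * E l m :=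
    fun k l a => by rw [← h k l a]; ring
  have h1 : ∀ i j, frameD E D i (frameD E D j (E l a))
      = ∑ p, E p a * frameD E D i (Γ' p j l)
        + ∑ p, Γ' p j l * (∑ q, Γ' q i p * E q a)
        - ∑ p, Γ' p j l * (∑ m, con E i (fun b => Γ a b m) * E p m)
        - ∑ m, E l m * frameD E D i (con E j fun b => Γ a b m)
        - ∑ m, con E j (fun b => Γ a b m) * (∑ p, Γ' p i l * E p m)
        + ∑ m, con E j (fun b => Γ a b m) * (∑ r, con E i (fun b => Γ m b r) * E l r) := by
    intro i j
    have := congrArg (frameD E D i) (h j l a)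
    simp only [map_add, map_sum, Derivation.leibniz, smul_eq_mul, hE i, mul_sub,
      Finset.sum_add_distrib, Finset.sum_sub_distrib] at this
    linear_combination this
  have hsw : ∀ i j, ∑ m, con E j (fun b => Γ a b m) * (∑ p, Γ' p i l * E p m)
      = ∑ p, Γ' p i l * (∑ m, con E j (fun b => Γ a b m) * E p m) := by
    intro i j
    simp only [Finset.mul_sum]
    rw [Finset.sum_comm]
    exact Finset.sum_congr rfl fun p _ => Finset.sum_congr rfl fun m _ => by ring
  have hΓD : ∀ i j m, frameD E D i (con E j fun b => Γ a b m)
      = ∑ c, frameD E D i (E j c) * Γ a c m + con2 E (fun c d => D c (Γ a d m)) i j := by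
    intro i j m
    rw [con, map_sum, con2, con_comm]
    simp only [Derivation.leibniz, smul_eq_mul, Finset.sum_add_distrib]
    rw [add_comm]
    congr 1
    · exact Finset.sum_congr rfl fun c _ => mul_comm _ _
    · simp only [frameD_apply]; rfl
  have hΓc : ∀ m, frameD E D i (con E j fun b => Γ a b m) - frameD E D j (con E i fun b => Γ a b m)
      = ∑ p, (Γ' p i j - Γ' p j i) * con E p (fun b => Γ a b m)
        + con2 E (fun c d => D c (Γ a d m) - D d (Γ a c m)) i j := by
    intro m
    have e1 : ∑ c, frameD E D i (E j c) * Γ a c m - ∑ c, frameD E D j (E i c) * Γ a c m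
        = ∑ p, (Γ' p i j - Γ' p j i) * con E p (fun b => Γ a b m) := by
      rw [← Finset.sum_sub_distrib]
      simp only [← sub_mul, h.torsion hΓ, con, Finset.mul_sum, Finset.sum_mul]
      rw [Finset.sum_comm]
      exact Finset.sum_congr rfl fun p _ => Finset.sum_congr rfl fun m _ => by ring
    have e2 : con2 E (fun c d => D c (Γ a d m) - D d (Γ a c m)) i j
        = con2 E (fun c d => D c (Γ a d m)) i j - con2 E (fun c d => D c (Γ a d m)) j i := by
      simp only [con2, con_sub]
      rw [con_comm E i j (fun c d => D d (Γ a c m))]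
    rw [hΓD, hΓD, e2]
    linear_combination e1
  have hL : con3 E (fun b c d => aRiem D Γ a b c d) l i j
      = ∑ b, E l b * (con2 E (fun c d => D c (Γ a d b) - D d (Γ a c b)) i j
        + ∑ e, (con E i (fun c => Γ a c e) * con E j (fun d => Γ e d b)
          - con E j (fun d => Γ a d e) * con E i (fun c => Γ e c b))) := by
    rw [con3, con]
    refine Finset.sum_congr rfl fun b _ => ?_
    simp only [aRiem, con2, con_add, con_sub, con_sum, con_mul, con_mul_right]
  -- The evaluation through the bracket; `h1` supplies the other one.
  have hc := h.commutator hΓ hD i j (E l a)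
  rw [h1 i j, h1 j i] at hc
  have hR : ∑ m, E l m * frameD E D i (con E j fun b => Γ a b m)
      - ∑ m, E l m * frameD E D j (con E i fun b => Γ a b m)
      = ∑ p, (Γ' p i j - Γ' p j i) * (∑ m, con E p (fun b => Γ a b m) * E l m)
        + ∑ m, E l m * con2 E (fun c d => D c (Γ a d m) - D d (Γ a c m)) i j := by
    rw [← Finset.sum_sub_distrib]
    simp only [← mul_sub, hΓc, mul_add, Finset.sum_add_distrib, Finset.mul_sum]
    rw [Finset.sum_comm]
    congr 1
    exact Finset.sum_congr rfl fun p _ => Finset.sum_congr rfl fun m _ => by ring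
  have hq : ∀ i j, ∑ b, E l b * (∑ e, con E i (fun c => Γ a c e) * con E j (fun d => Γ e d b))
      = ∑ m, con E i (fun b => Γ a b m) * (∑ r, con E j (fun b => Γ m b r) * E l r) := by
    intro i j
    simp only [Finset.mul_sum]
    rw [Finset.sum_comm]
    exact Finset.sum_congr rfl fun p _ => Finset.sum_congr rfl fun m _ => by ring
  have hF : ∑ q, frameRiem (frameD E D) Γ' q l i j * E q a
      = ∑ p, E p a * frameD E D i (Γ' p j l) - ∑ p, E p a * frameD E D j (Γ' p i l)
        + ∑ p, Γ' p j l * (∑ q, Γ' q i p * E q a) - ∑ p, Γ' p i l * (∑ q, Γ' q j p * E q a)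
        - ∑ p, (Γ' p i j - Γ' p j i) * ∑ q, Γ' q p l * E q a := by
    simp only [frameRiem, add_mul, sub_mul, Finset.sum_add_distrib, Finset.sum_sub_distrib,
      Finset.sum_mul, Finset.mul_sum]
    have sw : ∀ X : κ → κ → R, ∑ q, ∑ p, X p q * E q a = ∑ p, ∑ q, X p q * E q a :=
      fun X => Finset.sum_comm
    rw [sw (fun p q => Γ' p j l * Γ' q i p), sw (fun p q => Γ' p i l * Γ' q j p),
      sw (fun p q => Γ' p i j * Γ' q p l), sw (fun p q => Γ' p j i * Γ' q p l)]
    simp only [mul_assoc, mul_comm (E _ a)]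
    ring
  simp only [hE, mul_sub, Finset.sum_sub_distrib] at hc
  rw [hL, hF]
  simp only [mul_add, mul_sub, Finset.sum_add_distrib, Finset.sum_sub_distrib, hq]
  rw [hsw, hsw] at hc
  linear_combination -hc - hR

end Frame

end SDEinstein

end

noncomputable section

namespace SDEinstein

set_option linter.unusedSectionVars false

/-! ### Spinor connection coefficients and their curvature -/

section SpinFrame

variable {R : Type*} [CommRing R] [Algebra ℂ R]

/-- Pairs of an unprimed and a primed spinor index. -/
abbrev Bisp := Fin 2 × Fin 2

/-- The components of `ε_{AB}` in the ring `R`. -/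
def epsR (R : Type*) [CommRing R] (A B : Fin 2) : R :=
  if A = 0 ∧ B = 1 then 1 else if A = 1 ∧ B = 0 then -1 else 0

/-- The components of the metric in a spin frame. -/
def etaR (R : Type*) [CommRing R] (k l : Bisp) : R := epsR R k.1 l.1 * epsR R k.2 l.2

lemma ofNat_mul_cancel {x y : R} {k : ℕ} (hk : k ≠ 0) (h : (k : R) * x = k * y) : x = y := by
  have hu : algebraMap ℂ R ((k : ℂ)⁻¹) * (k : R) = 1 := by
    rw [← map_natCast (algebraMap ℂ R), ← map_mul, inv_mul_cancel₀ (Nat.cast_ne_zero.mpr hk),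
      map_one]
  rw [← one_mul x, ← one_mul y, ← hu, mul_assoc, mul_assoc, h]

lemma two_cancel {x y : R} (h : 2 * x = 2 * y) : x = y :=
  ofNat_mul_cancel (k := 2) two_ne_zero (by exact_mod_cast h)

lemma four_cancel {x y : R} (h : 4 * x = 4 * y) : x = y :=
  ofNat_mul_cancel (k := 4) four_ne_zero (by exact_mod_cast h)

/-- The connection coefficients on bispinors of connections on unprimed and primed spinors. -/
def spinΓ (u up : Bisp → Fin 2 → Fin 2 → R) (m k l : Bisp) : R :=
  (if m.2 = l.2 then u k l.1 m.1 else 0) + (if m.1 = l.1 then up k l.2 m.2 else 0)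

variable (D : Bisp → Derivation ℂ R R)

/-- The curvature of a connection on spinors, with frame connection coefficients `Γ`. -/
def curvForm (Γ : Bisp → Bisp → Bisp → R) (u : Bisp → Fin 2 → Fin 2 → R) (k l : Bisp)
    (A B : Fin 2) : R :=
  D k (u l A B) - D l (u k A B) + ∑ C, (u l A C * u k C B - u k A C * u l C B)
    - ∑ p, (Γ p k l - Γ p l k) * u p A B

/-- The curvature tensor with unprimed and primed curvature spinors `U`, `P`. -/
def spinRiem (U P : Bisp → Bisp → Fin 2 → Fin 2 → R) (q l i j : Bisp) : R :=
  (if q.2 = l.2 then U i j l.1 q.1 else 0) + (if q.1 = l.1 then P i j l.2 q.2 else 0)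

/-- Tangent vectors are tensor products of unprimed and primed spinors, and the curvature of a
tensor product connection is the sum of the two curvatures. -/
lemma frameRiem_spinΓ (u up : Bisp → Fin 2 → Fin 2 → R) (q l i j : Bisp) :
    frameRiem D (spinΓ u up) q l i j
      = spinRiem (curvForm D (spinΓ u up) u) (curvForm D (spinΓ u up) up) q l i j := by
  -- The coefficients in the torsion term are generalised to an arbitrary `Γ`, so that only the
  -- genuine curvature terms are expanded.
  have key : ∀ Γ : Bisp → Bisp → Bisp → R,
      D i (spinΓ u up q j l) - D j (spinΓ u up q i l)
        + ∑ p, (spinΓ u up p j l * spinΓ u up q i p - spinΓ u up p i l * spinΓ u up q j p)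
        - ∑ p, (Γ p i j - Γ p j i) * spinΓ u up q p l
      = spinRiem (curvForm D Γ u) (curvForm D Γ up) q l i j := by
    intro Γ
    obtain ⟨q, q'⟩ := q
    obtain ⟨l, l'⟩ := l
    fin_cases q <;> fin_cases q' <;> fin_cases l <;> fin_cases l' <;>
    · simp [spinΓ, spinRiem, curvForm, Fintype.sum_prod_type, Fin.sum_univ_two]
      try ring
  exact key _

lemma curvForm_antisymm (Γ : Bisp → Bisp → Bisp → R) (u : Bisp → Fin 2 → Fin 2 → R)
    (k l : Bisp) (A B : Fin 2) : curvForm D Γ u l k A B = -curvForm D Γ u k l A B := by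
  simp only [curvForm, Finset.sum_sub_distrib, sub_mul]
  ring

lemma curvForm_trace (Γ : Bisp → Bisp → Bisp → R) {u : Bisp → Fin 2 → Fin 2 → R}
    (hu : ∀ k, u k 1 1 = -u k 0 0) (k l : Bisp) :
    curvForm D Γ u k l 1 1 = -curvForm D Γ u k l 0 0 := by
  simp only [curvForm, Fin.sum_univ_two, hu, map_neg, mul_neg, Finset.sum_neg_distrib]
  ring

/-- The Ricci identity for tensors with two indices. -/
lemma cov3_cov2_commutator {κ : Type*} [Fintype κ] {D : κ → Derivation ℂ R R}
    {Γ : κ → κ → κ → R}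
    (hD : ∀ k l f, D k (D l f) - D l (D k f) = ∑ p, (Γ p k l - Γ p l k) * D p f)
    (h : κ → κ → R) (i j k l : κ) :
    cov3 D Γ (cov2 D Γ h) i j k l - cov3 D Γ (cov2 D Γ h) j i k l
      = -∑ m, (frameRiem D Γ m k i j * h m l + frameRiem D Γ m l i j * h k m) := by
  have e : ∀ i j, cov3 D Γ (cov2 D Γ h) i j k l
      = D i (D j (h k l)) - ∑ m, Γ m i j * D m (h k l)
        + ∑ m, (∑ n, Γ m i j * Γ n m k * h n l + ∑ n, Γ m i j * Γ n m l * h k n)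
        - ∑ m, (D i (Γ m j k) * h m l + D i (Γ m j l) * h k m)
        + ∑ m, (∑ n, Γ n i k * Γ m j n * h m l + ∑ n, Γ n i l * Γ m j n * h k m)
        + ∑ m, ∑ n, (Γ m i k * Γ n j l * h m n + Γ m j k * Γ n i l * h m n)
        - ∑ m, (Γ m i k * D j (h m l) + Γ m j k * D i (h m l))
        - ∑ m, (Γ m i l * D j (h k m) + Γ m j l * D i (h k m)) := by
    intro i j
    simp only [cov3, cov2, map_sub, map_sum, map_add, Derivation.leibniz, smul_eq_mul,
      Finset.sum_add_distrib, mul_sub, mul_add, Finset.sum_sub_distrib, Finset.mul_sum]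
    have s1 : ∑ m, ∑ n, Γ m i k * (Γ n j m * h n l) = ∑ m, ∑ n, Γ n i k * Γ m j n * h m l := by
      rw [Finset.sum_comm]
      exact Finset.sum_congr rfl fun _ _ => Finset.sum_congr rfl fun _ _ => by ring
    have s2 : ∑ m, ∑ n, Γ m i l * (Γ n j m * h k n) = ∑ m, ∑ n, Γ n i l * Γ m j n * h k m := by
      rw [Finset.sum_comm]
      exact Finset.sum_congr rfl fun _ _ => Finset.sum_congr rfl fun _ _ => by ring
    have s3 : ∑ m, ∑ n, Γ m i l * (Γ n j k * h n m) = ∑ m, ∑ n, Γ m j k * Γ n i l * h m n := by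
      rw [Finset.sum_comm]
      exact Finset.sum_congr rfl fun _ _ => Finset.sum_congr rfl fun _ _ => by ring
    have c1 : ∑ m, h m l * D i (Γ m j k) = ∑ m, D i (Γ m j k) * h m l :=
      Finset.sum_congr rfl fun _ _ => mul_comm _ _
    have c2 : ∑ m, h k m * D i (Γ m j l) = ∑ m, D i (Γ m j l) * h k m :=
      Finset.sum_congr rfl fun _ _ => mul_comm _ _
    rw [s1, s2, s3, c1, c2]
    simp only [mul_assoc]
    ring
  rw [e i j, e j i]
  have hc := hD i j (h k l)
  have t : ∀ m, frameRiem D Γ m k i j * h m l + frameRiem D Γ m l i j * h k m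
      = (D i (Γ m j k) * h m l + D i (Γ m j l) * h k m)
        - (D j (Γ m i k) * h m l + D j (Γ m i l) * h k m)
        + (∑ n, Γ n j k * Γ m i n * h m l + ∑ n, Γ n j l * Γ m i n * h k m)
        - (∑ n, Γ n i k * Γ m j n * h m l + ∑ n, Γ n i l * Γ m j n * h k m)
        - ((∑ n, Γ n i j * Γ m n k * h m l + ∑ n, Γ n i j * Γ m n l * h k m)
        - (∑ n, Γ n j i * Γ m n k * h m l + ∑ n, Γ n j i * Γ m n l * h k m)) := by
    intro m
    simp only [frameRiem, sub_mul, Finset.sum_sub_distrib, ← Finset.sum_mul]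
    ring
  simp only [t, sub_mul, Finset.sum_add_distrib, Finset.sum_sub_distrib] at hc ⊢
  have sw : ∀ X : κ → κ → R, ∑ n, ∑ m, X n m = ∑ m, ∑ n, X n m := fun _ => Finset.sum_comm
  rw [sw fun m n => Γ m i j * Γ n m k * h n l, sw fun m n => Γ m i j * Γ n m l * h k n,
    sw fun m n => Γ m j i * Γ n m k * h n l, sw fun m n => Γ m j i * Γ n m l * h k n]
  linear_combination hc

end SpinFrame

end SDEinstein

end

noncomputable section

namespace SDEinstein

set_option linter.unusedSectionVars false
set_option linter.unusedSimpArgs false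

/-! ### Curvature spinors of a self-dual Einstein metric -/

section SpinCurvature

variable {R : Type*} [CommRing R] [Algebra ℂ R]

/-- The curvature spinors `U`, `P` are those of an Einstein metric, `R_{ab} = 6 L g_{ab}`, whose
Weyl tensor has vanishing unprimed part. -/
structure IsSDEinsteinCurv (L : R) (U P : Bisp → Bisp → Fin 2 → Fin 2 → R) : Prop where
  antisymm : ∀ k l A B, U l k A B = -U k l A B
  antisymm' : ∀ k l A B, P l k A B = -P k l A B
  trace : ∀ k l, U k l 1 1 = -U k l 0 0
  trace' : ∀ k l, P k l 1 1 = -P k l 0 0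
  bianchi : ∀ q l i j, spinRiem U P q l i j + spinRiem U P q i j l + spinRiem U P q j l i = 0
  ricci : ∀ b d, ∑ a, spinRiem U P a b a d = 6 * L * etaR R b d
  weyl : ∀ A B C D : Fin 2, ∑ A', ∑ B', ∑ C', ∑ D', epsR R A' B' * epsR R C' D' *
    ((∑ q, etaR R (A, A') q * spinRiem U P q (B, B') (C, C') (D, D'))
      - 2 * L * (etaR R (A, A') (C, C') * etaR R (B, B') (D, D')
        - etaR R (A, A') (D, D') * etaR R (B, B') (C, C'))) = 0

variable {L : R} {U P : Bisp → Bisp → Fin 2 → Fin 2 → R}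

/-- Antisymmetry and tracelessness leave 18 components of `U`. The first Bianchi identity, the Ricci
tensor and the vanishing of the unprimed Weyl spinor form a linear system which determines all of
them. -/
lemma IsSDEinsteinCurv.unprimed_aux (hc : IsSDEinsteinCurv L U P) :
    U (0, 0) (0, 1) 0 0 = 0 ∧ U (0, 0) (0, 1) 0 1 = 0 ∧ U (0, 0) (0, 1) 1 0 = -2 * L ∧
    U (0, 0) (1, 0) 0 0 = 0 ∧ U (0, 0) (1, 0) 0 1 = 0 ∧ U (0, 0) (1, 0) 1 0 = 0 ∧
    U (0, 0) (1, 1) 0 0 = L ∧ U (0, 0) (1, 1) 0 1 = 0 ∧ U (0, 0) (1, 1) 1 0 = 0 ∧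
    U (0, 1) (1, 0) 0 0 = -L ∧ U (0, 1) (1, 0) 0 1 = 0 ∧ U (0, 1) (1, 0) 1 0 = 0 ∧
    U (0, 1) (1, 1) 0 0 = 0 ∧ U (0, 1) (1, 1) 0 1 = 0 ∧ U (0, 1) (1, 1) 1 0 = 0 ∧
    U (1, 0) (1, 1) 0 0 = 0 ∧ U (1, 0) (1, 1) 0 1 = 2 * L ∧ U (1, 0) (1, 1) 1 0 = 0 := by
  have dz : ∀ {X : Bisp → Bisp → Fin 2 → Fin 2 → R}, (∀ k l A B, X l k A B = -X k l A B) →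
      ∀ k A B, X k k A B = 0 := fun {X} hX k A B => two_cancel (by linear_combination hX k k A B)
  have dU := dz hc.antisymm
  have dP := dz hc.antisymm'
  have aU : ∀ k l, U l k = fun A B => -U k l A B := fun k l => by
    funext A B; exact hc.antisymm k l A B
  have aP : ∀ k l, P l k = fun A B => -P k l A B := fun k l => by
    funext A B; exact hc.antisymm' k l A B
  have hB := hc.bianchi
  have hRic := hc.ricci
  have hW := hc.weyl
  -- Multiplying by 2 or 4 makes the coefficients of the solution of the linear system integral.
  -- Each `linear_combination` below records one row of that solution; its residual identity is
  -- postponed by `rotate_left`, so that one expansion in components closes all of them.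
  refine ⟨four_cancel ?_, four_cancel ?_, four_cancel ?_, two_cancel ?_, two_cancel ?_,
    two_cancel ?_, four_cancel ?_, four_cancel ?_, four_cancel ?_, four_cancel ?_,
    four_cancel ?_, four_cancel ?_, two_cancel ?_, two_cancel ?_, two_cancel ?_,
    four_cancel ?_, four_cancel ?_, four_cancel ?_⟩
  linear_combination (norm := skip) -2 * hB (1, 0) (0, 0) (0, 1) (1, 0)
    - 2 * hB (1, 1) (0, 0) (0, 1) (1, 1) - hW 0 0 0 1
  rotate_left
  linear_combination (norm := skip) hW 0 0 0 0
  rotate_left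
  linear_combination (norm := skip) 2 * hB (0, 0) (0, 0) (0, 1) (1, 0)
    + 2 * hB (0, 1) (0, 0) (0, 1) (1, 1) + 2 * hB (1, 0) (0, 0) (1, 0) (1, 1)
    + 2 * hB (1, 1) (0, 1) (1, 0) (1, 1) - hW 0 0 1 1
  rotate_left
  linear_combination (norm := skip) -hB (0, 1) (0, 0) (0, 1) (1, 0) + hRic (0, 0) (1, 0)
  rotate_left
  linear_combination (norm := skip) -hB (1, 1) (0, 0) (0, 1) (1, 0) - hRic (0, 0) (0, 0)
  rotate_left
  linear_combination (norm := skip) hB (0, 1) (0, 0) (1, 0) (1, 1) + hRic (1, 0) (1, 0)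
  rotate_left
  linear_combination (norm := skip) hB (0, 0) (0, 0) (0, 1) (1, 0)
    - hB (0, 1) (0, 0) (0, 1) (1, 1) + hB (1, 0) (0, 0) (1, 0) (1, 1)
    + hB (1, 1) (0, 1) (1, 0) (1, 1) + 2 * hRic (0, 0) (1, 1) - hW 0 0 1 1
  rotate_left
  linear_combination (norm := skip) -2 * hB (1, 1) (0, 0) (0, 1) (1, 1) - 2 * hRic (0, 0) (0, 1)
    + hW 0 0 0 1
  rotate_left
  linear_combination (norm := skip) -2 * hB (0, 0) (0, 0) (1, 0) (1, 1) + 2 * hRic (1, 0) (1, 1)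
    - hW 0 1 1 1
  rotate_left
  linear_combination (norm := skip) hB (0, 0) (0, 0) (0, 1) (1, 0)
    - hB (0, 1) (0, 0) (0, 1) (1, 1) - hB (1, 0) (0, 0) (1, 0) (1, 1)
    - hB (1, 1) (0, 1) (1, 0) (1, 1) + 2 * hRic (0, 1) (1, 0) + hW 0 0 1 1
  rotate_left
  linear_combination (norm := skip) -2 * hB (1, 1) (0, 0) (0, 1) (1, 1) - 2 * hRic (0, 0) (0, 1)
    - hW 0 0 0 1
  rotate_left
  linear_combination (norm := skip) 2 * hB (0, 0) (0, 0) (1, 0) (1, 1)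
    + 4 * hB (0, 1) (0, 1) (1, 0) (1, 1) + 2 * hRic (1, 0) (1, 1) + hW 0 1 1 1
  rotate_left
  linear_combination (norm := skip) hB (0, 0) (0, 0) (0, 1) (1, 1) + hRic (0, 1) (1, 1)
  rotate_left
  linear_combination (norm := skip) hB (1, 0) (0, 0) (0, 1) (1, 1) - hRic (0, 1) (0, 1)
  rotate_left
  linear_combination (norm := skip) -hB (0, 0) (0, 1) (1, 0) (1, 1) + hRic (1, 1) (1, 1)
  rotate_left
  linear_combination (norm := skip) -hW 0 1 1 1
  rotate_left
  linear_combination (norm := skip) hW 0 0 1 1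
  rotate_left
  linear_combination (norm := skip) -hW 1 1 1 1
  rotate_left
  all_goals
    simp only [spinRiem, Fintype.sum_prod_type, Fin.sum_univ_two, etaR, epsR, Fin.isValue, dU, dP,
      aU (0, 0) (0, 1), aU (0, 0) (1, 0), aU (0, 0) (1, 1), aU (0, 1) (1, 0), aU (0, 1) (1, 1),
      aU (1, 0) (1, 1), aP (0, 0) (0, 1), aP (0, 0) (1, 0), aP (0, 0) (1, 1), aP (0, 1) (1, 0),
      aP (0, 1) (1, 1), aP (1, 0) (1, 1), hc.trace, hc.trace', zero_ne_one, one_ne_zero, if_true,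
      if_false, and_true, true_and, and_false, false_and, and_self]
    ring

/-- The same linear system for the primed curvature. Its unprimed two-form part vanishes. In the
primed part five components stay free, namely the self-dual Weyl spinor, on which nothing is
assumed. -/
lemma IsSDEinsteinCurv.primed_aux (hc : IsSDEinsteinCurv L U P) :
    P (0, 0) (0, 1) 0 0 = 0 ∧ P (0, 0) (0, 1) 0 1 = 0 ∧ P (0, 0) (0, 1) 1 0 = 0 ∧
    P (1, 0) (1, 1) 0 0 = 0 ∧ P (1, 0) (1, 1) 0 1 = 0 ∧ P (1, 0) (1, 1) 1 0 = 0 ∧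
    P (0, 0) (1, 0) 0 0 = -P (0, 1) (1, 0) 0 1 ∧ P (0, 0) (1, 0) 1 0 = -P (0, 1) (1, 1) 0 1 ∧
    P (0, 0) (1, 1) 0 0 = 3 * L - P (0, 1) (1, 1) 0 1 ∧
    P (0, 0) (1, 1) 0 1 = P (0, 1) (1, 0) 0 1 ∧ P (0, 0) (1, 1) 1 0 = P (0, 1) (1, 1) 0 0 ∧
    P (0, 1) (1, 0) 0 0 = 3 * L - P (0, 1) (1, 1) 0 1 ∧
    P (0, 1) (1, 0) 1 0 = P (0, 1) (1, 1) 0 0 := by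
  have dz : ∀ {X : Bisp → Bisp → Fin 2 → Fin 2 → R}, (∀ k l A B, X l k A B = -X k l A B) →
      ∀ k A B, X k k A B = 0 := fun {X} hX k A B => two_cancel (by linear_combination hX k k A B)
  have dU := dz hc.antisymm
  have dP := dz hc.antisymm'
  have aU : ∀ k l, U l k = fun A B => -U k l A B := fun k l => by
    funext A B; exact hc.antisymm k l A B
  have aP : ∀ k l, P l k = fun A B => -P k l A B := fun k l => by
    funext A B; exact hc.antisymm' k l A B
  have hB := hc.bianchi
  have hRic := hc.ricci
  have hW := hc.weyl
  refine ⟨two_cancel ?_, two_cancel ?_, two_cancel ?_, two_cancel ?_, two_cancel ?_, two_cancel ?_,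
    two_cancel ?_, two_cancel ?_, four_cancel ?_, ?_, two_cancel ?_, four_cancel ?_,
    two_cancel ?_⟩
  linear_combination (norm := skip) hB (1, 0) (0, 0) (0, 1) (1, 0) + hRic (0, 0) (0, 1)
  rotate_left
  linear_combination (norm := skip) hB (1, 1) (0, 0) (0, 1) (1, 0) - hRic (0, 0) (0, 0)
  rotate_left
  linear_combination (norm := skip) hB (1, 0) (0, 0) (0, 1) (1, 1) + hRic (0, 1) (0, 1)
  rotate_left
  linear_combination (norm := skip) hB (0, 0) (0, 0) (1, 0) (1, 1) + hRic (1, 0) (1, 1)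
  rotate_left
  linear_combination (norm := skip) hB (0, 1) (0, 0) (1, 0) (1, 1) - hRic (1, 0) (1, 0)
  rotate_left
  linear_combination (norm := skip) hB (0, 0) (0, 1) (1, 0) (1, 1) + hRic (1, 1) (1, 1)
  rotate_left
  linear_combination (norm := skip) hB (0, 1) (0, 0) (0, 1) (1, 0) + hRic (0, 0) (1, 0)
  rotate_left
  linear_combination (norm := skip) -hB (0, 0) (0, 0) (0, 1) (1, 0)
    + hB (0, 1) (0, 0) (0, 1) (1, 1) + hB (1, 0) (0, 0) (1, 0) (1, 1)
    - hB (1, 1) (0, 1) (1, 0) (1, 1)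
  rotate_left
  linear_combination (norm := skip) -hB (0, 0) (0, 0) (0, 1) (1, 0)
    + hB (0, 1) (0, 0) (0, 1) (1, 1) - hB (1, 0) (0, 0) (1, 0) (1, 1)
    - hB (1, 1) (0, 1) (1, 0) (1, 1) + 2 * hRic (0, 0) (1, 1)
  rotate_left
  linear_combination (norm := skip) -hB (1, 1) (0, 0) (1, 0) (1, 1) - hRic (0, 0) (1, 0)
  rotate_left
  linear_combination (norm := skip) -hB (0, 0) (0, 0) (0, 1) (1, 1) + hRic (0, 1) (1, 1)
  rotate_left
  linear_combination (norm := skip) -hB (0, 0) (0, 0) (0, 1) (1, 0)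
    + hB (0, 1) (0, 0) (0, 1) (1, 1) + hB (1, 0) (0, 0) (1, 0) (1, 1)
    - 3 * hB (1, 1) (0, 1) (1, 0) (1, 1) - 2 * hRic (0, 1) (1, 0)
  rotate_left
  linear_combination (norm := skip) -hB (0, 0) (0, 0) (0, 1) (1, 1)
    + 2 * hB (1, 0) (0, 1) (1, 0) (1, 1) - hRic (0, 1) (1, 1)
  rotate_left
  all_goals
    simp only [spinRiem, Fintype.sum_prod_type, Fin.sum_univ_two, etaR, epsR, Fin.isValue, dU, dP,
      aU (0, 0) (0, 1), aU (0, 0) (1, 0), aU (0, 0) (1, 1), aU (0, 1) (1, 0), aU (0, 1) (1, 1),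
      aU (1, 0) (1, 1), aP (0, 0) (0, 1), aP (0, 0) (1, 0), aP (0, 0) (1, 1), aP (0, 1) (1, 0),
      aP (0, 1) (1, 1), aP (1, 0) (1, 1), hc.trace, hc.trace', zero_ne_one, one_ne_zero, if_true,
      if_false, and_true, true_and, and_false, false_and, and_self]
    ring

lemma IsSDEinsteinCurv.diag (hc : IsSDEinsteinCurv L U P) (k : Bisp) (A B : Fin 2) :
    U k k A B = 0 ∧ P k k A B = 0 :=
  ⟨two_cancel (by linear_combination hc.antisymm k k A B),
    two_cancel (by linear_combination hc.antisymm' k k A B)⟩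

/-- The unprimed curvature is a constant multiple of the soldering two-forms. This is the form in
which `R_{ab} = Λ g_{ab}` and `Ψ = 0` enter the later computations. -/
lemma IsSDEinsteinCurv.unprimed (hc : IsSDEinsteinCurv L U P) (k l : Bisp) (A B : Fin 2) :
    U k l A B = -L * epsR R k.2 l.2 * ((if k.1 = B then 1 else 0) * epsR R l.1 A
      + (if l.1 = B then 1 else 0) * epsR R k.1 A) := by
  have dU := fun k A B => (hc.diag k A B).1
  have aU : ∀ k l, U l k = fun A B => -U k l A B := fun k l => by
    funext A B; exact hc.antisymm k l A B
  have hu := hc.unprimed_aux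
  obtain ⟨k, k'⟩ := k
  obtain ⟨l, l'⟩ := l
  fin_cases k <;> fin_cases k' <;> fin_cases l <;> fin_cases l' <;> fin_cases A <;> fin_cases B <;>
  · simp [epsR, dU, hu, hc.trace, aU (0, 0) (0, 1), aU (0, 0) (1, 0), aU (0, 0) (1, 1),
      aU (0, 1) (1, 0), aU (0, 1) (1, 1), aU (1, 0) (1, 1)]
    try ring

end SpinCurvature

/-! ### Second derivatives of `h`: Einstein part and pair symmetry -/

section SecondDerivatives

variable {R : Type*} [CommRing R] [Algebra ℂ R]
variable {L : R} {U P : Bisp → Bisp → Fin 2 → Fin 2 → R}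

/-- The unprimed part of the two-form-valued antisymmetrisation of `H`. -/
def asdX (H : Bisp → Bisp → Bisp → Bisp → R) (A B : Fin 2) (k l : Bisp) : R :=
  ∑ A', ∑ B', epsR R A' B' * (H k (B, B') (A, A') l + H k (A, B') (B, A') l
    - H l (B, B') (A, A') k - H l (A, B') (B, A') k)

variable {H : Bisp → Bisp → Bisp → Bisp → R} {h E : Bisp → Bisp → R} {c : R}

/-- The primed two-form part of the linearised unprimed curvature is trace-free Ricci, as for the
curvature itself. The nine equations are the trace-free components of `E`; the term `c * etaR` drops
out of each of them. Reordering second derivatives costs curvature terms, which combine with `-12 L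
h` to `-4 L h` in the normalisation `2 E`. The free self-dual Weyl components cancel. -/
lemma IsSDEinsteinCurv.selfDual_asdX (hc : IsSDEinsteinCurv L U P) (hs : ∀ k l, h k l = h l k)
    (hHs : ∀ i j k l, H i j k l = H i j l k)
    (hH : ∀ i j k l, H i j k l - H j i k l
      = -∑ m, (spinRiem U P m k i j * h m l + spinRiem U P m l i j * h k m))
    (hE : ∀ k l, 2 * E k l = (∑ m, ∑ n, etaR R m n * (H n k l m + H n l k m - H m n k l - H k l m n))
      - 12 * L * h k l + c * etaR R k l) :
    2 * E (0, 0) (0, 0) = -asdX H 0 0 (0, 0) (1, 0) - 4 * L * h (0, 0) (0, 0) ∧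
    4 * E (0, 0) (0, 1) = -(asdX H 0 0 (0, 0) (1, 1) + asdX H 0 0 (0, 1) (1, 0))
      - 8 * L * h (0, 0) (0, 1) ∧
    2 * E (0, 1) (0, 1) = -asdX H 0 0 (0, 1) (1, 1) - 4 * L * h (0, 1) (0, 1) ∧
    2 * E (0, 0) (1, 0) = -asdX H 0 1 (0, 0) (1, 0) - 4 * L * h (0, 0) (1, 0) ∧
    2 * (E (0, 0) (1, 1) + E (0, 1) (1, 0))
      = -(asdX H 0 1 (0, 0) (1, 1) + asdX H 0 1 (0, 1) (1, 0))
        - 4 * L * (h (0, 0) (1, 1) + h (0, 1) (1, 0)) ∧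
    2 * E (0, 1) (1, 1) = -asdX H 0 1 (0, 1) (1, 1) - 4 * L * h (0, 1) (1, 1) ∧
    2 * E (1, 0) (1, 0) = -asdX H 1 1 (0, 0) (1, 0) - 4 * L * h (1, 0) (1, 0) ∧
    4 * E (1, 0) (1, 1) = -(asdX H 1 1 (0, 0) (1, 1) + asdX H 1 1 (0, 1) (1, 0))
      - 8 * L * h (1, 0) (1, 1) ∧
    2 * E (1, 1) (1, 1) = -asdX H 1 1 (0, 1) (1, 1) - 4 * L * h (1, 1) (1, 1) := by
  have dU := fun k A B => (hc.diag k A B).1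
  have dP := fun k A B => (hc.diag k A B).2
  have aP : ∀ k l, P l k = fun A B => -P k l A B := fun k l => by
    funext A B; exact hc.antisymm' k l A B
  have hp := hc.primed_aux
  have hU := hc.unprimed
  refine ⟨?_, ?_, ?_, ?_, ?_, ?_, ?_, ?_, ?_⟩
  -- The commutators `hH` bring the second derivatives in `E` into the order in which they occur in
  -- `asdX`. The residual identities are again closed together at the end.
  linear_combination (norm := skip) hE (0, 0) (0, 0) + 2 * hH (0, 0) (0, 1) (0, 0) (1, 0)
    - hH (0, 0) (1, 1) (0, 0) (0, 0) + hH (0, 1) (1, 0) (0, 0) (0, 0)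
  rotate_left
  linear_combination (norm := skip) 2 * hE (0, 0) (0, 1) + 4 * hH (0, 0) (0, 1) (0, 1) (1, 0)
    - 2 * hH (0, 0) (1, 1) (0, 0) (0, 1) + 2 * hH (0, 1) (1, 0) (0, 0) (0, 1)
  rotate_left
  linear_combination (norm := skip) hE (0, 1) (0, 1) + 2 * hH (0, 0) (0, 1) (0, 1) (1, 1)
    - hH (0, 0) (1, 1) (0, 1) (0, 1) + hH (0, 1) (1, 0) (0, 1) (0, 1)
  rotate_left
  linear_combination (norm := skip) hE (0, 0) (1, 0) + hH (0, 0) (0, 1) (1, 0) (1, 0)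
    - hH (0, 0) (1, 0) (0, 0) (1, 1) + hH (0, 0) (1, 0) (0, 1) (1, 0)
    - hH (1, 0) (1, 1) (0, 0) (0, 0)
  rotate_left
  linear_combination (norm := skip) hE (0, 0) (1, 1) + hE (0, 1) (1, 0)
    + 2 * hH (0, 0) (0, 1) (1, 0) (1, 1) - hH (0, 0) (1, 1) (0, 0) (1, 1)
    + hH (0, 0) (1, 1) (0, 1) (1, 0) - hH (0, 1) (1, 0) (0, 0) (1, 1)
    + hH (0, 1) (1, 0) (0, 1) (1, 0) - 2 * hH (1, 0) (1, 1) (0, 0) (0, 1)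
  rotate_left
  linear_combination (norm := skip) hE (0, 1) (1, 1) + hH (0, 0) (0, 1) (1, 1) (1, 1)
    - hH (0, 1) (1, 1) (0, 0) (1, 1) + hH (0, 1) (1, 1) (0, 1) (1, 0)
    - hH (1, 0) (1, 1) (0, 1) (0, 1)
  rotate_left
  linear_combination (norm := skip) hE (1, 0) (1, 0) + hH (0, 0) (1, 1) (1, 0) (1, 0)
    - hH (0, 1) (1, 0) (1, 0) (1, 0) - 2 * hH (1, 0) (1, 1) (0, 0) (1, 0)
  rotate_left
  linear_combination (norm := skip) 2 * hE (1, 0) (1, 1) + 2 * hH (0, 0) (1, 1) (1, 0) (1, 1)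
    - 2 * hH (0, 1) (1, 0) (1, 0) (1, 1) - 4 * hH (1, 0) (1, 1) (0, 0) (1, 1)
  rotate_left
  linear_combination (norm := skip) hE (1, 1) (1, 1) + hH (0, 0) (1, 1) (1, 1) (1, 1)
    - hH (0, 1) (1, 0) (1, 1) (1, 1) - 2 * hH (1, 0) (1, 1) (0, 1) (1, 1)
  rotate_left
  all_goals
    simp only [asdX, hHs _ _ (0, 1) (0, 0), hHs _ _ (1, 0) (0, 0), hHs _ _ (1, 1) (0, 0),
      hHs _ _ (1, 0) (0, 1), hHs _ _ (1, 1) (0, 1), hHs _ _ (1, 1) (1, 0), hs (0, 1) (0, 0),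
      hs (1, 0) (0, 0), hs (1, 1) (0, 0), hs (1, 0) (0, 1), hs (1, 1) (0, 1), hs (1, 1) (1, 0),
      spinRiem, Fintype.sum_prod_type, Fin.sum_univ_two, etaR, epsR, Fin.isValue, dP, hU, hp,
      aP (0, 0) (0, 1), aP (0, 0) (1, 0), aP (0, 0) (1, 1), aP (0, 1) (1, 0),
      aP (0, 1) (1, 1), aP (1, 0) (1, 1), hc.trace', zero_ne_one, one_ne_zero, if_true,
      if_false, and_true, true_and, and_false, false_and, and_self]
    ring

/-- Linearised pair symmetry of the curvature: after contraction of the primed form indices,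
`X_{ABCD} = X_{CDAB}`. Consequently only the totally symmetric part and a trace remain. -/
lemma IsSDEinsteinCurv.symm_asdX (hc : IsSDEinsteinCurv L U P) (hs : ∀ k l, h k l = h l k)
    (hHs : ∀ i j k l, H i j k l = H i j l k)
    (hH : ∀ i j k l, H i j k l - H j i k l
      = -∑ m, (spinRiem U P m k i j * h m l + spinRiem U P m l i j * h k m)) :
    asdX H 0 0 (0, 0) (1, 1) - asdX H 0 0 (0, 1) (1, 0) = 2 * asdX H 0 1 (0, 0) (0, 1) ∧
    asdX H 0 0 (1, 0) (1, 1) = asdX H 1 1 (0, 0) (0, 1) ∧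
    2 * asdX H 0 1 (1, 0) (1, 1) = asdX H 1 1 (0, 0) (1, 1) - asdX H 1 1 (0, 1) (1, 0) := by
  have dU := fun k A B => (hc.diag k A B).1
  have dP := fun k A B => (hc.diag k A B).2
  have aP : ∀ k l, P l k = fun A B => -P k l A B := fun k l => by
    funext A B; exact hc.antisymm' k l A B
  have hp := hc.primed_aux
  have hU := hc.unprimed
  refine ⟨?_, ?_, ?_⟩
  linear_combination (norm := skip) 2 * hH (0, 0) (0, 1) (0, 0) (1, 1)
    - 2 * hH (0, 0) (0, 1) (0, 1) (1, 0) + 2 * hH (0, 0) (1, 0) (0, 1) (0, 1)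
    - 2 * hH (0, 0) (1, 1) (0, 0) (0, 1) - 2 * hH (0, 1) (1, 0) (0, 0) (0, 1)
    + 2 * hH (0, 1) (1, 1) (0, 0) (0, 0)
  rotate_left
  linear_combination (norm := skip) 2 * hH (0, 0) (1, 0) (0, 1) (1, 1)
    - 2 * hH (0, 0) (1, 1) (0, 1) (1, 0) - 2 * hH (0, 1) (1, 0) (0, 0) (1, 1)
    + 2 * hH (0, 1) (1, 1) (0, 0) (1, 0)
  rotate_left
  linear_combination (norm := skip) 2 * hH (0, 0) (1, 0) (1, 1) (1, 1)
    - 2 * hH (0, 0) (1, 1) (1, 0) (1, 1) - 2 * hH (0, 1) (1, 0) (1, 0) (1, 1)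
    + 2 * hH (0, 1) (1, 1) (1, 0) (1, 0) + 2 * hH (1, 0) (1, 1) (0, 0) (1, 1)
    - 2 * hH (1, 0) (1, 1) (0, 1) (1, 0)
  rotate_left
  all_goals
    simp only [asdX, hHs _ _ (0, 1) (0, 0), hHs _ _ (1, 0) (0, 0), hHs _ _ (1, 1) (0, 0),
      hHs _ _ (1, 0) (0, 1), hHs _ _ (1, 1) (0, 1), hHs _ _ (1, 1) (1, 0), hs (0, 1) (0, 0),
      hs (1, 0) (0, 0), hs (1, 1) (0, 0), hs (1, 0) (0, 1), hs (1, 1) (0, 1), hs (1, 1) (1, 0),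
      spinRiem, Fintype.sum_prod_type, Fin.sum_univ_two, etaR, epsR, Fin.isValue, dP, hU, hp,
      aP (0, 0) (0, 1), aP (0, 0) (1, 0), aP (0, 0) (1, 1), aP (0, 1) (1, 0),
      aP (0, 1) (1, 1), aP (1, 0) (1, 1), hc.trace', zero_ne_one, one_ne_zero, if_true,
      if_false, and_true, true_and, and_false, false_and, and_self]
    ring

end SecondDerivatives

end SDEinstein

end

noncomputable section

namespace SDEinstein

set_option linter.unusedSectionVars false
set_option linter.unusedSimpArgs false

/-! ### The exterior covariant derivative of the antisymmetrised second derivatives -/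

section Exterior

variable {R : Type*} [CommRing R] [Algebra ℂ R]

/-- The unprimed part of the antisymmetrisation of `N` in the first two indices. -/
def asdY (N : Bisp → Bisp → Bisp → R) (A B : Fin 2) (k : Bisp) : R :=
  ∑ A', ∑ B', epsR R A' B' * (N (B, B') (A, A') k + N (A, B') (B, A') k)

variable {D : Bisp → Derivation ℂ R R} {u up : Bisp → Fin 2 → Fin 2 → R}

lemma asdX_symm (H : Bisp → Bisp → Bisp → Bisp → R) (A B : Fin 2) (k l : Bisp) :
    asdX H A B k l = asdX H B A k l := by
  refine Finset.sum_congr rfl fun _ _ => Finset.sum_congr rfl fun _ _ => ?_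
  ring

lemma asdX_antisymm (H : Bisp → Bisp → Bisp → Bisp → R) (A B : Fin 2) (k l : Bisp) :
    asdX H A B l k = -asdX H A B k l := by
  simp only [asdX, ← Finset.sum_neg_distrib]
  refine Finset.sum_congr rfl fun _ _ => Finset.sum_congr rfl fun _ _ => ?_
  ring

/-- The covariant exterior derivative of spinor-valued one-forms, with torsion coefficients `c`. -/
def extCov1 (D : Bisp → Derivation ℂ R R) (c : Bisp → Bisp → Bisp → R)
    (u : Bisp → Fin 2 → Fin 2 → R) (Y : Fin 2 → Fin 2 → Bisp → R) (A B : Fin 2) (k l : Bisp) : R :=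
  D k (Y A B l) - D l (Y A B k) - ∑ p, c p k l * Y A B p
    - ∑ C, (u k A C * Y C B l + u k B C * Y A C l - u l A C * Y C B k - u l B C * Y A C k)

/-- One of the three terms of the covariant exterior derivative of spinor-valued two-forms. -/
def extCov2 (D : Bisp → Derivation ℂ R R) (c : Bisp → Bisp → Bisp → R)
    (u : Bisp → Fin 2 → Fin 2 → R) (X : Fin 2 → Fin 2 → Bisp → Bisp → R) (A B : Fin 2)
    (i j k : Bisp) : R :=
  D i (X A B j k) - ∑ p, c p i j * X A B p k - ∑ C, (u i A C * X C B j k + u i B C * X A C j k)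

/-- The trace-free primed connection preserves `ε^{A'B'}`, so the contraction commutes with `∇`.
Antisymmetrisation in the form indices leaves the exterior covariant derivative, with a torsion term
because the frame is not holonomic. -/
lemma asdX_cov3 (hu : ∀ k, up k 1 1 = -up k 0 0) (N : Bisp → Bisp → Bisp → R) (A B : Fin 2)
    (k l : Bisp) :
    asdX (cov3 D (spinΓ u up) N) A B k l
      = extCov1 D (fun p k l => spinΓ u up p k l - spinΓ u up p l k) u (asdY N) A B k l := by
  have key : ∀ k l, ∑ A', ∑ B', epsR R A' B' * (cov3 D (spinΓ u up) N k (B, B') (A, A') l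
        + cov3 D (spinΓ u up) N k (A, B') (B, A') l)
      = D k (asdY N A B l) - ∑ p, spinΓ u up p k l * asdY N A B p
        - ∑ C, (u k A C * asdY N C B l + u k B C * asdY N A C l) := by
    intro k l
    fin_cases A <;> fin_cases B <;>
    · simp [asdY, cov3, spinΓ, epsR, Fintype.sum_prod_type, Fin.sum_univ_two, hu]
      ring
  have e : asdX (cov3 D (spinΓ u up) N) A B k l
      = (∑ A', ∑ B', epsR R A' B' * (cov3 D (spinΓ u up) N k (B, B') (A, A') l
        + cov3 D (spinΓ u up) N k (A, B') (B, A') l))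
        - (∑ A', ∑ B', epsR R A' B' * (cov3 D (spinΓ u up) N l (B, B') (A, A') k
        + cov3 D (spinΓ u up) N l (A, B') (B, A') k)) := by
    simp only [asdX, ← Finset.sum_sub_distrib]
    refine Finset.sum_congr rfl fun _ _ => Finset.sum_congr rfl fun _ _ => ?_
    ring
  rw [e, key, key, extCov1]
  simp only [sub_mul, Finset.sum_sub_distrib, Finset.sum_add_distrib]
  ring

/-- For a torsion-free connection the first Bianchi identity, written in a frame, is the Jacobi
identity for the structure coefficients of the frame. -/
lemma torsion_jacobi {κ : Type*} [Fintype κ] {D : κ → Derivation ℂ R R} {Γ : κ → κ → κ → R}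
    {q l i j : κ}
    (hB : frameRiem D Γ q l i j + frameRiem D Γ q i j l + frameRiem D Γ q j l i = 0) :
    (D i (Γ q j l - Γ q l j) - ∑ p, (Γ p i j - Γ p j i) * (Γ q p l - Γ q l p))
      + (D j (Γ q l i - Γ q i l) - ∑ p, (Γ p j l - Γ p l j) * (Γ q p i - Γ q i p))
      + (D l (Γ q i j - Γ q j i) - ∑ p, (Γ p l i - Γ p i l) * (Γ q p j - Γ q j p)) = 0 := by
  simp only [frameRiem, map_sub, sub_mul, mul_sub, Finset.sum_sub_distrib] at hB ⊢
  linear_combination hB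

/-- `d^∇ d^∇ Y = F ∧ Y`. In a non-holonomic frame the terms linear in undifferentiated `Y` cancel
only because of the Jacobi identity `hJ`. -/
lemma extCov2_extCov1 {c : Bisp → Bisp → Bisp → R}
    (hD : ∀ k l f, D k (D l f) - D l (D k f) = ∑ p, c p k l * D p f) (i j k : Bisp)
    (hJ : ∀ q, (D i (c q j k) - ∑ p, c p i j * c q p k) + (D j (c q k i) - ∑ p, c p j k * c q p i)
      + (D k (c q i j) - ∑ p, c p k i * c q p j) = 0)
    {F : Bisp → Bisp → Fin 2 → Fin 2 → R}
    (hF : ∀ k l A B, F k l A B = D k (u l A B) - D l (u k A B)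
      + ∑ C, (u l A C * u k C B - u k A C * u l C B) - ∑ p, c p k l * u p A B)
    (Y : Fin 2 → Fin 2 → Bisp → R) (A B : Fin 2) :
    extCov2 D c u (extCov1 D c u Y) A B i j k + extCov2 D c u (extCov1 D c u Y) A B j k i
      + extCov2 D c u (extCov1 D c u Y) A B k i j
      = -∑ C, (F i j A C * Y C B k + F i j B C * Y A C k + (F j k A C * Y C B i + F j k B C * Y A C i)
        + (F k i A C * Y C B j + F k i B C * Y A C j)) := by
  have h1 := hD i j (Y A B k)
  have h2 := hD j k (Y A B i)
  have h3 := hD k i (Y A B j)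
  simp only [hF, extCov2, extCov1, Fintype.sum_prod_type, Fin.sum_univ_two, map_sub, map_add,
    Derivation.leibniz, smul_eq_mul] at h1 h2 h3 hJ ⊢
  linear_combination h1 + h2 + h3 - hJ (0, 0) * Y A B (0, 0) - hJ (0, 1) * Y A B (0, 1)
    - hJ (1, 0) * Y A B (1, 0) - hJ (1, 1) * Y A B (1, 1)

end Exterior

end SDEinstein

end

noncomputable section

namespace SDEinstein

set_option linter.unusedSectionVars false
set_option linter.unusedSimpArgs false

/-! ### The Bianchi identity for the perturbed Weyl spinor -/

section Bianchi

variable {R : Type*} [CommRing R] [Algebra ℂ R]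

/-- Twelve times the components of the symmetric spinor with four indices in `X`. -/
def phi12 (X : Fin 2 → Fin 2 → Bisp → Bisp → R) (i : Fin 5) : R :=
  ![6 * X 0 0 (0, 0) (0, 1), 6 * X 0 1 (0, 0) (0, 1),
    2 * (X 0 0 (1, 0) (1, 1) + X 0 1 (0, 0) (1, 1) - X 0 1 (0, 1) (1, 0)),
    6 * X 0 1 (1, 0) (1, 1), 6 * X 1 1 (1, 0) (1, 1)] i

/-- The contraction `ε^{C'D'} N_{DD'BB'CC'}`. -/
def contrE (N : Bisp → Bisp → Bisp → R) (B' : Fin 2) (B C D : Fin 2) : R :=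
  ∑ C', ∑ D', epsR R C' D' * N (D, D') (B, B') (C, C')

/-- Twelve times the components of the symmetrisation of a spinor with three indices. -/
def sym12 (K : Fin 2 → Fin 2 → Fin 2 → R) (i : Fin 4) : R :=
  ![12 * K 0 0 0, 4 * (K 1 0 0 + K 0 1 0 + K 0 0 1), 4 * (K 1 1 0 + K 1 0 1 + K 0 1 1),
    12 * K 1 1 1] i

/-- The components `f_{AA'}` of the Lee form of the complex structure. -/
def leeR (u : Bisp → Fin 2 → Fin 2 → R) (k : Bisp) : R :=
  if k.1 = 0 then -u (1, k.2) 0 1 else -u (0, k.2) 1 0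

variable {D : Bisp → Derivation ℂ R R} {u up : Bisp → Fin 2 → Fin 2 → R} {L : R} {h G : Bisp → Bisp → R}

-- The components of `d^∇ X = F ∧ Y`. The primed part of `X` is replaced by `G` and `h` through `g1`
-- to `g9`, and since `F` is a multiple of `L`, the terms `L ∇h` from both sides cancel. The
-- hypotheses `g1` to `g9` leave the trace of `G` free, and symmetrisation over three unprimed
-- indices removes it from the right-hand side. The coefficients of `u` and `leeR` are those of
-- `wCoef` for `r = 2 - i` along `ι` and for `r = 1 - i` along `o`.
set_option maxHeartbeats 4000000 in
lemma bianchi_aux (hu : ∀ k, u k 1 1 = -u k 0 0) (hup : ∀ k, up k 1 1 = -up k 0 0)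
    (h01 : ∀ k', u (0, k') 0 1 = 0) (h10 : ∀ k', u (1, k') 1 0 = 0)
    (hL : ∀ k, D k L = 0)
    {X : Fin 2 → Fin 2 → Bisp → Bisp → R}
    (hX : X 1 0 = X 0 1)
    (aX : ∀ A B k l, X A B k l = -X A B l k)
    (dX : ∀ A B i j k, extCov2 D (fun p k l => spinΓ u up p k l - spinΓ u up p l k) u X A B i j k
      + extCov2 D (fun p k l => spinΓ u up p k l - spinΓ u up p l k) u X A B j k i
      + extCov2 D (fun p k l => spinΓ u up p k l - spinΓ u up p l k) u X A B k i j
      = -∑ C, (curvForm D (spinΓ u up) u i j A C * asdY (cov2 D (spinΓ u up) h) C B k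
        + curvForm D (spinΓ u up) u i j B C * asdY (cov2 D (spinΓ u up) h) A C k
        + (curvForm D (spinΓ u up) u j k A C * asdY (cov2 D (spinΓ u up) h) C B i
        + curvForm D (spinΓ u up) u j k B C * asdY (cov2 D (spinΓ u up) h) A C i)
        + (curvForm D (spinΓ u up) u k i A C * asdY (cov2 D (spinΓ u up) h) C B j
        + curvForm D (spinΓ u up) u k i B C * asdY (cov2 D (spinΓ u up) h) A C j)))
    (hU : ∀ k l A B, curvForm D (spinΓ u up) u k l A B = -L * epsR R k.2 l.2 *
      ((if k.1 = B then 1 else 0) * epsR R l.1 A + (if l.1 = B then 1 else 0) * epsR R k.1 A))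
    (hs : ∀ k l, h k l = h l k) (hG : ∀ k l, G k l = G l k)
    (hX1 : X 0 0 (0, 0) (1, 1) = 2 * X 0 1 (0, 0) (0, 1) + X 0 0 (0, 1) (1, 0))
    (hX2 : X 1 1 (0, 0) (0, 1) = X 0 0 (1, 0) (1, 1))
    (hX3 : X 1 1 (0, 0) (1, 1) = 2 * X 0 1 (1, 0) (1, 1) + X 1 1 (0, 1) (1, 0))
    (g1 : G (0, 0) (0, 0) = -2 * X 0 0 (0, 0) (1, 0) - 8 * L * h (0, 0) (0, 0))
    (g2 : G (0, 0) (0, 1) = -(X 0 0 (0, 0) (1, 1) + X 0 0 (0, 1) (1, 0)) - 8 * L * h (0, 0) (0, 1))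
    (g3 : G (0, 1) (0, 1) = -2 * X 0 0 (0, 1) (1, 1) - 8 * L * h (0, 1) (0, 1))
    (g4 : G (0, 0) (1, 0) = -2 * X 0 1 (0, 0) (1, 0) - 8 * L * h (0, 0) (1, 0))
    (g5 : G (0, 1) (1, 0) = -2 * (X 0 1 (0, 0) (1, 1) + X 0 1 (0, 1) (1, 0))
      - 8 * L * (h (0, 0) (1, 1) + h (0, 1) (1, 0)) - G (0, 0) (1, 1))
    (g6 : G (0, 1) (1, 1) = -2 * X 0 1 (0, 1) (1, 1) - 8 * L * h (0, 1) (1, 1))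
    (g7 : G (1, 0) (1, 0) = -2 * X 1 1 (0, 0) (1, 0) - 8 * L * h (1, 0) (1, 0))
    (g8 : G (1, 0) (1, 1) = -(X 1 1 (0, 0) (1, 1) + X 1 1 (0, 1) (1, 0)) - 8 * L * h (1, 0) (1, 1))
    (g9 : G (1, 1) (1, 1) = -2 * X 1 1 (0, 1) (1, 1) - 8 * L * h (1, 1) (1, 1))
    (i : Fin 4) (B' : Fin 2) :
    4 * (D (1, B') (phi12 X i.castSucc)
        + (-(4 - 2 * ((i : ℕ) : R)) * u (1, B') 0 0 - (1 + ((i : ℕ) : R)) * leeR u (1, B'))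
          * phi12 X i.castSucc)
      - 4 * (D (0, B') (phi12 X i.succ)
        + (-(2 - 2 * ((i : ℕ) : R)) * u (0, B') 0 0 - (4 - ((i : ℕ) : R)) * leeR u (0, B'))
          * phi12 X i.succ)
      = -sym12 (contrE (cov2 D (spinΓ u up) G) B') i := by
  have d0 : ∀ A B k, X A B k k = 0 := fun A B k => two_cancel (by linear_combination aX A B k k)
  have hn : ∀ k, D k 2 = 0 ∧ D k 6 = 0 ∧ D k 8 = 0 := fun k =>
    ⟨derivation_ofNat _ 2, derivation_ofNat _ 6, derivation_ofNat _ 8⟩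
  fin_cases i <;> fin_cases B'
  -- For each pair `(i, B')` one or two components of the three-form identity suffice. The
  -- multipliers match the normalisation of `phi12` and `sym12`.
  linear_combination (norm := skip) 24 * dX 0 0 (0, 0) (0, 1) (1, 0)
  rotate_left
  linear_combination (norm := skip) 24 * dX 0 0 (0, 0) (0, 1) (1, 1)
  rotate_left
  linear_combination (norm := skip)
    -8 * dX 0 0 (0, 0) (1, 0) (1, 1) + 16 * dX 0 1 (0, 0) (0, 1) (1, 0)
  rotate_left
  linear_combination (norm := skip)
    -8 * dX 0 0 (0, 1) (1, 0) (1, 1) + 16 * dX 0 1 (0, 0) (0, 1) (1, 1)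
  rotate_left
  linear_combination (norm := skip)
    -16 * dX 0 1 (0, 0) (1, 0) (1, 1) + 8 * dX 1 1 (0, 0) (0, 1) (1, 0)
  rotate_left
  linear_combination (norm := skip)
    -16 * dX 0 1 (0, 1) (1, 0) (1, 1) + 8 * dX 1 1 (0, 0) (0, 1) (1, 1)
  rotate_left
  linear_combination (norm := skip) -24 * dX 1 1 (0, 0) (1, 0) (1, 1)
  rotate_left
  linear_combination (norm := skip) -24 * dX 1 1 (0, 1) (1, 0) (1, 1)
  rotate_left
  all_goals
    simp only [phi12, sym12, contrE, leeR, cov2, asdY, extCov2, hU, spinΓ, epsR,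
      Fintype.sum_prod_type, Fin.sum_univ_two, hX, d0, aX _ _ (0, 1) (0, 0),
      aX _ _ (1, 0) (0, 0), aX _ _ (1, 1) (0, 0), aX _ _ (1, 0) (0, 1), aX _ _ (1, 1) (0, 1),
      aX _ _ (1, 1) (1, 0), hG (0, 1) (0, 0), hG (1, 0) (0, 0), hG (1, 1) (0, 0), hG (1, 0) (0, 1),
      hG (1, 1) (0, 1), hG (1, 1) (1, 0), hs (0, 1) (0, 0), hs (1, 0) (0, 0), hs (1, 1) (0, 0),
      hs (1, 0) (0, 1), hs (1, 1) (0, 1), hs (1, 1) (1, 0), g1, g2, g3, g4, g5, g6, g7, g8, g9,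
      hX1, hX2, hX3, hu, hup, h01, h10, hL, hn, zero_ne_one,
      one_ne_zero, if_true, if_false, and_true, true_and, and_false, false_and, and_self, map_add,
      map_sub, map_neg, Derivation.leibniz, smul_eq_mul, zero_add, add_zero, mul_zero, zero_mul,
      sub_zero, neg_zero, zero_sub, one_mul, mul_one, neg_mul, Fin.isValue, Fin.zero_eta,
      Fin.mk_one, Fin.reduceFinMk, Fin.castSucc_zero, Fin.castSucc_one, Fin.reduceCastSucc,
      Fin.reduceSucc, Fin.succ_zero_eq_one, Fin.succ_one_eq_two, Matrix.cons_val,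
      Matrix.cons_val_zero, Matrix.cons_val_one, Nat.cast_zero, Nat.cast_one, Nat.cast_ofNat,
      Fin.val_zero, Fin.val_one, Fin.val_two, Fin.coe_ofNat_eq_mod, Nat.reduceMod, sub_neg_eq_add, neg_neg]
    ring

end Bianchi

end SDEinstein

end

noncomputable section

namespace SDEinstein

set_option linter.unusedSectionVars false
set_option linter.unusedSimpArgs false

/-! ### The wave operator in a spin frame -/

section Wave

variable {R : Type*} [CommRing R] [Algebra ℂ R]
variable (D : Bisp → Derivation ℂ R R) (u up : Bisp → Fin 2 → Fin 2 → R)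

/-- The connection form of the covariant derivative on scalars of weights `(-3, 2r)`. -/
def wCoef (u : Bisp → Fin 2 → Fin 2 → R) (r : R) (k : Bisp) : R :=
  if k.1 = 0 then -2 * r * u k 0 0 - (3 + r) * leeR u k
  else -2 * r * u k 0 0 - (3 - r) * leeR u k

/-- The covariant derivative of a scalar of weights `(-3, 2r)`. -/
def wDer (r : R) (ψ : R) (k : Bisp) : R := D k ψ + wCoef u r k * ψ

/-- The wave operator on scalars of weights `(-3, 2r)`. -/
def wBox (r ψ : R) : R :=
  ∑ k, ∑ l, etaR R k l * (cov1 D (spinΓ u up) (wDer D u r ψ) k l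
    + wCoef u r k * wDer D u r ψ l
    - (leeR u k * wDer D u r ψ l + leeR u l * wDer D u r ψ k
      - etaR R k l * ∑ m, ∑ n, etaR R m n * leeR u n * wDer D u r ψ m))

/-- The divergence of a primed spinor along `o^A`. -/
def div0 (r : R) (v : Fin 2 → R) : R :=
  ∑ A', ∑ B', epsR R A' B' * (D (0, A') (v B') - ∑ C', up (0, A') B' C' * v C'
    + (-(2 * r - 1) * u (0, A') 0 0 - (2 + r) * leeR u (0, A')) * v B')

/-- The divergence of a primed spinor along `ι^A`. -/
def div1 (r : R) (v : Fin 2 → R) : R :=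
  ∑ A', ∑ B', epsR R A' B' * (D (1, A') (v B') - ∑ C', up (1, A') B' C' * v C'
    + (-(2 * r + 1) * u (1, A') 0 0 - (2 - r) * leeR u (1, A')) * v B')

/-- Twelve times the components of the symmetrisation of a spinor with four indices. -/
def fullSym12 (K : Fin 2 → Fin 2 → Fin 2 → Fin 2 → R) (i : Fin 5) : R :=
  ![12 * K 0 0 0 0, 3 * (K 1 0 0 0 + K 0 1 0 0 + K 0 0 1 0 + K 0 0 0 1),
    2 * (K 1 1 0 0 + K 1 0 1 0 + K 1 0 0 1 + K 0 1 1 0 + K 0 1 0 1 + K 0 0 1 1),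
    3 * (K 1 1 1 0 + K 1 1 0 1 + K 1 0 1 1 + K 0 1 1 1), 12 * K 1 1 1 1] i

variable {D u up}

lemma div0_sub (r : R) (v w : Fin 2 → R) :
    div0 D u up r (fun B => v B - w B) = div0 D u up r v - div0 D u up r w := by
  simp only [div0, ← Finset.sum_sub_distrib, map_sub, mul_sub]
  refine Finset.sum_congr rfl fun _ _ => Finset.sum_congr rfl fun _ _ => ?_
  simp only [Finset.sum_sub_distrib]
  ring

lemma div1_sub (r : R) (v w : Fin 2 → R) :
    div1 D u up r (fun B => v B - w B) = div1 D u up r v - div1 D u up r w := by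
  simp only [div1, ← Finset.sum_sub_distrib, map_sub, mul_sub]
  refine Finset.sum_congr rfl fun _ _ => Finset.sum_congr rfl fun _ _ => ?_
  simp only [Finset.sum_sub_distrib]
  ring

/-- Again the trace-free primed connection commutes with contraction by `ε^{C'E'}`, leaving a spinor
with one primed and three unprimed indices. -/
lemma contrE_cov3 (hup : ∀ k, up k 1 1 = -up k 0 0) (N : Bisp → Bisp → Bisp → R) (a : Bisp)
    (B' B C E : Fin 2) :
    ∑ C', ∑ E', epsR R C' E' * cov3 D (spinΓ u up) N a (E, E') (B, B') (C, C')
      = D a (contrE N B' B C E) - ∑ C', up a B' C' * contrE N C' B C E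
        - ∑ F, (u a B F * contrE N B' F C E + u a C F * contrE N B' B F E
          + u a E F * contrE N B' B C F) := by
  fin_cases B <;> fin_cases C <;> fin_cases E <;> fin_cases B' <;>
  · simp only [contrE, cov3, spinΓ, epsR, Fintype.sum_prod_type, Fin.sum_univ_two, hup, zero_ne_one,
      one_ne_zero, if_true, if_false, and_true, true_and, and_false, false_and, and_self, map_add,
      map_neg, zero_add, add_zero, mul_zero, zero_mul, sub_zero, neg_zero, zero_sub, one_mul,
      mul_one, neg_mul, Fin.isValue, Fin.zero_eta, Fin.mk_one]
    ring

/-- When the four unprimed indices are symmetrised with `i` of them equal to `ι`, the index of the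
outer derivative is `o` in the proportion `(4-i)/4` and `ι` in the proportion `i/4`. This produces
the coefficients `3 : 1`, `1 : 1` and `1 : 3`. The connection terms mixing neighbouring components
are either zero by integrability or Lee terms, absorbed in the weights of `div0` and `div1`. -/
lemma fullSym12_source (hu : ∀ k, u k 1 1 = -u k 0 0) (h01 : ∀ k', u (0, k') 0 1 = 0)
    (h10 : ∀ k', u (1, k') 1 0 = 0)
    {K : Fin 2 → Fin 2 → Fin 2 → Fin 2 → R} {S : Fin 2 → Fin 2 → Fin 2 → Fin 2 → R}
    (hS : ∀ A B C E, S A B C E = ∑ A', ∑ B', epsR R A' B' *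
      (D (A, A') (K B' B C E) - ∑ C', up (A, A') B' C' * K C' B C E
        - ∑ F, (u (A, A') B F * K B' F C E + u (A, A') C F * K B' B F E
          + u (A, A') E F * K B' B C F) - 4 * leeR u (A, A') * K B' B C E)) :
    fullSym12 S 0 = div0 D u up 2 (fun B' => sym12 (K B') 0) ∧
    4 * fullSym12 S 1 = 3 * div0 D u up 1 (fun B' => sym12 (K B') 1)
      + div1 D u up 1 (fun B' => sym12 (K B') 0) ∧
    2 * fullSym12 S 2 = div0 D u up 0 (fun B' => sym12 (K B') 2)
      + div1 D u up 0 (fun B' => sym12 (K B') 1) ∧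
    4 * fullSym12 S 3 = div0 D u up (-1) (fun B' => sym12 (K B') 3)
      + 3 * div1 D u up (-1) (fun B' => sym12 (K B') 2) ∧
    fullSym12 S 4 = div1 D u up (-2) (fun B' => sym12 (K B') 3) := by
  have hn : ∀ k, D k 4 = 0 ∧ D k 12 = 0 := fun k => ⟨derivation_ofNat _ 4, derivation_ofNat _ 12⟩
  refine ⟨?_, ?_, ?_, ?_, ?_⟩ <;>
  · simp only [fullSym12, hS, div0, div1, sym12, leeR, epsR, Fin.sum_univ_two, h01, h10, hu, hn,
      zero_ne_one, one_ne_zero, if_true, if_false, and_true, true_and, and_false, false_and,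
      and_self, map_add, map_sub, map_neg, Derivation.leibniz, smul_eq_mul, zero_add, add_zero,
      mul_zero, zero_mul, sub_zero, neg_zero, zero_sub, one_mul, mul_one, neg_mul, Fin.isValue,
      Matrix.cons_val]
    ring

variable {L : R}

/-- The spin connections `u`, `up` in an adapted frame of an integrable complex structure on a
self-dual Einstein manifold, `R_{ab} = 6 L g_{ab}`. -/
structure IsAdapted (D : Bisp → Derivation ℂ R R) (u up : Bisp → Fin 2 → Fin 2 → R) (L : R) :
    Prop where
  trace : ∀ k, u k 1 1 = -u k 0 0
  trace' : ∀ k, up k 1 1 = -up k 0 0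
  integrable0 : ∀ k', u (0, k') 0 1 = 0
  integrable1 : ∀ k', u (1, k') 1 0 = 0
  commutator : ∀ k l f, D k (D l f) - D l (D k f)
    = ∑ p, (spinΓ u up p k l - spinΓ u up p l k) * D p f
  curvature : ∀ k l A B, curvForm D (spinΓ u up) u k l A B = -L * epsR R k.2 l.2 *
    ((if k.1 = B then 1 else 0) * epsR R l.1 A + (if l.1 = B then 1 else 0) * epsR R k.1 A)

/-- This composition is the commutator of the twisted derivatives along the two vectors `E_{00'}`,
`E_{01'}`. Their span is involutive, and the curvature components that occur, including those
governing the derivatives of the Lee form, vanish. The twist is thus flat along the span. -/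
lemma IsAdapted.div0_wDer0 (ha : IsAdapted D u up L) (r ψ : R)
    (hr : ∀ k, D k r = 0) :
    div0 D u up (r + 1) (fun B' => wDer D u r ψ (0, B')) = 0 := by
  have c := ha.commutator (0, 0) (0, 1) ψ
  have c1 := ha.curvature (0, 0) (0, 1) 0 0
  have c2 := ha.curvature (0, 0) (1, 1) 0 1
  have c3 := ha.curvature (0, 1) (1, 0) 0 1
  have hn : ∀ k, D k 2 = 0 ∧ D k 3 = 0 := fun k => ⟨derivation_ofNat _ 2, derivation_ofNat _ 3⟩
  simp [curvForm, epsR, Fintype.sum_prod_type, Fin.sum_univ_two, ha.integrable0, ha.integrable1,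
    ha.trace, ha.trace', spinΓ] at c c1 c2 c3
  simp [div0, wDer, wCoef, leeR, epsR, Fin.sum_univ_two, ha.integrable0, ha.integrable1,
    ha.trace, ha.trace', hr, hn,
    zero_ne_one, one_ne_zero, if_true, if_false, and_true, true_and, and_false, false_and, and_self,
    map_add, map_sub, map_neg, Derivation.leibniz, smul_eq_mul, zero_add, add_zero, mul_zero,
    zero_mul, sub_zero, neg_zero, zero_sub, one_mul, mul_one, neg_mul, Fin.isValue]
  linear_combination c - 2 * r * ψ * c1 + (3 + r) * ψ * (c2 - c3)

/-- The counterpart of `div0_wDer0` for the other eigenspace of `J`; exchanging `o` and `ι` reverses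
the sign of `r`. -/
lemma IsAdapted.div1_wDer1 (ha : IsAdapted D u up L) (r ψ : R)
    (hr : ∀ k, D k r = 0) :
    div1 D u up (r - 1) (fun B' => wDer D u r ψ (1, B')) = 0 := by
  have c := ha.commutator (1, 0) (1, 1) ψ
  have c1 := ha.curvature (1, 0) (1, 1) 0 0
  have c2 := ha.curvature (0, 0) (1, 1) 1 0
  have c3 := ha.curvature (0, 1) (1, 0) 1 0
  have hn : ∀ k, D k 2 = 0 ∧ D k 3 = 0 := fun k => ⟨derivation_ofNat _ 2, derivation_ofNat _ 3⟩
  simp [curvForm, epsR, Fintype.sum_prod_type, Fin.sum_univ_two, ha.integrable0, ha.integrable1,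
    ha.trace, ha.trace', spinΓ] at c c1 c2 c3
  simp [div1, wDer, wCoef, leeR, epsR, Fin.sum_univ_two, ha.integrable0, ha.integrable1,
    ha.trace, ha.trace', hr, hn,
    zero_ne_one, one_ne_zero, if_true, if_false, and_true, true_and, and_false, false_and, and_self,
    map_add, map_sub, map_neg, Derivation.leibniz, smul_eq_mul, zero_add, add_zero, mul_zero,
    zero_mul, sub_zero, neg_zero, zero_sub, one_mul, mul_one, neg_mul, Fin.isValue]
  linear_combination c - 2 * r * ψ * c1 + (3 - r) * ψ * (c2 - c3)

/-- The trace in `wBox` pairs vectors of opposite eigenspaces, so each product occurs in both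
orders; commutators bring all of them to the order with the derivative along `ι` applied first. The
curvature contributions are `4 r L` from the GHP part and `-4 r L` from the Lee part of the weights,
and they cancel. Hence no potential remains in the wave operator. -/
lemma IsAdapted.wBox_eq_div0 (ha : IsAdapted D u up L) (r ψ : R)
    (hr : ∀ k, D k r = 0) :
    wBox D u up r ψ = 2 * div0 D u up r (fun B' => wDer D u r ψ (1, B')) := by
  have c := ha.commutator (0, 0) (1, 1) ψ
  have c' := ha.commutator (0, 1) (1, 0) ψ
  have c1 := ha.curvature (0, 0) (1, 1) 0 0
  have c2 := ha.curvature (0, 1) (1, 0) 0 0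
  have c3 := ha.curvature (0, 0) (0, 1) 1 0
  have c4 := ha.curvature (1, 0) (1, 1) 0 1
  have hn : ∀ k, D k 2 = 0 ∧ D k 3 = 0 := fun k => ⟨derivation_ofNat _ 2, derivation_ofNat _ 3⟩
  simp [curvForm, epsR, Fintype.sum_prod_type, Fin.sum_univ_two, ha.integrable0, ha.integrable1,
    ha.trace, ha.trace', spinΓ] at c c' c1 c2 c3 c4
  simp only [wBox, div0, wDer, wCoef, leeR, etaR, epsR, cov1, spinΓ, Fintype.sum_prod_type,
    Fin.sum_univ_two, ha.integrable0, ha.integrable1, ha.trace, ha.trace', hr, hn,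
    zero_ne_one, one_ne_zero, if_true, if_false, and_true, true_and, and_false, false_and, and_self,
    map_add, map_sub, map_neg, Derivation.leibniz, smul_eq_mul, zero_add, add_zero, mul_zero,
    zero_mul, sub_zero, neg_zero, zero_sub, one_mul, mul_one, neg_mul, Fin.isValue]
  linear_combination -c + c' + 2 * r * ψ * (c1 - c2) - (3 - r) * ψ * c3 - (3 + r) * ψ * c4

/-- The opposite ordering of the same mixed products; the curvature contributions cancel in the same
way. -/
lemma IsAdapted.wBox_eq_div1 (ha : IsAdapted D u up L) (r ψ : R)
    (hr : ∀ k, D k r = 0) :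
    wBox D u up r ψ = -2 * div1 D u up r (fun B' => wDer D u r ψ (0, B')) := by
  have c := ha.commutator (0, 0) (1, 1) ψ
  have c' := ha.commutator (0, 1) (1, 0) ψ
  have c1 := ha.curvature (0, 0) (1, 1) 0 0
  have c2 := ha.curvature (0, 1) (1, 0) 0 0
  have c3 := ha.curvature (0, 0) (0, 1) 1 0
  have c4 := ha.curvature (1, 0) (1, 1) 0 1
  have hn : ∀ k, D k 2 = 0 ∧ D k 3 = 0 := fun k => ⟨derivation_ofNat _ 2, derivation_ofNat _ 3⟩
  simp [curvForm, epsR, Fintype.sum_prod_type, Fin.sum_univ_two, ha.integrable0, ha.integrable1,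
    ha.trace, ha.trace', spinΓ] at c c' c1 c2 c3 c4
  simp only [wBox, div1, wDer, wCoef, leeR, etaR, epsR, cov1, spinΓ, Fintype.sum_prod_type,
    Fin.sum_univ_two, ha.integrable0, ha.integrable1, ha.trace, ha.trace', hr, hn,
    zero_ne_one, one_ne_zero, if_true, if_false, and_true, true_and, and_false, false_and, and_self,
    map_add, map_sub, map_neg, Derivation.leibniz, smul_eq_mul, zero_add, add_zero, mul_zero,
    zero_mul, sub_zero, neg_zero, zero_sub, one_mul, mul_one, neg_mul, Fin.isValue]
  linear_combination c - c' - 2 * r * ψ * (c1 - c2) + (3 - r) * ψ * c3 + (3 + r) * ψ * c4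

end Wave

end SDEinstein

end

noncomputable section

namespace SDEinstein

set_option linter.unusedSectionVars false
set_option linter.unusedSimpArgs false

/-! ### The wave equation for the perturbed Weyl spinor in a spin frame -/

section FrameTeukolsky

variable {R : Type*} [CommRing R] [Algebra ℂ R]
variable {D : Bisp → Derivation ℂ R R} {u up : Bisp → Fin 2 → Fin 2 → R} {L : R}
variable {H : Bisp → Bisp → Bisp → Bisp → R} {h E : Bisp → Bisp → R}

/-- The double contraction of `H` with `ε^{A'B'} ε^{C'D'}`. -/
def dblContr (H : Bisp → Bisp → Bisp → Bisp → R) (A B C F : Fin 2) : R :=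
  ∑ A', ∑ B', epsR R A' B' * ∑ C', ∑ F', epsR R C' F' * H (A, A') (B, B') (C, C') (F, F')

/-- Both sides are the totally symmetric part of the unprimed two-form part of `X`. The pair
symmetries are needed because the two contractions of `H` distribute the indices differently. -/
lemma fullSym12_dblContr
    (hX1 : asdX H 0 0 (0, 0) (1, 1) - asdX H 0 0 (0, 1) (1, 0) = 2 * asdX H 0 1 (0, 0) (0, 1))
    (hX2 : asdX H 0 0 (1, 0) (1, 1) = asdX H 1 1 (0, 0) (0, 1))
    (hX3 : 2 * asdX H 0 1 (1, 0) (1, 1) = asdX H 1 1 (0, 0) (1, 1) - asdX H 1 1 (0, 1) (1, 0))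
    (i : Fin 5) :
    fullSym12 (dblContr fun a b c d => H c b a d) i = phi12 (asdX H) i := by
  simp only [asdX, Fin.sum_univ_two, epsR, Fin.isValue, zero_ne_one, one_ne_zero, if_true, if_false,
    and_true, and_false, and_self, zero_mul, zero_add, add_zero, one_mul, neg_mul] at hX1 hX2 hX3
  have key : ∀ K, K = (dblContr fun a b c d => H c b a d) →
      2 * fullSym12 K 0 = 2 * phi12 (asdX H) 0 ∧ 2 * fullSym12 K 1 = 2 * phi12 (asdX H) 1 ∧
      2 * fullSym12 K 2 = 2 * phi12 (asdX H) 2 ∧ 2 * fullSym12 K 3 = 2 * phi12 (asdX H) 3 ∧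
      2 * fullSym12 K 4 = 2 * phi12 (asdX H) 4 := by
    rintro K rfl
    simp only [fullSym12, dblContr, phi12, asdX, Fin.sum_univ_two, epsR, Fin.isValue, zero_ne_one,
      one_ne_zero, if_true, if_false, and_true, true_and, and_false, false_and, and_self, zero_mul,
      zero_add, add_zero, one_mul, neg_mul, Matrix.cons_val]
    refine ⟨?_, ?_, ?_, ?_, ?_⟩
    · ring
    · linear_combination 3 * hX1
    · linear_combination -2 * hX2
    · linear_combination -3 * hX3
    · ring
  obtain ⟨k0, k1, k2, k3, k4⟩ := key _ rfl
  match i with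
  | 0 => exact two_cancel k0
  | 1 => exact two_cancel k1
  | 2 => exact two_cancel k2
  | 3 => exact two_cancel k3
  | 4 => exact two_cancel k4

lemma wBox_fullSym12 (ha : IsAdapted D u up L) (hL : ∀ k, D k L = 0)
    (hc : IsSDEinsteinCurv L (curvForm D (spinΓ u up) u) (curvForm D (spinΓ u up) up))
    (hs : ∀ k l, h k l = h l k) (hEs : ∀ k l, E k l = E l k)
    (hH : H = cov3 D (spinΓ u up) (cov2 D (spinΓ u up) h)) {c : R}
    (hE : ∀ k l, 2 * E k l = (∑ m, ∑ n, etaR R m n * (H n k l m + H n l k m - H m n k l - H k l m n))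
      - 12 * L * h k l + c * etaR R k l)
    {S : Fin 2 → Fin 2 → Fin 2 → Fin 2 → R}
    (hS : S = dblContr fun a b c d => cov3 D (spinΓ u up) (cov2 D (spinΓ u up) E) a d b c
        - 4 * leeR u a * cov2 D (spinΓ u up) E d b c) (i : Fin 5) :
    wBox D u up (2 - ((i : ℕ) : R)) (fullSym12 (dblContr fun a b c d => H c b a d) i)
      = -2 * fullSym12 S i := by
  have hNs : ∀ a k l, cov2 D (spinΓ u up) h a k l = cov2 D (spinΓ u up) h a l k := by
    intro a k l
    simp only [cov2]
    rw [hs k l]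
    congr 1
    exact Finset.sum_congr rfl fun m _ => by rw [hs m l, hs k m]; ring
  have hHs : ∀ a b k l, H a b k l = H a b l k := by
    intro a b k l
    simp only [hH, cov3]
    rw [hNs b k l]
    congr 1
    exact Finset.sum_congr rfl fun m _ => by rw [hNs m k l, hNs b m l, hNs b k m]; ring
  have hHc : ∀ i j k l, H i j k l - H j i k l
      = -∑ m, (spinRiem (curvForm D (spinΓ u up) u) (curvForm D (spinΓ u up) up) m k i j * h m l
        + spinRiem (curvForm D (spinΓ u up) u) (curvForm D (spinΓ u up) up) m l i j * h k m) := by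
    intro i j k l
    rw [hH, cov3_cov2_commutator ha.commutator]
    simp only [frameRiem_spinΓ]
  obtain ⟨e1, e2, e3, e4, e5, e6, e7, e8, e9⟩ := hc.selfDual_asdX hs hHs hHc hE
  obtain ⟨s1, s2, s3⟩ := hc.symm_asdX hs hHs hHc
  have hXY : ∀ A B k l, asdX H A B k l = extCov1 D
      (fun p k l => spinΓ u up p k l - spinΓ u up p l k) u (asdY (cov2 D (spinΓ u up) h)) A B k l :=
    fun A B k l => by rw [hH, asdX_cov3 ha.trace']
  have hX : asdX H = extCov1 D (fun p k l => spinΓ u up p k l - spinΓ u up p l k) u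
      (asdY (cov2 D (spinΓ u up) h)) := by
    funext A B k l; exact hXY A B k l
  have dX : ∀ A B i j k, extCov2 D (fun p k l => spinΓ u up p k l - spinΓ u up p l k) u
        (asdX H) A B i j k
      + extCov2 D (fun p k l => spinΓ u up p k l - spinΓ u up p l k) u (asdX H) A B j k i
      + extCov2 D (fun p k l => spinΓ u up p k l - spinΓ u up p l k) u (asdX H) A B k i j
      = -∑ C, (curvForm D (spinΓ u up) u i j A C * asdY (cov2 D (spinΓ u up) h) C B k
        + curvForm D (spinΓ u up) u i j B C * asdY (cov2 D (spinΓ u up) h) A C k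
        + (curvForm D (spinΓ u up) u j k A C * asdY (cov2 D (spinΓ u up) h) C B i
        + curvForm D (spinΓ u up) u j k B C * asdY (cov2 D (spinΓ u up) h) A C i)
        + (curvForm D (spinΓ u up) u k i A C * asdY (cov2 D (spinΓ u up) h) C B j
        + curvForm D (spinΓ u up) u k i B C * asdY (cov2 D (spinΓ u up) h) A C j)) := by
    intro A B i j k
    rw [hX]
    refine extCov2_extCov1 ha.commutator i j k (fun q => ?_) (fun _ _ _ _ => rfl) _ A B
    refine torsion_jacobi (q := q) (l := k) (i := i) (j := j) ?_
    simpa only [frameRiem_spinΓ] using hc.bianchi q k i j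
  -- The factor 4 in `G` clears the denominators in the nine component equations for `E`.
  have hB := bianchi_aux (G := fun k l => 4 * E k l) (h := h) (X := asdX H)
    ha.trace ha.trace' ha.integrable0 ha.integrable1 hL
    (by funext k l; exact asdX_symm H 1 0 k l) (fun A B k l => asdX_antisymm H A B l k) dX
    hc.unprimed hs (fun k l => by rw [hEs k l]) (by linear_combination s1) s2.symm
    (by linear_combination -s3) (by linear_combination 2 * e1) (by linear_combination e2)
    (by linear_combination 2 * e3) (by linear_combination 2 * e4) (by linear_combination 2 * e5)
    (by linear_combination 2 * e6) (by linear_combination 2 * e7) (by linear_combination e8)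
    (by linear_combination 2 * e9)
  have h4 : ∀ k, D k (4 : R) = 0 := fun k => derivation_ofNat (D k) 4
  have hN4 : ∀ a k l, cov2 D (spinΓ u up) (fun k l => 4 * E k l) a k l
      = 4 * cov2 D (spinΓ u up) E a k l := by
    intro a k l
    simp only [cov2, Derivation.leibniz, smul_eq_mul, mul_sub, Finset.mul_sum,
      h4, mul_zero, add_zero]
    congr 1
    exact Finset.sum_congr rfl fun m _ => by ring
  have hJ4 : ∀ B' i, sym12 (contrE (cov2 D (spinΓ u up) fun k l => 4 * E k l) B') i
      = 4 * sym12 (contrE (cov2 D (spinΓ u up) E) B') i := by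
    intro B' i
    fin_cases i <;>
    · simp [sym12, contrE, hN4, Fin.sum_univ_two]
      ring
  have hB' : ∀ (i : Fin 4) (B' : Fin 2),
      sym12 (contrE (cov2 D (spinΓ u up) E) B') i
        = wDer D u (2 - (((i.succ : Fin 5) : ℕ) : R)) (phi12 (asdX H) i.succ) (0, B')
        - wDer D u (2 - (((i.castSucc : Fin 5) : ℕ) : R)) (phi12 (asdX H) i.castSucc) (1, B') := by
    intro i B'
    have := hB i B'
    rw [hJ4] at this
    refine four_cancel ?_
    simp only [wDer, wCoef, if_true, one_ne_zero, if_false, Fin.val_succ, Fin.val_castSucc,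
      Nat.cast_add, Nat.cast_one]
    linear_combination this
  have hS' : ∀ A B C F, S A B C F = ∑ A', ∑ B', epsR R A' B' *
      (D (A, A') (contrE (cov2 D (spinΓ u up) E) B' B C F)
        - ∑ C', up (A, A') B' C' * contrE (cov2 D (spinΓ u up) E) C' B C F
        - ∑ F', (u (A, A') B F' * contrE (cov2 D (spinΓ u up) E) B' F' C F
          + u (A, A') C F' * contrE (cov2 D (spinΓ u up) E) B' B F' F
          + u (A, A') F F' * contrE (cov2 D (spinΓ u up) E) B' B C F')
        - 4 * leeR u (A, A') * contrE (cov2 D (spinΓ u up) E) B' B C F) := by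
    intro A B C F
    simp only [hS, dblContr]
    refine Finset.sum_congr rfl fun A' _ => Finset.sum_congr rfl fun B' _ => ?_
    rw [← contrE_cov3 ha.trace']
    simp only [contrE, Fin.sum_univ_two, mul_sub]
    ring
  obtain ⟨t0, t1, t2, t3, t4⟩ := fullSym12_source ha.trace ha.integrable0 ha.integrable1 hS'
  have hr : ∀ (z : ℤ) k, D k (z : R) = 0 := fun z k => (D k).map_intCast z
  have j0 : (fun B' => sym12 (contrE (cov2 D (spinΓ u up) E) B') 0)
      = fun B' => wDer D u 1 (phi12 (asdX H) 1) (0, B') - wDer D u 2 (phi12 (asdX H) 0) (1, B') := by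
    funext B'; simpa [show (2 : R) - 1 = 1 by ring] using hB' 0 B'
  have j1 : (fun B' => sym12 (contrE (cov2 D (spinΓ u up) E) B') 1)
      = fun B' => wDer D u 0 (phi12 (asdX H) 2) (0, B') - wDer D u 1 (phi12 (asdX H) 1) (1, B') := by
    funext B'; simpa [show (2 : R) - 1 = 1 by ring] using hB' 1 B'
  have j2 : (fun B' => sym12 (contrE (cov2 D (spinΓ u up) E) B') 2)
      = fun B' => wDer D u (-1) (phi12 (asdX H) 3) (0, B')
        - wDer D u 0 (phi12 (asdX H) 2) (1, B') := by
    funext B'; simpa [show (2 : R) - 3 = -1 by ring] using hB' 2 B'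
  have j3 : (fun B' => sym12 (contrE (cov2 D (spinΓ u up) E) B') 3)
      = fun B' => wDer D u (-2) (phi12 (asdX H) 4) (0, B')
        - wDer D u (-1) (phi12 (asdX H) 3) (1, B') := by
    funext B'; simpa [show (2 : R) - 3 = -1 by ring, show (2 : R) - 4 = -2 by ring] using hB' 3 B'
  rw [j0, div0_sub] at t0
  rw [j0, j1, div0_sub, div1_sub] at t1
  rw [j1, j2, div0_sub, div1_sub] at t2
  rw [j2, j3, div0_sub, div1_sub] at t3
  rw [j3, div1_sub] at t4
  -- The weights are written as integer casts because every derivation annihilates those.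
  have z0 : ∀ (n : ℤ) (ψ : R) (q : R), q = (n : R) + 1 →
      div0 D u up q (fun B' => wDer D u (n : R) ψ (0, B')) = 0 := by
    rintro n ψ _ rfl; exact ha.div0_wDer0 _ _ (hr n)
  have z1 : ∀ (n : ℤ) (ψ : R) (q : R), q = (n : R) - 1 →
      div1 D u up q (fun B' => wDer D u (n : R) ψ (1, B')) = 0 := by
    rintro n ψ _ rfl; exact ha.div1_wDer1 _ _ (hr n)
  have b0 := fun (n : ℤ) ψ => ha.wBox_eq_div0 (n : R) ψ (hr n)
  have b1 := fun (n : ℤ) ψ => ha.wBox_eq_div1 (n : R) ψ (hr n)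
  have c0 := z0 1 (phi12 (asdX H) 1) 2 (by norm_num)
  have c1 := z0 0 (phi12 (asdX H) 2) 1 (by norm_num)
  have c2 := z0 (-1) (phi12 (asdX H) 3) 0 (by norm_num)
  have c3 := z0 (-2) (phi12 (asdX H) 4) (-1) (by norm_num)
  have d0 := z1 2 (phi12 (asdX H) 0) 1 (by norm_num)
  have d1 := z1 1 (phi12 (asdX H) 1) 0 (by norm_num)
  have d2 := z1 0 (phi12 (asdX H) 2) (-1) (by norm_num)
  have d3 := z1 (-1) (phi12 (asdX H) 3) (-2) (by norm_num)
  push_cast at b0 b1 c0 c1 c2 c3 d0 d1 d2 d3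
  -- The divergences along `o` and `ι` are added with weights `4 - i` and `i`, reduced by common
  -- factors. The neighbours `φ_{i+1}` and `φ_{i-1}` vanish by `c0` to `d3`, and both remaining
  -- terms are multiples of the same wave operator. For `i = 0` and `i = 4` a single divergence is
  -- enough.
  rw [fullSym12_dblContr s1 s2 s3]
  match i with
  | 0 =>
    have f0 := b0 2 (phi12 (asdX H) 0)
    simp only [Int.cast_ofNat, Fin.coe_ofNat_eq_mod, Nat.zero_mod, Nat.cast_zero, sub_zero] at f0 ⊢
    linear_combination f0 + 2 * t0 + 2 * c0
  | 1 =>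
    have f0 := b0 1 (phi12 (asdX H) 1)
    have f1 := b1 1 (phi12 (asdX H) 1)
    rw [show (2 : R) - (((1 : Fin 5) : ℕ) : R) = 1 by norm_num]
    rw [Int.cast_one] at f0 f1
    refine four_cancel ?_
    linear_combination 3 * f0 + f1 + 2 * t1 + 6 * c1 - 2 * d0
  | 2 =>
    have f0 := b0 0 (phi12 (asdX H) 2)
    have f1 := b1 0 (phi12 (asdX H) 2)
    rw [show (2 : R) - (((2 : Fin 5) : ℕ) : R) = 0 by norm_num]
    rw [Int.cast_zero] at f0 f1
    refine two_cancel ?_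
    linear_combination f0 + f1 + 2 * t2 + 2 * c2 - 2 * d1
  | 3 =>
    have f0 := b0 (-1) (phi12 (asdX H) 3)
    have f1 := b1 (-1) (phi12 (asdX H) 3)
    rw [show (2 : R) - (((3 : Fin 5) : ℕ) : R) = -1 by norm_num]
    push_cast at f0 f1
    refine four_cancel ?_
    linear_combination f0 + 3 * f1 + 2 * t3 + 2 * c3 - 6 * d2
  | 4 =>
    have f1 := b1 (-2) (phi12 (asdX H) 4)
    rw [show (2 : R) - (((4 : Fin 5) : ℕ) : R) = -2 by norm_num]
    push_cast at f1
    linear_combination f1 + 2 * t4 - 2 * d3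

end FrameTeukolsky

end SDEinstein

end

noncomputable section

namespace SDEinstein

set_option linter.unusedSectionVars false
set_option linter.unusedSimpArgs false

/-! ### Dual frames -/

section DualFrame

variable {R : Type*} [CommRing R] [Algebra ℂ R]
variable {n κ : Type*} [Fintype n] [Fintype κ] [DecidableEq n] [DecidableEq κ]

/-- The coframe `θ` is dual to the frame `E`. -/
structure IsDualFrame (E : κ → n → R) (θ : n → κ → R) : Prop where
  right : ∀ k l, ∑ a, E k a * θ a l = if k = l then 1 else 0
  left : ∀ a b, ∑ k, θ a k * E k b = if a = b then 1 else 0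

variable {E : κ → n → R} {θ : n → κ → R}

lemma IsDualFrame.sum_con (hE : IsDualFrame E θ) (v : n → R) (a : n) :
    ∑ k, θ a k * con E k v = v a := by
  simp only [con, Finset.mul_sum, ← mul_assoc]
  rw [Finset.sum_comm]
  simp only [← Finset.sum_mul, hE.left, ite_mul, one_mul, zero_mul, Finset.sum_ite_eq,
    Finset.mem_univ, if_true]

lemma IsDualFrame.coeff (hE : IsDualFrame E θ) (c : κ → R) (p : κ) :
    ∑ a, (∑ q, c q * E q a) * θ a p = c p := by
  simp only [Finset.sum_mul, mul_assoc]
  rw [Finset.sum_comm]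
  simp only [← Finset.mul_sum, hE.right, mul_ite, mul_one, mul_zero, Finset.sum_ite_eq',
    Finset.mem_univ, if_true]

lemma IsDualFrame.coeff_unique (hE : IsDualFrame E θ) {c c' : κ → R}
    (h : ∀ a, ∑ q, c q * E q a = ∑ q, c' q * E q a) (p : κ) : c p = c' p := by
  rw [← hE.coeff c p, ← hE.coeff c' p]
  simp only [h]

variable (D : n → Derivation ℂ R R) (Γ : n → n → n → R)

/-- The connection coefficients of `Γ` in the frame `E` with dual coframe `θ`. -/
def frameConn (E : κ → n → R) (θ : n → κ → R) (p k l : κ) : R :=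
  ∑ a, (frameD E D k (E l a) + ∑ m, con E k (fun b => Γ a b m) * E l m) * θ a p

variable {D Γ}

lemma IsDualFrame.isFrameConn (hE : IsDualFrame E θ) :
    IsFrameConn E D Γ (frameConn D Γ E θ) := by
  intro k l a
  simp only [frameConn, Finset.sum_mul, mul_assoc]
  rw [Finset.sum_comm]
  simp only [← Finset.mul_sum, hE.left, mul_ite, mul_one, mul_zero, Finset.sum_ite_eq',
    Finset.mem_univ, if_true]

lemma aRiem_bianchi (hΓ : ∀ a b c, Γ a b c = Γ a c b) (a b c d : n) :
    aRiem D Γ a b c d + aRiem D Γ a c d b + aRiem D Γ a d b c = 0 := by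
  simp only [aRiem, Finset.sum_sub_distrib, hΓ _ d b, hΓ _ c b, hΓ _ d c]
  ring

variable {Γ' : κ → κ → κ → R}

lemma con3_rotate (T : n → n → n → R) (l i j : κ) :
    con3 E T i j l = con3 E (fun b c d => T c d b) l i j := by
  simp only [con3, con2]
  have h1 : ∀ a, con E j (fun b => con E l fun c => T a b c)
      = con E l fun c => con E j fun b => T a b c := fun a => con_comm E j l _
  simp only [h1]
  rw [con_comm E i l]

/-- The coordinate Bianchi identity is transported by `riem`, and linear independence of the frame
allows the coefficients to be compared. -/
lemma IsFrameConn.bianchi (h : IsFrameConn E D Γ Γ') (hE : IsDualFrame E θ)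
    (hΓ : ∀ a b c, Γ a b c = Γ a c b) (hD : ∀ a b f, D a (D b f) = D b (D a f)) (q l i j : κ) :
    frameRiem (frameD E D) Γ' q l i j + frameRiem (frameD E D) Γ' q i j l
      + frameRiem (frameD E D) Γ' q j l i = 0 := by
  refine hE.coeff_unique (c := fun q => frameRiem (frameD E D) Γ' q l i j
    + frameRiem (frameD E D) Γ' q i j l + frameRiem (frameD E D) Γ' q j l i)
    (c' := fun _ => 0) (fun a => ?_) q
  simp only [add_mul, Finset.sum_add_distrib, ← h.riem hΓ hD, zero_mul, Finset.sum_const_zero]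
  rw [con3_rotate _ l i j, ← con3_rotate _ j l i]
  have e : ∀ T T' T'' : n → n → n → R, (∀ b c d, T b c d + T' b c d + T'' b c d = 0) →
      con3 E T l i j + con3 E T' l i j + con3 E T'' l i j = 0 := by
    intro T T' T'' h0
    simp only [con3, con2, ← con_add, h0]
    simp [con]
  exact e _ _ _ fun b c d => aRiem_bianchi hΓ a b c d

lemma IsFrameConn.ricci (h : IsFrameConn E D Γ Γ') (hE : IsDualFrame E θ)
    (hΓ : ∀ a b c, Γ a b c = Γ a c b) (hD : ∀ a b f, D a (D b f) = D b (D a f)) (l j : κ) :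
    ∑ q, frameRiem (frameD E D) Γ' q l q j
      = con2 E (fun b d => ∑ a, aRiem D Γ a b a d) l j := by
  have e : ∀ q, frameRiem (frameD E D) Γ' q l q j
      = ∑ a, con E q (fun c => con2 E (fun b d => aRiem D Γ a b c d) l j) * θ a q := by
    intro q
    rw [← hE.coeff (fun p => frameRiem (frameD E D) Γ' p l q j) q]
    refine Finset.sum_congr rfl fun a _ => ?_
    rw [← h.riem hΓ hD]
    simp only [con3, con2]
    rw [con_comm E q l]
  simp only [e]
  rw [Finset.sum_comm]
  have : ∀ a, ∑ q, con E q (fun c => con2 E (fun b d => aRiem D Γ a b c d) l j) * θ a q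
      = con2 E (fun b d => aRiem D Γ a b a d) l j := by
    intro a
    rw [← hE.sum_con (fun c => con2 E (fun b d => aRiem D Γ a b c d) l j) a]
    exact Finset.sum_congr rfl fun _ _ => mul_comm _ _
  simp only [this]
  simp only [con2, con_sum]

lemma IsFrameConn.riemLow (h : IsFrameConn E D Γ Γ') (hΓ : ∀ a b c, Γ a b c = Γ a c b)
    (hD : ∀ a b f, D a (D b f) = D b (D a f)) (g : n → n → R) (m l i j : κ) :
    con4 E (fun a b c d => ∑ e, g a e * aRiem D Γ e b c d) m l i j
      = ∑ q, con2 E g m q * frameRiem (frameD E D) Γ' q l i j := by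
  have e1 : ∀ a, con3 E (fun b c d => ∑ e, g a e * aRiem D Γ e b c d) l i j
      = ∑ q, con E q (g a) * frameRiem (frameD E D) Γ' q l i j := by
    intro a
    have : con3 E (fun b c d => ∑ e, g a e * aRiem D Γ e b c d) l i j
        = ∑ e, g a e * con3 E (fun b c d => aRiem D Γ e b c d) l i j := by
      simp only [con3, con2, con_sum, con_mul]
    simp only [this, h.riem hΓ hD, con, Finset.mul_sum, Finset.sum_mul]
    rw [Finset.sum_comm]
    exact Finset.sum_congr rfl fun q _ => Finset.sum_congr rfl fun e _ => by ring
  simp only [con4, e1, con2, con_sum, con_mul_right]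

/-- The covariant derivative of a tensor with one upper index `c` and one lower index `b`. -/
def covEnd (D : n → Derivation ℂ R R) (Γ : n → n → n → R) (J : n → n → R) (a c b : n) : R :=
  D a (J c b) + ∑ m, (Γ c a m * J m b - Γ m a b * J c m)

/-- The Nijenhuis tensor. -/
def aNijenhuis (D : n → Derivation ℂ R R) (J : n → n → R) (c a b : n) : R :=
  ∑ d, (J d a * D d (J c b) - J d b * D d (J c a) - J c d * (D a (J d b) - D b (J d a)))

/-- The covector `-½ J^b_c ∇_b J^c_a`. -/
def aLee (D : n → Derivation ℂ R R) (Γ : n → n → n → R) (J : n → n → R) (a : n) : R :=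
  -half R * ∑ b, ∑ c, J b c * covEnd D Γ J b c a

variable {J : n → n → R} {lam : κ → R}

lemma frameD_con (k l : κ) (v : n → R) :
    frameD E D k (con E l v) = con E l (fun b => frameD E D k (v b))
      + ∑ b, frameD E D k (E l b) * v b := by
  simp only [con, map_sum, Derivation.leibniz, smul_eq_mul, Finset.sum_add_distrib]
  congr 1
  exact Finset.sum_congr rfl fun _ _ => mul_comm _ _

/-- Obtained by differentiating `J E_l = λ_l E_l` with constant eigenvalue. -/
lemma frameD_eigen (hJ : ∀ k a, con E k (J a) = lam k * E k a)
    (hl : ∀ k a, D a (lam k) = 0) (k l : κ) (c : n) :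
    con E l (fun b => frameD E D k (J c b))
      = lam l * frameD E D k (E l c) - ∑ b, J c b * frameD E D k (E l b) := by
  have h1 := frameD_con (D := D) (E := E) k l (J c)
  have h2 : frameD E D k (lam l) = 0 := by
    rw [frameD_apply]; simp [con, hl]
  simp only [hJ, Derivation.leibniz, smul_eq_mul, h2, mul_zero, add_zero] at h1
  simp only [mul_comm (J c _)]
  linear_combination -h1

/-- For two vectors with the same constant eigenvalue `λ` the Nijenhuis tensor equals `(J - λ)²
[E_k, E_l]`. It measures the part of the bracket that leaves the eigenspace. -/
lemma IsFrameConn.nijenhuis (h : IsFrameConn E D Γ Γ') (hΓ : ∀ a b c, Γ a b c = Γ a c b)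
    (hJ : ∀ k a, con E k (J a) = lam k * E k a)
    (hl : ∀ k a, D a (lam k) = 0) (k l : κ) (hkl : lam l = lam k) (c : n) :
    con2 E (aNijenhuis D J c) k l
      = ∑ p, ((lam p - lam k) ^ 2 * (Γ' p k l - Γ' p l k)) * E p c := by
  have t : ∀ k l, ∑ d, con E k (J d) * con E l (fun b => D d (J c b))
      = lam k * (lam l * frameD E D k (E l c) - ∑ b, J c b * frameD E D k (E l b)) := by
    intro k l
    rw [← frameD_eigen hJ hl]
    simp only [hJ, mul_assoc, ← Finset.mul_sum]
    change lam k * con E k (fun d => con E l fun b => D d (J c b)) = _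
    rw [con_comm]
    simp only [frameD_apply]
  have e1 : con2 E (aNijenhuis D J c) k l
      = ∑ d, con E k (J d) * con E l (fun b => D d (J c b))
        - ∑ d, con E l (J d) * con E k (fun b => D d (J c b))
        - ∑ d, J c d * (con E l (fun b => frameD E D k (J d b))
          - con E k (fun b => frameD E D l (J d b))) := by
    simp only [con2, aNijenhuis, con_sum, con_sub, con_mul, con_mul_right, frameD_apply,
      Finset.sum_sub_distrib]
    congr 1
    refine Finset.sum_congr rfl fun d _ => ?_
    rw [con_comm E k l fun a b => D a (J d b)]
  have w : ∀ a, frameD E D k (E l a) = frameD E D l (E k a)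
      + ∑ p, (Γ' p k l - Γ' p l k) * E p a := fun a => by rw [← h.torsion hΓ]; ring
  obtain ⟨T, hT⟩ : ∃ T : κ → R, ∀ p, Γ' p k l - Γ' p l k = T p := ⟨_, fun _ => rfl⟩
  simp only [hT] at w ⊢
  have s1 : ∀ (q : κ → R) (c : n), ∑ b, J c b * ∑ p, q p * E p b
      = ∑ p, (q p * lam p) * E p c := by
    intro q c
    simp only [mul_assoc, ← hJ, con, Finset.mul_sum]
    rw [Finset.sum_comm]
    exact Finset.sum_congr rfl fun _ _ => Finset.sum_congr rfl fun _ _ => by ring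
  have s2 : ∀ (q : κ → R), ∑ d, J c d * ∑ b, J d b * ∑ p, q p * E p b
      = ∑ p, (q p * lam p * lam p) * E p c := by
    intro q
    simp only [s1]
  rw [e1, t, t]
  simp only [frameD_eigen hJ hl, w, hkl, mul_add, Finset.sum_add_distrib, mul_sub,
    Finset.sum_sub_distrib, s1, s2]
  have s3 : ∀ d, J c d * (lam k * ∑ p, T p * E p d)
      = lam k * (J c d * ∑ p, T p * E p d) := fun d => by ring
  simp only [s3, ← Finset.mul_sum, s1]
  have f : ∑ p, ((lam p - lam k) ^ 2 * T p) * E p c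
      = lam k * (lam k * ∑ p, T p * E p c)
        - 2 * (lam k * ∑ p, (T p * lam p) * E p c)
        + ∑ p, (T p * lam p * lam p) * E p c := by
    simp only [Finset.mul_sum, ← Finset.sum_sub_distrib, ← Finset.sum_add_distrib]
    exact Finset.sum_congr rfl fun _ _ => by ring
  rw [f]
  ring

/-- In an eigenframe `∇_p J` has the entries `(λ_k - λ_q) Γ'^q_{pk}`, and the contraction with `J`
multiplies by `λ_p`. Only coefficients joining the two eigenspaces survive. -/
lemma IsFrameConn.lee (h : IsFrameConn E D Γ Γ') (hE : IsDualFrame E θ)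
    (hJ : ∀ k a, con E k (J a) = lam k * E k a)
    (hl : ∀ k a, D a (lam k) = 0) (k : κ) :
    con E k (aLee D Γ J) = -half R * ∑ p, lam p * (lam k - lam p) * Γ' p p k := by
  have e1 : ∀ b c, J b c = ∑ p, θ c p * (lam p * E p b) := by
    intro b c
    simp only [← hJ, hE.sum_con]
  have e2 : ∀ p c, con E p (fun b => con E k (covEnd D Γ J b c))
      = ∑ q, ((lam k - lam q) * Γ' q p k) * E q c := by
    intro p c
    have x1 : con E p (fun b => con E k (covEnd D Γ J b c))
        = con E k (fun b => frameD E D p (J c b))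
          + ∑ m, con E p (fun b => Γ c b m) * con E k (J m)
          - ∑ m, J c m * ∑ a, con E p (fun b => Γ m b a) * E k a := by
      rw [con_comm]
      have : ∀ m, J c m * ∑ a, con E p (fun b => Γ m b a) * E k a
          = con E k (fun a => con E p (fun b => Γ m b a)) * J c m := by
        intro m
        rw [con, mul_comm]
        congr 1
        exact Finset.sum_congr rfl fun _ _ => mul_comm _ _
      simp only [this]
      simp only [covEnd, con_add, con_sum, con_sub, con_mul, con_mul_right, frameD_apply,
        Finset.sum_sub_distrib]
      ring
    have x2 : ∀ m, ∑ a, con E p (fun b => Γ m b a) * E k a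
        = ∑ q, Γ' q p k * E q m - frameD E D p (E k m) := fun m => by rw [← h p k m]; ring
    have x3 : ∑ m, con E p (fun b => Γ c b m) * con E k (J m)
        = lam k * (∑ q, Γ' q p k * E q c - frameD E D p (E k c)) := by
      rw [← x2, Finset.mul_sum]
      exact Finset.sum_congr rfl fun _ _ => by rw [hJ]; ring
    rw [x1, x3, frameD_eigen hJ hl]
    simp only [x2, mul_sub, Finset.sum_sub_distrib]
    have x4 : ∑ m, J c m * ∑ q, Γ' q p k * E q m = ∑ q, (lam q * Γ' q p k) * E q c := by
      simp only [mul_right_comm (lam _), ← hJ, con, Finset.mul_sum, Finset.sum_mul]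
      rw [Finset.sum_comm]
      exact Finset.sum_congr rfl fun _ _ => Finset.sum_congr rfl fun _ _ => by ring
    rw [x4]
    simp only [sub_mul, Finset.sum_sub_distrib, Finset.mul_sum, mul_assoc]
    ring
  have e3 : con E k (aLee D Γ J)
      = -half R * ∑ b, ∑ c, J b c * con E k (covEnd D Γ J b c) := by
    simp only [← con_mul, ← con_sum]
    rfl
  rw [e3]
  congr 1
  have e4 : ∑ b, ∑ c, J b c * con E k (covEnd D Γ J b c)
      = ∑ p, lam p * ∑ c, con E p (fun b => con E k (covEnd D Γ J b c)) * θ c p := by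
    have : ∀ b c, J b c * con E k (covEnd D Γ J b c)
        = ∑ p, θ c p * (lam p * E p b) * con E k (covEnd D Γ J b c) := by
      intro b c
      rw [← Finset.sum_mul, ← e1]
    simp only [this]
    rw [Finset.sum_comm]
    have y : ∀ c, ∑ b, ∑ p, θ c p * (lam p * E p b) * con E k (covEnd D Γ J b c)
        = ∑ p, lam p * (con E p (fun b => con E k (covEnd D Γ J b c)) * θ c p) := by
      intro c
      rw [Finset.sum_comm]
      refine Finset.sum_congr rfl fun p _ => ?_
      simp only [con, Finset.sum_mul, Finset.mul_sum]
      refine Finset.sum_congr rfl fun b _ => Finset.sum_congr rfl fun a _ => by ring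
    simp only [y]
    rw [Finset.sum_comm]
    simp only [Finset.mul_sum]
  rw [e4]
  refine Finset.sum_congr rfl fun p _ => ?_
  simp only [e2, hE.coeff]
  ring

end DualFrame

end SDEinstein

end

noncomputable section

namespace SDEinstein

set_option linter.unusedSectionVars false
set_option linter.unusedSimpArgs false

/-! ### Spin frames adapted to a complex structure -/

section HatFrame

variable {R : Type*} [CommRing R] [Algebra ℂ R]

/-- The eigenvalues of the complex structure on the vectors of an adapted frame. -/
def lamR (R : Type*) [CommRing R] [Algebra ℂ R] (k : Bisp) : R :=
  algebraMap ℂ R (if k.1 = 0 then -Complex.I else Complex.I)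

/-- `E` is a spin frame of eigenvectors of `J`, with dual coframe `θ`. -/
structure IsHatFrame (g gi J : Fin 4 → Fin 4 → R) (E : Bisp → Fin 4 → R) (θ : Fin 4 → Bisp → R) :
    Prop where
  metric : IsMetricPair g gi
  dual : IsDualFrame E θ
  eta : ∀ k l, con2 E g k l = etaR R k l
  eigen : ∀ k a, con E k (J a) = lamR R k * E k a

variable {g gi J : Fin 4 → Fin 4 → R} {E : Bisp → Fin 4 → R} {θ : Fin 4 → Bisp → R}

lemma etaR_symm (k l : Bisp) : etaR R k l = etaR R l k := by
  obtain ⟨k, k'⟩ := k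
  obtain ⟨l, l'⟩ := l
  fin_cases k <;> fin_cases k' <;> fin_cases l <;> fin_cases l' <;> simp [etaR, epsR]

lemma sum_etaR_etaR (k m : Bisp) :
    ∑ l, etaR R k l * etaR R l m = if k = m then 1 else 0 := by
  obtain ⟨k, k'⟩ := k
  obtain ⟨m, m'⟩ := m
  fin_cases k <;> fin_cases k' <;> fin_cases m <;> fin_cases m' <;>
    simp [etaR, epsR, Fintype.sum_prod_type]

lemma derivation_epsR (d : Derivation ℂ R R) (A B : Fin 2) : d (epsR R A B) = 0 := by
  unfold epsR; split_ifs <;> simp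

lemma derivation_etaR (d : Derivation ℂ R R) (k l : Bisp) : d (etaR R k l) = 0 := by
  simp [etaR, derivation_epsR]

lemma IsHatFrame.con_metric (h : IsHatFrame g gi J E θ) (k : Bisp) (a : Fin 4) :
    con E k (g a) = ∑ m, θ a m * etaR R m k := by
  rw [← h.dual.sum_con (fun a => con E k (g a)) a]
  refine Finset.sum_congr rfl fun m _ => ?_
  rw [← h.eta]; rfl

/-- The matrix `etaR` is its own inverse, so the expression is a right inverse of `g`; inverses are
unique. -/
lemma IsHatFrame.inv_eq (h : IsHatFrame g gi J E θ) (a b : Fin 4) :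
    gi a b = ∑ k, ∑ l, etaR R k l * E k a * E l b := by
  have h1 : ∀ c b, ∑ a, g c a * (∑ k, ∑ l, etaR R k l * E k a * E l b) = if c = b then 1 else 0 := by
    intro c b
    have e1 : ∑ a, g c a * (∑ k, ∑ l, etaR R k l * E k a * E l b)
        = ∑ k, ∑ l, con E k (g c) * etaR R k l * E l b := by
      simp only [con, Finset.mul_sum, Finset.sum_mul]
      rw [Finset.sum_comm]
      refine Finset.sum_congr rfl fun k _ => ?_
      rw [Finset.sum_comm]
      exact Finset.sum_congr rfl fun l _ => Finset.sum_congr rfl fun a _ => by ring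
    have e2 : ∀ l, ∑ k, con E k (g c) * etaR R k l = θ c l := by
      intro l
      simp only [h.con_metric, Finset.sum_mul, mul_assoc]
      rw [Finset.sum_comm]
      simp only [← Finset.mul_sum, sum_etaR_etaR, mul_ite, mul_one, mul_zero, Finset.sum_ite_eq',
        Finset.mem_univ, if_true]
    rw [e1, Finset.sum_comm]
    simp only [← Finset.sum_mul, e2, h.dual.left]
  have h2 := h.metric.raise_lower (fun a => ∑ k, ∑ l, etaR R k l * E k a * E l b) a
  rw [← h2]
  simp only [h1, mul_ite, mul_one, mul_zero, Finset.sum_ite_eq', Finset.mem_univ, if_true]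

lemma IsHatFrame.trace_eq (h : IsHatFrame g gi J E θ) (T : Fin 4 → Fin 4 → R) :
    aTr gi T = ∑ k, ∑ l, etaR R k l * con2 E T k l := by
  simp only [aTr, h.inv_eq, con2, con, Finset.mul_sum, Finset.sum_mul]
  have sw : ∀ X : Fin 4 → Fin 4 → Bisp → Bisp → R,
      ∑ a, ∑ b, ∑ k, ∑ l, X a b k l = ∑ k, ∑ l, ∑ a, ∑ b, X a b k l := by
    intro X
    calc ∑ a, ∑ b, ∑ k, ∑ l, X a b k l = ∑ a, ∑ k, ∑ l, ∑ b, X a b k l := by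
          refine Finset.sum_congr rfl fun a _ => ?_
          rw [Finset.sum_comm]
          exact Finset.sum_congr rfl fun k _ => Finset.sum_comm
      _ = ∑ k, ∑ l, ∑ a, ∑ b, X a b k l := by
          rw [Finset.sum_comm]
          exact Finset.sum_congr rfl fun k _ => Finset.sum_comm
  rw [sw]
  exact Finset.sum_congr rfl fun k _ => Finset.sum_congr rfl fun l _ =>
    Finset.sum_congr rfl fun a _ => Finset.sum_congr rfl fun b _ => by ring

variable {D : Fin 4 → Derivation ℂ R R}

/-- The unprimed spin connection of connection coefficients. -/
def unprimedConn (Γ : Bisp → Bisp → Bisp → R) (k : Bisp) (A B : Fin 2) : R :=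
  half R * ∑ A', Γ (B, A') k (A, A')

/-- The primed spin connection of connection coefficients. -/
def primedConn (Γ : Bisp → Bisp → Bisp → R) (k : Bisp) (A' B' : Fin 2) : R :=
  half R * ∑ A, Γ (A, B') k (A, A')

/-- The splitting `so(4, ℂ) = sl(2, ℂ) ⊕ sl(2, ℂ)`: coefficients skew with respect to `etaR` are
recovered from their two partial traces. -/
lemma spinΓ_unprimed_primed {Γ : Bisp → Bisp → Bisp → R}
    (hΓ : ∀ k l m, ∑ p, (Γ p k l * etaR R p m + Γ p k m * etaR R l p) = 0) :
    Γ = spinΓ (unprimedConn Γ) (primedConn Γ) := by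
  funext m k l
  have h2 := two_mul_half (R := R)
  have H := hΓ k
  simp only [Fintype.sum_prod_type, Fin.sum_univ_two, etaR] at H
  have a00 := H (0, 0) (1, 1)
  have a01 := H (0, 1) (1, 0)
  have b0 := H (0, 0) (0, 0)
  have b1 := H (0, 0) (0, 1)
  have b2 := H (0, 0) (1, 0)
  have b3 := H (0, 1) (0, 1)
  have b4 := H (0, 1) (1, 1)
  have b5 := H (1, 0) (1, 0)
  have b6 := H (1, 0) (1, 1)
  have b7 := H (1, 1) (1, 1)
  simp [epsR] at a00 a01 b0 b1 b2 b3 b4 b5 b6 b7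
  replace b0 := two_cancel (R := R) (y := 0) (by linear_combination b0)
  replace b3 := two_cancel (R := R) (y := 0) (by linear_combination -b3)
  replace b5 := two_cancel (R := R) (y := 0) (by linear_combination -b5)
  replace b7 := two_cancel (R := R) (y := 0) (by linear_combination b7)
  obtain ⟨m, m'⟩ := m
  obtain ⟨l, l'⟩ := l
  fin_cases m <;> fin_cases m' <;> fin_cases l <;> fin_cases l' <;>
    simp [spinΓ, unprimedConn, primedConn, Fin.sum_univ_two]
  all_goals clear H
  all_goals grind

lemma unprimedConn_trace {Γ : Bisp → Bisp → Bisp → R}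
    (hΓ : ∀ k l m, ∑ p, (Γ p k l * etaR R p m + Γ p k m * etaR R l p) = 0) (k : Bisp) :
    unprimedConn Γ k 1 1 = -unprimedConn Γ k 0 0 := by
  have h1 := hΓ k (0, 0) (1, 1)
  have h2 := hΓ k (0, 1) (1, 0)
  simp [etaR, epsR, Fintype.sum_prod_type] at h1 h2
  simp [unprimedConn, Fin.sum_univ_two]
  linear_combination half R * (h1 - h2)

lemma primedConn_trace {Γ : Bisp → Bisp → Bisp → R}
    (hΓ : ∀ k l m, ∑ p, (Γ p k l * etaR R p m + Γ p k m * etaR R l p) = 0) (k : Bisp) :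
    primedConn Γ k 1 1 = -primedConn Γ k 0 0 := by
  have h1 := hΓ k (0, 0) (1, 1)
  have h2 := hΓ k (0, 1) (1, 0)
  simp [etaR, epsR, Fintype.sum_prod_type] at h1 h2
  simp [primedConn, Fin.sum_univ_two]
  linear_combination half R * (h1 - h2)

/-- This is `∇g = 0` in a frame whose metric components are constant. -/
lemma IsHatFrame.conn_antisymm {Γ' : Bisp → Bisp → Bisp → R} (h : IsHatFrame g gi J E θ)
    (hc : IsFrameConn E D (aChr D g gi) Γ') (k l m : Bisp) :
    ∑ p, (Γ' p k l * etaR R p m + Γ' p k m * etaR R l p) = 0 := by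
  have h1 : cov2 D (aChr D g gi) g = fun _ _ _ => 0 := by
    funext a b c
    rw [cov2, metric_compat D h.metric b c a, ← Finset.sum_sub_distrib]
    exact Finset.sum_eq_zero fun m _ => by ring
  have h2 := hc.cov2 g k l m
  have h3 : con2 E g = etaR R := by funext k l; exact h.eta k l
  rw [h1, h3] at h2
  simp only [cov2, derivation_etaR, zero_sub] at h2
  simp only [con3, con2, con, mul_zero, Finset.sum_const_zero] at h2
  linear_combination h2

end HatFrame

end SDEinstein

end

noncomputable section

namespace SDEinstein

set_option linter.unusedSectionVars false
set_option linter.unusedSimpArgs false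

/-! ### The adapted frame of an integrable complex structure -/

section Adapted

variable {R : Type*} [CommRing R] [Algebra ℂ R]
variable {g gi J : Fin 4 → Fin 4 → R} {E : Bisp → Fin 4 → R} {θ : Fin 4 → Bisp → R}
variable (D : Fin 4 → Derivation ℂ R R)

/-- The unprimed spin connection of a metric in a spin frame. -/
def hatU (g gi : Fin 4 → Fin 4 → R) (E : Bisp → Fin 4 → R) (θ : Fin 4 → Bisp → R) :
    Bisp → Fin 2 → Fin 2 → R := unprimedConn (frameConn D (aChr D g gi) E θ)

/-- The primed spin connection of a metric in a spin frame. -/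
def hatUp (g gi : Fin 4 → Fin 4 → R) (E : Bisp → Fin 4 → R) (θ : Fin 4 → Bisp → R) :
    Bisp → Fin 2 → Fin 2 → R := primedConn (frameConn D (aChr D g gi) E θ)

variable {D}

lemma IsHatFrame.frameConn_eq (h : IsHatFrame g gi J E θ) :
    frameConn D (aChr D g gi) E θ = spinΓ (hatU D g gi E θ) (hatUp D g gi E θ) :=
  spinΓ_unprimed_primed (h.conn_antisymm h.dual.isFrameConn)

lemma IsHatFrame.isFrameConn (h : IsHatFrame g gi J E θ) :
    IsFrameConn E D (aChr D g gi) (spinΓ (hatU D g gi E θ) (hatUp D g gi E θ)) := by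
  rw [← h.frameConn_eq]; exact h.dual.isFrameConn

lemma IsHatFrame.trace (h : IsHatFrame g gi J E θ) (k : Bisp) :
    hatU D g gi E θ k 1 1 = -hatU D g gi E θ k 0 0 :=
  unprimedConn_trace (h.conn_antisymm h.dual.isFrameConn) k

lemma IsHatFrame.trace' (h : IsHatFrame g gi J E θ) (k : Bisp) :
    hatUp D g gi E θ k 1 1 = -hatUp D g gi E θ k 0 0 :=
  primedConn_trace (h.conn_antisymm h.dual.isFrameConn) k

lemma derivation_lamR (d : Derivation ℂ R R) (k : Bisp) : d (lamR R k) = 0 :=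
  d.map_algebraMap _

lemma lamR_sq (k : Bisp) : lamR R k * lamR R k = -1 := by
  unfold lamR
  rw [← map_mul]
  split_ifs <;> simp

lemma lamR_one (A' B' : Fin 2) : lamR R (1, A') = -lamR R (0, B') := by
  simp [lamR]

/-- Each eigenspace of `J` is involutive. For the bracket of the two vectors of one eigenspace, the
components in the other eigenspace are single coefficients of the unprimed connection, because the
primed part contributes nothing. -/
lemma IsHatFrame.integrable (h : IsHatFrame g gi J E θ)
    (hN : ∀ c a b, aNijenhuis D J c a b = 0) :
    (∀ k', hatU D g gi E θ (0, k') 0 1 = 0) ∧ ∀ k', hatU D g gi E θ (1, k') 1 0 = 0 := by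
  have key : ∀ k l p, lamR R l = lamR R k → lamR R p = -lamR R k →
      spinΓ (hatU D g gi E θ) (hatUp D g gi E θ) p k l
        = spinΓ (hatU D g gi E θ) (hatUp D g gi E θ) p l k := by
    intro k l p hl hp
    have h1 := h.dual.coeff_unique (c := fun p => (lamR R p - lamR R k) ^ 2 *
      (spinΓ (hatU D g gi E θ) (hatUp D g gi E θ) p k l
        - spinΓ (hatU D g gi E θ) (hatUp D g gi E θ) p l k)) (c' := fun _ => 0)
      (fun c => by
        rw [← h.isFrameConn.nijenhuis (aChr_symm D h.metric) h.eigen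
          (fun k a => derivation_lamR _ _) k l hl c]
        simp [con2, con, hN]) p
    simp only [hp] at h1
    -- For opposite eigenvalues `(λ_p - λ_k)² = 4 λ_k² = -4`.
    refine four_cancel ?_
    linear_combination -h1 + 4 * (spinΓ (hatU D g gi E θ) (hatUp D g gi E θ) p k l
        - spinΓ (hatU D g gi E θ) (hatUp D g gi E θ) p l k) * lamR_sq (R := R) k
  have a1 := key (0, 0) (0, 1) (1, 0) rfl (lamR_one _ _)
  have a2 := key (0, 0) (0, 1) (1, 1) rfl (lamR_one _ _)
  have a3 := key (1, 0) (1, 1) (0, 0) rfl (by rw [lamR_one 0 0, neg_neg])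
  have a4 := key (1, 0) (1, 1) (0, 1) rfl (by rw [lamR_one 0 0, neg_neg]; rfl)
  simp [spinΓ] at a1 a2 a3 a4
  constructor <;> intro k' <;> fin_cases k'
  exacts [a2, a1.symm, a4, a3.symm]

/-- `J` is integrable and the metric is self-dual Einstein with `R_{ab} = Λ g_{ab}`. -/
structure IsSDEinsteinFrame (D : Fin 4 → Derivation ℂ R R) (g gi J : Fin 4 → Fin 4 → R)
    (E : Bisp → Fin 4 → R) (θ : Fin 4 → Bisp → R) (Λ : ℂ) : Prop where
  hat : IsHatFrame g gi J E θ
  comm : ∀ a b f, D a (D b f) = D b (D a f)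
  nijenhuis : ∀ c a b, aNijenhuis D J c a b = 0
  ricci : ∀ a b, aRicci D g gi a b = algebraMap ℂ R Λ * g a b
  weyl : ∀ A B C F, dblContr (con4 E (aWeyl D g gi)) A B C F = 0

variable {Λ : ℂ}

lemma IsMetricPair.trace_self (h : IsMetricPair g gi) : ∑ a, ∑ b, gi a b * g a b = 4 := by
  have : ∀ a, ∑ b, gi a b * g a b = 1 := by
    intro a
    have h1 := h.inv_mul a a
    simp only [if_true] at h1
    rw [← h1]
    exact Finset.sum_congr rfl fun b _ => by rw [h.symm]
  simp [this]

lemma algebraMap_eq_six (Λ : ℂ) : algebraMap ℂ R Λ = 6 * algebraMap ℂ R (Λ / 6) := by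
  rw [show (6 : R) = algebraMap ℂ R 6 from (map_ofNat (algebraMap ℂ R) 6).symm, ← map_mul]
  congr 1; ring

lemma IsSDEinsteinFrame.scal (h : IsSDEinsteinFrame D g gi J E θ Λ) :
    aScal D g gi = 4 * algebraMap ℂ R Λ := by
  simp only [aScal, h.ricci, mul_left_comm _ (algebraMap ℂ R Λ), ← Finset.mul_sum,
    h.hat.metric.trace_self]
  ring

lemma con4_prod13 (S T : Fin 4 → Fin 4 → R) (k l i j : Bisp) :
    con4 E (fun a b c d => S a c * T b d) k l i j = con2 E S k i * con2 E T l j := by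
  simp only [con4, con3, con2, con_mul, con_mul_right]

lemma con4_prod14 (S T : Fin 4 → Fin 4 → R) (k l i j : Bisp) :
    con4 E (fun a b c d => S a d * T b c) k l i j = con2 E S k j * con2 E T l i := by
  simp only [con4, con3, con2, con_mul, con_mul_right]

lemma con4_add (X Y : Fin 4 → Fin 4 → Fin 4 → Fin 4 → R) (k l i j : Bisp) :
    con4 E (fun a b c d => X a b c d + Y a b c d) k l i j
      = con4 E X k l i j + con4 E Y k l i j := by
  simp only [con4, con3, con2, con_add]

lemma con4_sub (X Y : Fin 4 → Fin 4 → Fin 4 → Fin 4 → R) (k l i j : Bisp) :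
    con4 E (fun a b c d => X a b c d - Y a b c d) k l i j
      = con4 E X k l i j - con4 E Y k l i j := by
  simp only [con4, con3, con2, con_sub]

lemma con4_mul (x : R) (X : Fin 4 → Fin 4 → Fin 4 → Fin 4 → R) (k l i j : Bisp) :
    con4 E (fun a b c d => x * X a b c d) k l i j = x * con4 E X k l i j := by
  simp only [con4, con3, con2, con_mul]

lemma con4_swap12 (X : Fin 4 → Fin 4 → Fin 4 → Fin 4 → R) (k l i j : Bisp) :
    con4 E (fun a b c d => X b a c d) k l i j = con4 E X l k i j :=
  con_comm E k l fun a b => con2 E (X b a) i j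

lemma con4_swap23 (X : Fin 4 → Fin 4 → Fin 4 → Fin 4 → R) (k l i j : Bisp) :
    con4 E (fun a b c d => X a c b d) k l i j = con4 E X k i l j := by
  simp only [con4, con3, con2]
  congr 1; funext a
  exact con_comm E l i fun b c => con E j (X a c b)

lemma con4_swap34 (X : Fin 4 → Fin 4 → Fin 4 → Fin 4 → R) (k l i j : Bisp) :
    con4 E (fun a b c d => X a b d c) k l i j = con4 E X k l j i := by
  simp only [con4, con3, con2]
  congr 1; funext a; congr 1; funext b
  exact con_comm E i j fun c d => X a b d c

lemma IsSDEinsteinFrame.riemLow (h : IsSDEinsteinFrame D g gi J E θ Λ)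
    (T : Fin 4 → Fin 4 → R) (m l i j : Bisp) :
    con4 E (fun a b c d => ∑ e, T a e * aRiem D (aChr D g gi) e b c d) m l i j
      = ∑ q, con2 E T m q * spinRiem
        (curvForm (frameD E D) (spinΓ (hatU D g gi E θ) (hatUp D g gi E θ)) (hatU D g gi E θ))
        (curvForm (frameD E D) (spinΓ (hatU D g gi E θ) (hatUp D g gi E θ)) (hatUp D g gi E θ))
        q l i j := by
  rw [h.hat.isFrameConn.riemLow (aChr_symm D h.hat.metric) h.comm]
  simp only [frameRiem_spinΓ]

lemma IsSDEinsteinFrame.curv (h : IsSDEinsteinFrame D g gi J E θ Λ) :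
    IsSDEinsteinCurv (algebraMap ℂ R (Λ / 6))
      (curvForm (frameD E D) (spinΓ (hatU D g gi E θ) (hatUp D g gi E θ)) (hatU D g gi E θ))
      (curvForm (frameD E D) (spinΓ (hatU D g gi E θ) (hatUp D g gi E θ)) (hatUp D g gi E θ)) where
  antisymm := curvForm_antisymm _ _ _
  antisymm' := curvForm_antisymm _ _ _
  trace := curvForm_trace _ _ h.hat.trace
  trace' := curvForm_trace _ _ h.hat.trace'
  bianchi q l i j := by
    simp only [← frameRiem_spinΓ]
    exact h.hat.isFrameConn.bianchi h.hat.dual (aChr_symm D h.hat.metric) h.comm q l i j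
  ricci b d := by
    simp only [← frameRiem_spinΓ]
    rw [h.hat.isFrameConn.ricci h.hat.dual (aChr_symm D h.hat.metric) h.comm]
    have : (fun b d => ∑ a, aRiem D (aChr D g gi) a b a d)
        = fun b d => algebraMap ℂ R Λ * g b d := by
      funext b d; exact h.ricci b d
    rw [this, ← h.hat.eta, ← algebraMap_eq_six]
    simp only [con2, con_mul]
  weyl A B C F := by
    have h0 := h.weyl A B C F
    have e : ∀ k l i j, con4 E (aWeyl D g gi) k l i j
        = (∑ q, etaR R k q * spinRiem
        (curvForm (frameD E D) (spinΓ (hatU D g gi E θ) (hatUp D g gi E θ)) (hatU D g gi E θ))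
        (curvForm (frameD E D) (spinΓ (hatU D g gi E θ) (hatUp D g gi E θ)) (hatUp D g gi E θ))
        q l i j) - 2 * algebraMap ℂ R (Λ / 6)
          * (etaR R k i * etaR R l j - etaR R k j * etaR R l i) := by
      intro k l i j
      simp only [← h.hat.eta]
      rw [← h.riemLow, ← con4_prod13, ← con4_prod14, ← con4_sub, ← con4_mul,
        ← con4_sub]
      congr 1
      funext a b c d
      have h6 : 6 * algebraMap ℂ R (1 / 6) = 1 := by
        rw [← algebraMap_eq_six, map_one]
      -- With `R_{ab} = Λ g_{ab}` the trace terms of the Weyl tensor add up to `-Λ + 4Λ/6 = -Λ/3`,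
      -- which is `-2 L`.
      rw [aWeyl, aRiemLow, h.scal, h.ricci, h.ricci, h.ricci, h.ricci, algebraMap_eq_six Λ]
      linear_combination (-6 * algebraMap ℂ R (Λ / 6) * (g a c * g b d - g a d * g b c))
        * two_mul_half (R := R)
        + (4 * algebraMap ℂ R (Λ / 6) * (g a c * g b d - g a d * g b c)) * h6
    simp only [dblContr, e] at h0
    rw [← h0]
    simp only [Finset.mul_sum]
    refine Finset.sum_congr rfl fun A' _ => Finset.sum_congr rfl fun B' _ =>
      Finset.sum_congr rfl fun C' _ => Finset.sum_congr rfl fun F' _ => ?_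
    rw [mul_assoc]

lemma IsSDEinsteinFrame.adapted (h : IsSDEinsteinFrame D g gi J E θ Λ) :
    IsAdapted (frameD E D) (hatU D g gi E θ) (hatUp D g gi E θ) (algebraMap ℂ R (Λ / 6)) where
  trace := h.hat.trace
  trace' := h.hat.trace'
  integrable0 := (h.hat.integrable h.nijenhuis).1
  integrable1 := (h.hat.integrable h.nijenhuis).2
  commutator := h.hat.isFrameConn.commutator (aChr_symm D h.hat.metric) h.comm
  curvature := h.curv.unprimed

/-- By integrability one off-diagonal coefficient of the unprimed connection survives in each
direction, and the eigenvalue factor is evaluated with `λ² = -1`. -/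
lemma IsSDEinsteinFrame.lee (h : IsSDEinsteinFrame D g gi J E θ Λ) (k : Bisp) :
    con E k (aLee D (aChr D g gi) J) = leeR (hatU D g gi E θ) k := by
  rw [h.hat.isFrameConn.lee h.hat.dual h.hat.eigen fun k a => derivation_lamR _ _]
  have h0 := h.adapted.integrable0
  have h1 := h.adapted.integrable1
  have h2 := two_mul_half (R := R)
  have hl := lamR_sq (R := R) (0, 0)
  have l01 : lamR R (0, 1) = lamR R (0, 0) := rfl
  have l10 : lamR R (1, 0) = -lamR R (0, 0) := lamR_one _ _
  have l11 : lamR R (1, 1) = -lamR R (0, 0) := lamR_one _ _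
  obtain ⟨k, k'⟩ := k
  fin_cases k <;> fin_cases k' <;>
    simp [Fintype.sum_prod_type, l01, l10, l11, spinΓ, leeR]
  · linear_combination (lamR R (0, 0) * lamR R (0, 0) * hatU D g gi E θ (1, 0) 0 1) * h2
      + hatU D g gi E θ (1, 0) 0 1 * hl
  · linear_combination (lamR R (0, 0) * lamR R (0, 0) * hatU D g gi E θ (1, 1) 0 1) * h2
      + hatU D g gi E θ (1, 1) 0 1 * hl
  · linear_combination -(lamR R (0, 0) * lamR R (0, 0) * hatU D g gi E θ (0, 0) 1 0) * h2
      - hatU D g gi E θ (0, 0) 1 0 * hl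
  · linear_combination -(lamR R (0, 0) * lamR R (0, 0) * hatU D g gi E θ (0, 1) 1 0) * h2
      - hatU D g gi E θ (0, 1) 1 0 * hl

end Adapted

end SDEinstein

end

noncomputable section

namespace SDEinstein

set_option linter.unusedSectionVars false
set_option linter.unusedSimpArgs false
set_option linter.unnecessarySeqFocus false

/-! ### Contractions with the symmetrised products of principal spinors -/

section SymContr

variable {R : Type*} [CommRing R] [Algebra ℂ R]

lemma fullSym12_add (K K' : Fin 2 → Fin 2 → Fin 2 → Fin 2 → R) (i : Fin 5) :
    fullSym12 (fun A B C F => K A B C F + K' A B C F) i = fullSym12 K i + fullSym12 K' i := by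
  match i with
  | 0 | 1 | 2 | 3 | 4 => simp only [fullSym12, Matrix.cons_val] <;> ring

lemma fullSym12_mul (x : R) (K : Fin 2 → Fin 2 → Fin 2 → Fin 2 → R) (i : Fin 5) :
    fullSym12 (fun A B C F => x * K A B C F) i = x * fullSym12 K i := by
  match i with
  | 0 | 1 | 2 | 3 | 4 => simp only [fullSym12, Matrix.cons_val] <;> ring

lemma fullSym12_swap12 (K : Fin 2 → Fin 2 → Fin 2 → Fin 2 → R) (i : Fin 5) :
    fullSym12 (fun A B C F => K B A C F) i = fullSym12 K i := by
  match i with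
  | 0 | 1 | 2 | 3 | 4 => simp only [fullSym12, Matrix.cons_val] <;> ring

lemma fullSym12_swap34 (K : Fin 2 → Fin 2 → Fin 2 → Fin 2 → R) (i : Fin 5) :
    fullSym12 (fun A B C F => K A B F C) i = fullSym12 K i := by
  match i with
  | 0 | 1 | 2 | 3 | 4 => simp only [fullSym12, Matrix.cons_val] <;> ring

lemma fullSym12_swap13 (K : Fin 2 → Fin 2 → Fin 2 → Fin 2 → R) (i : Fin 5) :
    fullSym12 (fun A B C F => K C B A F) i = fullSym12 K i := by
  match i with
  | 0 | 1 | 2 | 3 | 4 => simp only [fullSym12, Matrix.cons_val] <;> ring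

/-- Twelve times the contraction of a tensor with `S_i^{ABCD} ε^{A'B'} ε^{C'D'}`. -/
def symContr (H : Bisp → Bisp → Bisp → Bisp → R) (i : Fin 5) : R := fullSym12 (dblContr H) i

lemma symContr_add (H K : Bisp → Bisp → Bisp → Bisp → R) (i : Fin 5) :
    symContr (fun a b c d => H a b c d + K a b c d) i = symContr H i + symContr K i := by
  rw [symContr, symContr, symContr, ← fullSym12_add]
  congr 1
  funext A B C F
  simp only [dblContr, mul_add, Finset.sum_add_distrib]

lemma symContr_mul (x : R) (H : Bisp → Bisp → Bisp → Bisp → R) (i : Fin 5) :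
    symContr (fun a b c d => x * H a b c d) i = x * symContr H i := by
  rw [symContr, symContr, ← fullSym12_mul]
  congr 1
  funext A B C F
  simp only [dblContr, mul_left_comm _ x, ← Finset.mul_sum]

lemma symContr_sub (H K : Bisp → Bisp → Bisp → Bisp → R) (i : Fin 5) :
    symContr (fun a b c d => H a b c d - K a b c d) i = symContr H i - symContr K i := by
  have h := symContr_mul (-1) K i
  simp only [neg_one_mul] at h
  simp only [sub_eq_add_neg, symContr_add, h]

lemma symContr_swap12 (H : Bisp → Bisp → Bisp → Bisp → R) (i : Fin 5) :
    symContr (fun a b c d => H b a c d) i = -symContr H i := by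
  rw [← neg_one_mul, ← symContr_mul, symContr, symContr, ← fullSym12_swap12]
  congr 1
  funext A B C F
  simp [dblContr, epsR, Fin.sum_univ_two]
  ring

lemma symContr_swap34 (H : Bisp → Bisp → Bisp → Bisp → R) (i : Fin 5) :
    symContr (fun a b c d => H a b d c) i = -symContr H i := by
  rw [← neg_one_mul, ← symContr_mul, symContr, symContr, ← fullSym12_swap34]
  congr 1
  funext A B C F
  simp [dblContr, epsR, Fin.sum_univ_two]
  ring

lemma symContr_eq_zero_of_symm12 {H : Bisp → Bisp → Bisp → Bisp → R}
    (h : ∀ a b c d, H a b c d = H b a c d) (i : Fin 5) : symContr H i = 0 := by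
  have h1 := symContr_swap12 H i
  have h2 : (fun a b c d => H b a c d) = H := by funext a b c d; exact (h a b c d).symm
  rw [h2] at h1
  exact two_cancel (by linear_combination h1)

lemma symContr_eq_zero_of_symm34 {H : Bisp → Bisp → Bisp → Bisp → R}
    (h : ∀ a b c d, H a b c d = H a b d c) (i : Fin 5) : symContr H i = 0 := by
  have h1 := symContr_swap34 H i
  have h2 : (fun a b c d => H a b d c) = H := by funext a b c d; exact (h a b c d).symm
  rw [h2] at h1
  exact two_cancel (by linear_combination h1)

lemma epsR_values : epsR R 0 0 = 0 ∧ epsR R 0 1 = 1 ∧ epsR R 1 0 = -1 ∧ epsR R 1 1 = 0 := by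
  simp [epsR]

/-- A metric factor contributes `ε_{AC}`, which the symmetrisation over unprimed indices
annihilates. -/
lemma symContr_etaR13 (T : Bisp → Bisp → R) (i : Fin 5) :
    symContr (fun a b c d => etaR R a c * T b d) i = 0 := by
  obtain ⟨e1, e2, e3, e4⟩ := epsR_values (R := R)
  have h : dblContr (fun a b c d => etaR R a c * T b d)
      = fun A B C F => epsR R A C * (T (B, 0) (F, 1) - T (B, 1) (F, 0)) := by
    funext A B C F
    simp only [dblContr, Fin.sum_univ_two, etaR, e1, e2, e3, e4]
    ring
  rw [symContr]
  have h1 := fullSym12_swap13 (dblContr fun a b c d => etaR R a c * T b d) i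
  have h2 : (fun A B C F => dblContr (fun a b c d => etaR R a c * T b d) C B A F)
      = fun A B C F => -1 * dblContr (fun a b c d => etaR R a c * T b d) A B C F := by
    rw [h]
    funext A B C F
    fin_cases A <;> fin_cases C <;> simp [e1, e2, e3, e4]
  rw [h2, fullSym12_mul] at h1
  exact two_cancel (by linear_combination -h1)

lemma symContr_etaR14 (T : Bisp → Bisp → R) (i : Fin 5) :
    symContr (fun a b c d => etaR R a d * T b c) i = 0 := by
  rw [symContr_swap34 fun a b c d => etaR R a c * T b d, symContr_etaR13, neg_zero]

lemma symContr_etaR23 (T : Bisp → Bisp → R) (i : Fin 5) :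
    symContr (fun a b c d => etaR R b c * T a d) i = 0 := by
  rw [symContr_swap12 fun a b c d => etaR R a c * T b d, symContr_etaR13, neg_zero]

lemma symContr_etaR24 (T : Bisp → Bisp → R) (i : Fin 5) :
    symContr (fun a b c d => etaR R b d * T a c) i = 0 := by
  rw [symContr_swap12 fun a b c d => etaR R a d * T b c, symContr_etaR14, neg_zero]

/-- Contraction with `ε^{A'B'}`, together with symmetry in the unprimed indices, is skew in the
first pair, and likewise in the second. Two of the six terms are symmetric in the first pair and
drop out; the other four coincide up to sign, and `½ · 4 = 2`. -/
lemma symContr_linRiem {H : Bisp → Bisp → Bisp → Bisp → R}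
    (hs : ∀ i j k l, H i j k l = H i j l k) (i : Fin 5) :
    symContr (fun a b c d => half R * (H c d a b + H c b a d - H c a d b - H d c a b - H d b a c
      + H d a c b)) i = 2 * symContr (fun a b c d => H c b a d) i := by
  rw [symContr_mul]
  simp only [symContr_add, symContr_sub]
  have e1 : symContr (fun a b c d => H c d a b) i = 0 :=
    symContr_eq_zero_of_symm12 (H := fun a b c d => H c d a b) (fun a b c d => hs c d a b) i
  have e2 : symContr (fun a b c d => H d c a b) i = 0 :=
    symContr_eq_zero_of_symm12 (H := fun a b c d => H d c a b) (fun a b c d => hs d c a b) i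
  have e3 : symContr (fun a b c d => H c a d b) i = -symContr (fun a b c d => H c b a d) i := by
    rw [← symContr_swap12 fun a b c d => H c b a d]
    congr 1
    funext a b c d
    exact hs c a d b
  have e4 : symContr (fun a b c d => H d b a c) i = -symContr (fun a b c d => H c b a d) i :=
    symContr_swap34 (fun a b c d => H c b a d) i
  have e5 : symContr (fun a b c d => H d a c b) i = symContr (fun a b c d => H c b a d) i := by
    rw [symContr_swap34 (fun a b c d => H c a d b) i, e3, neg_neg]
  rw [e1, e2, e3, e4, e5]
  linear_combination (2 * symContr (fun a b c d => H c b a d) i) * two_mul_half (R := R)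

variable {L : R} {U P : Bisp → Bisp → Fin 2 → Fin 2 → R}

/-- The undifferentiated curvature does not contribute. The primed curvature has no unprimed
two-form part, and the unprimed curvature is a multiple of `L` times products containing an `ε` of
two symmetrised indices. -/
lemma IsSDEinsteinCurv.symContr_spinRiem (hc : IsSDEinsteinCurv L U P) {h : Bisp → Bisp → R}
    (hs : ∀ k l, h k l = h l k) (i : Fin 5) :
    symContr (fun m l i j => ∑ q, h m q * spinRiem U P q l i j) i = 0 := by
  obtain ⟨e1, e2, e3, e4⟩ := epsR_values (R := R)
  obtain ⟨a1, a2, a3, a4, a5, a6, a7, a8, a9, a10, a11', a12, a13⟩ := hc.primed_aux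
  have hp : ∀ C F B Q, P (C, 0) (F, 1) B Q - P (C, 1) (F, 0) B Q = 0 := by
    have a00 : ∀ B Q, P (0, 0) (0, 1) B Q = 0 := by
      intro B Q; fin_cases B <;> fin_cases Q <;> simp [a1, a2, a3, hc.trace']
    have a11 : ∀ B Q, P (1, 0) (1, 1) B Q = 0 := by
      intro B Q; fin_cases B <;> fin_cases Q <;> simp [a4, a5, a6, hc.trace']
    have a01 : ∀ B Q, P (0, 0) (1, 1) B Q - P (0, 1) (1, 0) B Q = 0 := by
      intro B Q; fin_cases B <;> fin_cases Q <;> simp [a9, a10, a11', a12, a13, hc.trace']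
    intro C F B Q
    fin_cases C <;> fin_cases F
    · simp [hc.antisymm' (0, 0) (0, 1), a00]
    · exact a01 B Q
    · change P (1, 0) (0, 1) B Q - P (1, 1) (0, 0) B Q = 0
      rw [hc.antisymm' (0, 1) (1, 0), hc.antisymm' (0, 0) (1, 1)]
      linear_combination a01 B Q
    · simp [hc.antisymm' (1, 0) (1, 1), a11]
  have hu : ∀ C F B Q, U (C, 0) (F, 1) B Q - U (C, 1) (F, 0) B Q
      = -2 * L * ((if C = Q then 1 else 0) * epsR R F B + (if F = Q then 1 else 0) * epsR R C B) := by
    intro C F B Q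
    rw [hc.unprimed, hc.unprimed]
    simp only [e2, e3]
    ring
  have h1 : dblContr (fun m l i j => ∑ q, h m q * spinRiem U P q l i j)
      = fun A B C F => ∑ A', ∑ B', epsR R A' B' * ∑ q, h (A, A') q *
        (-2 * L * if q.2 = B' then ((if C = q.1 then 1 else 0) * epsR R F B
          + (if F = q.1 then 1 else 0) * epsR R C B) else 0) := by
    funext A B C F
    refine Finset.sum_congr rfl fun A' _ => Finset.sum_congr rfl fun B' _ => ?_
    congr 1
    simp only [Fin.sum_univ_two, e1, e2, e3, e4]
    have : ∀ q, h (A, A') q * (-2 * L * if q.2 = B' then ((if C = q.1 then 1 else 0) * epsR R F B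
          + (if F = q.1 then 1 else 0) * epsR R C B) else 0)
        = h (A, A') q * spinRiem U P q (B, B') (C, 0) (F, 1)
          - h (A, A') q * spinRiem U P q (B, B') (C, 1) (F, 0) := by
      intro q
      rw [← mul_sub, spinRiem, spinRiem, mul_ite, ← hu, mul_zero]
      have := hp C F B' q.2
      split_ifs <;> first | ring1 | linear_combination -h (A, A') q * this
    simp only [this, Finset.sum_sub_distrib]
    ring
  have key : ∀ A B C F, dblContr (fun m l i j => ∑ q, h m q * spinRiem U P q l i j) A B C F
      = -2 * L * (epsR R F B * (h (A, 0) (C, 1) - h (A, 1) (C, 0))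
        + epsR R C B * (h (A, 0) (F, 1) - h (A, 1) (F, 0))) := by
    intro A B C F
    rw [h1]
    simp only [Fin.sum_univ_two, Fintype.sum_prod_type, e1, e2, e3, e4]
    fin_cases C <;> fin_cases F <;> simp [e1, e2, e3, e4] <;> ring
  rw [symContr]
  generalize dblContr (fun m l i j => ∑ q, h m q * spinRiem U P q l i j) = K at key
  have s1 := hs (1, 1) (0, 0)
  have s2 := hs (1, 0) (0, 1)
  have s3 := hs (0, 0) (0, 1)
  have s4 := hs (1, 0) (1, 1)
  match i with
  | 0 | 1 | 2 | 3 | 4 =>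
    simp only [fullSym12, Matrix.cons_val, key, e1, e2, e3, e4, s1, s2, s3, s4, hs (1, 0) (0, 0), hs (1, 1) (0, 1)]
    ring

end SymContr

end SDEinstein

end

noncomputable section

namespace SDEinstein

set_option linter.unusedSectionVars false
set_option linter.unusedSimpArgs false

/-! ### The operator identity for a self-dual Einstein metric -/

section Identity

variable {R : Type*} [CommRing R] [Algebra ℂ R]
variable {g gi J : Fin 4 → Fin 4 → R} {E : Bisp → Fin 4 → R} {θ : Fin 4 → Bisp → R}
variable {D : Fin 4 → Derivation ℂ R R} {Λ : ℂ} {h : Fin 4 → Fin 4 → R}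

lemma con2_symm (hs : ∀ a b, h a b = h b a) (k l : Bisp) : con2 E h k l = con2 E h l k := by
  rw [con2, con_comm]
  simp only [con2, hs]

lemma IsHatFrame.con4_aHess2 (hh : IsHatFrame g gi J E θ) (k l i j : Bisp) :
    con4 E (aHess2 D g gi h) k l i j
      = cov3 (frameD E D) (spinΓ (hatU D g gi E θ) (hatUp D g gi E θ))
        (cov2 (frameD E D) (spinΓ (hatU D g gi E θ) (hatUp D g gi E θ)) (con2 E h)) k l i j := by
  rw [aHess2, hh.isFrameConn.cov3]
  congr 1
  funext k l i
  exact hh.isFrameConn.cov2 _ _ _ _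

lemma con4_perm3142 (X : Fin 4 → Fin 4 → Fin 4 → Fin 4 → R) (k l i j : Bisp) :
    con4 E (fun a b c d => X c b a d) k l i j = con4 E X i l k j := by
  rw [con4_swap12 fun a b c d => X c a b d, con4_swap23 fun a b c d => X b a c d, con4_swap12]

/-- Each Ricci or scalar curvature term of the linearised Weyl tensor has a metric factor on the
Einstein background, and `h · Riem` is removed by `symContr_spinRiem`. Only the second derivatives
of `h` remain. -/
lemma IsSDEinsteinFrame.symContr_aLinWeyl (hf : IsSDEinsteinFrame D g gi J E θ Λ)
    (hs : ∀ a b, h a b = h b a) (i : Fin 5) :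
    symContr (con4 E (aLinWeyl D g gi h)) i
      = 2 * symContr (fun a b c d => con4 E (aHess2 D g gi h) c b a d) i := by
  obtain ⟨σ, hσ⟩ : ∃ σ, linScal D g gi h
    - ∑ a, ∑ b, (∑ c, ∑ d, gi a c * h c d * gi d b) * aRicci D g gi a b = σ := ⟨_, rfl⟩
  -- Collects the tensors that multiply a metric factor, so that all trace terms take the form `g ·
  -- T'`.
  obtain ⟨T, hT⟩ : ∃ T : Fin 4 → Fin 4 → R, T = fun a b =>
    -half R * (linRicci D g gi h a b + algebraMap ℂ R Λ * h a b)
      + algebraMap ℂ R (1 / 6) * (4 * algebraMap ℂ R Λ * h a b) := ⟨_, rfl⟩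
  obtain ⟨T', hT'⟩ : ∃ T' : Fin 4 → Fin 4 → R, T' = fun a b =>
    T a b + algebraMap ℂ R (1 / 6) * σ * g a b := ⟨_, rfl⟩
  have e : aLinWeyl D g gi h = fun a b c d =>
      (∑ e, h a e * aRiem D (aChr D g gi) e b c d) + linRiem (aHess2 D g gi h) a b c d
        + (g a c * T' b d - g a d * T' b c - (g b c * T a d - g b d * T a c)) := by
    funext a b c d
    rw [aLinWeyl, hσ, hf.scal, hT', hT]
    simp only [hf.ricci]
    ring
  have p23 : ∀ (S T : Fin 4 → Fin 4 → R) (k l i j : Bisp),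
      con4 E (fun a b c d => S b c * T a d) k l i j = con2 E S l i * con2 E T k j := by
    intro S T k l i j
    rw [con4_swap12 fun a b c d => S a c * T b d, con4_prod13]
  have p24 : ∀ (S T : Fin 4 → Fin 4 → R) (k l i j : Bisp),
      con4 E (fun a b c d => S b d * T a c) k l i j = con2 E S l j * con2 E T k i := by
    intro S T k l i j
    rw [con4_swap12 fun a b c d => S a d * T b c, con4_prod14]
  have e2 : con4 E (aLinWeyl D g gi h) = fun k l i j =>
      (∑ q, con2 E h k q * spinRiem
        (curvForm (frameD E D) (spinΓ (hatU D g gi E θ) (hatUp D g gi E θ)) (hatU D g gi E θ))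
        (curvForm (frameD E D) (spinΓ (hatU D g gi E θ) (hatUp D g gi E θ)) (hatUp D g gi E θ))
        q l i j) + con4 E (linRiem (aHess2 D g gi h)) k l i j
        + (etaR R k i * con2 E T' l j - etaR R k j * con2 E T' l i
          - (etaR R l i * con2 E T k j - etaR R l j * con2 E T k i)) := by
    funext k l i j
    rw [e]
    simp only [con4_add, con4_sub]
    rw [hf.riemLow, con4_prod13, con4_prod14, p23, p24]
    simp only [hf.hat.eta]
  have e3 : con4 E (linRiem (aHess2 D g gi h)) = fun a b c d => half R *
      (con4 E (aHess2 D g gi h) c d a b + con4 E (aHess2 D g gi h) c b a d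
        - con4 E (aHess2 D g gi h) c a d b - con4 E (aHess2 D g gi h) d c a b
        - con4 E (aHess2 D g gi h) d b a c + con4 E (aHess2 D g gi h) d a c b) := by
    funext a b c d
    obtain ⟨H, hH⟩ : ∃ H, aHess2 D g gi h = H := ⟨_, rfl⟩
    have e : linRiem (aHess2 D g gi h) = fun a b c d => half R * (H c d a b + H c b a d - H c a d b
      - H d c a b - H d b a c + H d a c b) := by rw [hH]; rfl
    rw [e, hH]
    simp only [con4_mul, con4_add, con4_sub]
    have q1 : con4 E (fun a b c d => H c d a b) a b c d = con4 E H c d a b := by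
      rw [con4_swap23 fun a b c d => H b d a c, con4_swap12 fun a b c d => H a d b c,
        con4_swap34 fun a b c d => H a c b d, con4_swap23 fun a b c d => H a b c d]
    have q2 : con4 E (fun a b c d => H c b a d) a b c d = con4 E H c b a d :=
      con4_perm3142 H a b c d
    have q3 : con4 E (fun a b c d => H c a d b) a b c d = con4 E H c a d b := by
      rw [con4_swap23 fun a b c d => H b a d c, con4_swap12 fun a b c d => H a b d c,
        con4_swap34 fun a b c d => H a b c d]
    have q4 : con4 E (fun a b c d => H d c a b) a b c d = con4 E H d c a b := by
      rw [con4_swap34 fun a b c d => H c d a b, con4_swap23 fun a b c d => H b d a c,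
        con4_swap12 fun a b c d => H a d b c,
        con4_swap34 fun a b c d => H a c b d, con4_swap23 fun a b c d => H a b c d]
    have q5 : con4 E (fun a b c d => H d b a c) a b c d = con4 E H d b a c := by
      rw [con4_swap34 fun a b c d => H c b a d, con4_perm3142]
    have q6 : con4 E (fun a b c d => H d a c b) a b c d = con4 E H d a c b := by
      rw [con4_swap34 fun a b c d => H c a d b,
        con4_swap23 fun a b c d => H b a d c, con4_swap12 fun a b c d => H a b d c,
        con4_swap34 fun a b c d => H a b c d]
    rw [q1, q2, q3, q4, q5, q6]
  rw [e2]
  simp only [symContr_add, symContr_sub, symContr_etaR13, symContr_etaR14, symContr_etaR23,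
    symContr_etaR24, hf.curv.symContr_spinRiem (con2_symm hs)]
  rw [e3, symContr_linRiem]
  · ring
  · intro k l i j
    rw [← con4_swap34]
    congr 1
    funext a b c d
    exact aHess2_symm hs a b d c

/-- The spin connection of a tetrad. -/
def aSpinConn (D : Fin 4 → Derivation ℂ R R) (g gi : Fin 4 → Fin 4 → R)
    (e : Fin 2 → Fin 2 → Fin 4 → R) (a : Fin 4) (A B : Fin 2) : R :=
  ∑ C, epsR R B C * (half R * ∑ A', ∑ C', epsR R A' C' * ∑ b, ∑ c, g b c *
    (D a (e A A' b) + ∑ m, aChr D g gi b a m * e A A' m) * e C C' c)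

/-- The connection form of a pair of spinors. -/
def aGhp (D : Fin 4 → Derivation ℂ R R) (g gi : Fin 4 → Fin 4 → R)
    (e : Fin 2 → Fin 2 → Fin 4 → R) (o ι : Fin 2 → R) (a : Fin 4) : R :=
  ∑ B, (∑ A, ι A * epsR R A B) * (D a (o B) + ∑ A, o A * aSpinConn D g gi e a A B)

/-- The spin frame with `o` and `ι` as unprimed spinors. -/
def hatFrame (e : Fin 2 → Fin 2 → Fin 4 → R) (o ι : Fin 2 → R) (k : Bisp) (a : Fin 4) : R :=
  ∑ A, (if k.1 = 0 then o A else ι A) * e A k.2 a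

/-- The form `ι_B ∇ o^B` is written through the metric and the vectors of the adapted frame, so the
original tetrad is no longer mentioned. -/
lemma aGhp_eq {e : Fin 2 → Fin 2 → Fin 4 → R} {o ι : Fin 2 → R}
    (he : ∀ A A' B B', ∑ a, ∑ b, g a b * e A A' a * e B B' b = epsR R A B * epsR R A' B')
    (a : Fin 4) :
    aGhp D g gi e o ι a = -half R * ∑ A', ∑ C', epsR R A' C' * ∑ b, ∑ c, g b c *
      (D a (hatFrame e o ι (0, A') b) + ∑ m, aChr D g gi b a m * hatFrame e o ι (0, A') m)
        * hatFrame e o ι (1, C') c := by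
  obtain ⟨N, hN⟩ : ∃ N : Fin 2 → Fin 2 → Fin 4 → R, ∀ A A' b,
    D a (e A A' b) + ∑ m, aChr D g gi b a m * e A A' m = N A A' b := ⟨_, fun _ _ _ => rfl⟩
  obtain ⟨Q, hQ⟩ : ∃ Q : Fin 2 → Fin 2 → Fin 2 → Fin 2 → R, ∀ A A' C C',
    ∑ b, ∑ c, g b c * N A A' b * e C C' c = Q A A' C C' := ⟨_, fun _ _ _ _ => rfl⟩
  have h1 : ∀ A' b, D a (hatFrame e o ι (0, A') b)
      + ∑ m, aChr D g gi b a m * hatFrame e o ι (0, A') m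
      = ∑ A, (D a (o A) * e A A' b + o A * N A A' b) := by
    intro A' b
    simp only [hatFrame, ← hN, if_true, map_sum, Derivation.leibniz, smul_eq_mul, mul_add,
      Finset.mul_sum, Finset.sum_add_distrib]
    rw [Finset.sum_comm (f := fun m A => aChr D g gi b a m * (o A * e A A' m))]
    have : ∀ A m, aChr D g gi b a m * (o A * e A A' m) = o A * (aChr D g gi b a m * e A A' m) :=
      fun A m => by ring
    simp only [this]
    have : ∀ A, e A A' b * D a (o A) = D a (o A) * e A A' b := fun A => mul_comm _ _
    simp only [this]
    ring
  have h2 : ∀ A' C', ∑ b, ∑ c, g b c * (D a (hatFrame e o ι (0, A') b)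
      + ∑ m, aChr D g gi b a m * hatFrame e o ι (0, A') m) * hatFrame e o ι (1, C') c
      = ∑ A, ∑ C, (D a (o A) * ι C * (epsR R A C * epsR R A' C') + o A * ι C * Q A A' C C') := by
    intro A' C'
    have h3 : ∀ c, hatFrame e o ι (1, C') c = ∑ C, ι C * e C C' c := fun c => by
      simp only [hatFrame, one_ne_zero, if_false]
    simp only [h1, h3]
    simp only [← he, ← hQ, Fin.sum_univ_two, Finset.mul_sum, ← Finset.sum_add_distrib]
    exact Finset.sum_congr rfl fun b _ => Finset.sum_congr rfl fun c _ => by ring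
  obtain ⟨e1, e2, e3, e4⟩ := epsR_values (R := R)
  simp only [h2, aGhp, aSpinConn, hN, hQ, Fin.sum_univ_two, e1, e2, e3, e4]
  linear_combination (D a (o 0) * ι 1 - D a (o 1) * ι 0) * two_mul_half (R := R)

lemma IsHatFrame.con_aGhp {e : Fin 2 → Fin 2 → Fin 4 → R} {o ι : Fin 2 → R}
    (hf : IsHatFrame g gi J (hatFrame e o ι) θ)
    (he : ∀ A A' B B', ∑ a, ∑ b, g a b * e A A' a * e B B' b = epsR R A B * epsR R A' B')
    (k : Bisp) :
    con (hatFrame e o ι) k (aGhp D g gi e o ι) = -hatU D g gi (hatFrame e o ι) θ k 0 0 := by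
  have h0 : aGhp D g gi e o ι = _ := funext fun a => aGhp_eq he a
  rw [h0]
  generalize hatFrame e o ι = E at hf ⊢
  have h1 : ∀ A' C', con E k (fun a => ∑ b, ∑ c, g b c * (D a (E (0, A') b)
      + ∑ m, aChr D g gi b a m * E (0, A') m) * E (1, C') c)
      = ∑ p, spinΓ (hatU D g gi E θ) (hatUp D g gi E θ) p k (0, A') * etaR R p (1, C') := by
    intro A' C'
    have h2 : ∀ b, con E k (fun a => D a (E (0, A') b) + ∑ m, aChr D g gi b a m * E (0, A') m)
        = ∑ p, spinΓ (hatU D g gi E θ) (hatUp D g gi E θ) p k (0, A') * E p b := by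
      intro b
      rw [← hf.isFrameConn, con_add, con_sum, frameD_apply]
      simp only [con_mul_right]
    simp only [con_sum, con_mul, con_mul_right, h2]
    simp only [← hf.eta, con2, con, Finset.mul_sum, Finset.sum_mul]
    calc _ = ∑ b, ∑ p, ∑ c, g b c * (spinΓ (hatU D g gi E θ) (hatUp D g gi E θ) p k (0, A')
          * E p b) * E (1, C') c := Finset.sum_congr rfl fun b _ => Finset.sum_comm
      _ = _ := by
        rw [Finset.sum_comm]
        exact Finset.sum_congr rfl fun p _ => Finset.sum_congr rfl fun b _ =>
          Finset.sum_congr rfl fun c _ => by ring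
  simp only [con_mul, con_sum, h1]
  obtain ⟨e1, e2, e3, e4⟩ := epsR_values (R := R)
  simp only [Fin.sum_univ_two, Fintype.sum_prod_type, etaR, e1, e2, e3, e4, spinΓ]
  simp [hf.trace']
  linear_combination hatU D g gi E θ k 0 0 * two_mul_half (R := R)

/-- The covector `P_a`. -/
def aFormP (D : Fin 4 → Derivation ℂ R R) (g gi J : Fin 4 → Fin 4 → R)
    (e : Fin 2 → Fin 2 → Fin 4 → R) (o ι : Fin 2 → R) (a : Fin 4) : R :=
  aGhp D g gi e o ι a
    - half R * algebraMap ℂ R Complex.I * ∑ b, J b a * aLee D (aChr D g gi) J b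

/-- The covector `w f_a + p P_a`. -/
def aWeight (D : Fin 4 → Derivation ℂ R R) (g gi J : Fin 4 → Fin 4 → R)
    (e : Fin 2 → Fin 2 → Fin 4 → R) (o ι : Fin 2 → R) (w p : ℂ) (a : Fin 4) : R :=
  algebraMap ℂ R w * aLee D (aChr D g gi) J a + algebraMap ℂ R p * aFormP D g gi J e o ι a

/-- The derivative of a scalar twisted by the covector `q`. -/
def aScalarDer (D : Fin 4 → Derivation ℂ R R) (q : Fin 4 → R) (ψ : R) (a : Fin 4) : R :=
  D a ψ + q a * ψ

/-- The derivative of a covector twisted by the covectors `q` and `f`. -/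
def aCovectorDer (D : Fin 4 → Derivation ℂ R R) (g gi : Fin 4 → Fin 4 → R) (f q v : Fin 4 → R)
    (a b : Fin 4) : R :=
  cov1 D (aChr D g gi) v a b + q a * v b
    - (f a * v b + f b * v a - g a b * ∑ c, ∑ d, gi c d * f d * v c)

/-- The twisted wave operator. -/
def aBox (D : Fin 4 → Derivation ℂ R R) (g gi : Fin 4 → Fin 4 → R) (f q : Fin 4 → R) (ψ : R) : R :=
  aTr gi (aCovectorDer D g gi f q (aScalarDer D q ψ))

/-- On an eigenvector of `J` with eigenvalue `∓i` the term `-½ i J f` equals `∓½ f`. The Lee form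
therefore enters `P` with opposite signs on the two eigenspaces, which gives the coefficients `3 +
r` and `3 - r`. -/
lemma IsSDEinsteinFrame.con_aWeight {e : Fin 2 → Fin 2 → Fin 4 → R} {o ι : Fin 2 → R}
    (hf : IsSDEinsteinFrame D g gi J (hatFrame e o ι) θ Λ)
    (he : ∀ A A' B B', ∑ a, ∑ b, g a b * e A A' a * e B B' b = epsR R A B * epsR R A' B')
    (r : ℂ) (k : Bisp) :
    con (hatFrame e o ι) k (aWeight D g gi J e o ι (-3) (2 * r))
      = wCoef (hatU D g gi (hatFrame e o ι) θ) (algebraMap ℂ R r) k := by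
  have h1 : con (hatFrame e o ι) k (fun a => ∑ b, J b a * aLee D (aChr D g gi) J b)
      = lamR R k * leeR (hatU D g gi (hatFrame e o ι) θ) k := by
    rw [con_sum]
    simp only [con_mul_right]
    rw [← hf.lee, con, Finset.mul_sum]
    exact Finset.sum_congr rfl fun b _ => by
      rw [show con (hatFrame e o ι) k (fun a => J b a) = _ from hf.hat.eigen k b]; ring
  have h2 : con (hatFrame e o ι) k (aWeight D g gi J e o ι (-3) (2 * r))
      = algebraMap ℂ R (-3) * con (hatFrame e o ι) k (aLee D (aChr D g gi) J)
        + algebraMap ℂ R (2 * r) * (con (hatFrame e o ι) k (aGhp D g gi e o ι)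
          - half R * algebraMap ℂ R Complex.I
            * con (hatFrame e o ι) k (fun a => ∑ b, J b a * aLee D (aChr D g gi) J b)) := by
    rw [← con_mul, ← con_mul, ← con_sub, ← con_mul, ← con_add]
    rfl
  rw [h2, h1, hf.hat.con_aGhp he, hf.lee]
  have m2 : algebraMap ℂ R (2 * r) = 2 * algebraMap ℂ R r := by
    rw [map_mul, map_ofNat]
  have m3 : algebraMap ℂ R (-3) = -3 := by rw [map_neg, map_ofNat]
  have hI : algebraMap ℂ R Complex.I * algebraMap ℂ R Complex.I = -1 := by
    rw [← map_mul, Complex.I_mul_I, map_neg, map_one]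
  rw [m2, m3, wCoef]
  generalize leeR (hatU D g gi (hatFrame e o ι) θ) k = f
  have h2 := two_mul_half (R := R)
  split_ifs with hk
  · have : lamR R k = -algebraMap ℂ R Complex.I := by simp [lamR, hk]
    rw [this]
    linear_combination (algebraMap ℂ R r * algebraMap ℂ R Complex.I * algebraMap ℂ R Complex.I * f)
      * h2 + algebraMap ℂ R r * f * hI
  · have : lamR R k = algebraMap ℂ R Complex.I := by simp [lamR, hk]
    rw [this]
    linear_combination -(algebraMap ℂ R r * algebraMap ℂ R Complex.I * algebraMap ℂ R Complex.I * f)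
      * h2 - algebraMap ℂ R r * f * hI

lemma IsHatFrame.aBox_eq_wBox (hf : IsHatFrame g gi J E θ) {f q : Fin 4 → R} {r : R}
    (hq : ∀ k, con E k q = wCoef (hatU D g gi E θ) r k)
    (hl : ∀ k, con E k f = leeR (hatU D g gi E θ) k) (ψ : R) :
    aBox D g gi f q ψ = wBox (frameD E D) (hatU D g gi E θ) (hatUp D g gi E θ) r ψ := by
  have h1 : (fun k => con E k (aScalarDer D q ψ)) = wDer (frameD E D) (hatU D g gi E θ) r ψ := by
    funext k
    rw [wDer, ← hq, frameD_apply, ← con_mul_right, ← con_add]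
    rfl
  rw [aBox]
  generalize aScalarDer D q ψ = v at h1 ⊢
  have h1' : ∀ k, con E k v = wDer (frameD E D) (hatU D g gi E θ) r ψ k := fun k => congrFun h1 k
  have h2 : ∑ c, ∑ d, gi c d * f d * v c = ∑ m, ∑ n, etaR R m n * leeR (hatU D g gi E θ) n
      * wDer (frameD E D) (hatU D g gi E θ) r ψ m := by
    have := hf.trace_eq fun c d => f d * v c
    simp only [aTr, con2, con_mul_right, hl] at this
    simp only [mul_assoc, this, con_mul, h1']
  rw [hf.trace_eq, wBox]
  refine Finset.sum_congr rfl fun k _ => Finset.sum_congr rfl fun l _ => ?_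
  congr 1
  have h3 : con2 E (cov1 D (aChr D g gi) v) k l
      = cov1 (frameD E D) (spinΓ (hatU D g gi E θ) (hatUp D g gi E θ))
        (wDer (frameD E D) (hatU D g gi E θ) r ψ) k l := by
    rw [hf.isFrameConn.cov1, h1]
  rw [← h3, ← hq, ← hl, ← hl, ← h1', ← h1', ← hf.eta, ← h2]
  simp only [con2, con_mul, con_mul_right, con_add, con_sub, aCovectorDer]

lemma aLinEinstein_symm (hg : IsMetricPair g gi) (hD : ∀ a b f, D a (D b f) = D b (D a f))
    (hs : ∀ a b, h a b = h b a) (a b : Fin 4) :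
    aLinEinstein D g gi h Λ a b = aLinEinstein D g gi h Λ b a := by
  have h1 : cov1 D (aChr D g gi) (fun b => D b (aTr gi h)) a b
      = cov1 D (aChr D g gi) (fun b => D b (aTr gi h)) b a := by
    simp only [cov1, hD a b, aChr_symm D hg _ a b]
  simp only [aLinEinstein, linRicci, h1, hs a b, hg.symm a b, aHess2_symm hs _ _ a b]
  simp only [add_comm (aHess2 D g gi h _ a b _)]

lemma con4_trace (hf : IsHatFrame g gi J E θ) (X : Fin 4 → Fin 4 → Fin 4 → Fin 4 → R)
    (k l : Bisp) : con2 E (fun a b => ∑ c, ∑ d, gi c d * X c d a b) k l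
      = ∑ m, ∑ n, etaR R m n * con4 E X m n k l := by
  have h1 : ∀ a b, ∑ c, ∑ d, gi c d * X c d a b
      = ∑ m, ∑ n, etaR R m n * con2 E (fun c d => X c d a b) m n := fun a b =>
    hf.trace_eq fun c d => X c d a b
  simp only [h1]
  simp only [con2, con_sum, con_mul, con4, con3]
  refine Finset.sum_congr rfl fun m _ => Finset.sum_congr rfl fun n _ => ?_
  congr 1
  calc _ = con E k fun a => con E m fun c => con E l fun b => con E n fun d => X c d a b := by
        congr 1; funext a; exact con_comm E l m _
    _ = con E m fun c => con E k fun a => con E l fun b => con E n fun d => X c d a b :=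
        con_comm E k m _
    _ = con E m fun c => con E k fun a => con E n fun d => con E l fun b => X c d a b := by
        congr 1; funext c; congr 1; funext a; exact con_comm E l n _
    _ = _ := by
        congr 1; funext c; exact con_comm E k n _

/-- All terms proportional to the metric are collected in `c`, since only the trace-free part of the
operator is needed. -/
lemma IsSDEinsteinFrame.con2_aLinEinstein (hf : IsSDEinsteinFrame D g gi J E θ Λ)
    {H : Bisp → Bisp → Bisp → Bisp → R} (hH : H = con4 E (aHess2 D g gi h)) :
    ∃ c, ∀ k l, 2 * con2 E (aLinEinstein D g gi h Λ) k l
      = (∑ m, ∑ n, etaR R m n * (H n k l m + H n l k m - H m n k l - H k l m n))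
        - 12 * algebraMap ℂ R (Λ / 6) * con2 E h k l + c * etaR R k l := by
  refine ⟨algebraMap ℂ R Λ * aTr gi h - linScal D g gi h, fun k l => ?_⟩
  subst hH
  have e : ∀ a b, 2 * aLinEinstein D g gi h Λ a b
      = (∑ c, ∑ d, gi c d * aHess2 D g gi h d a b c) + (∑ c, ∑ d, gi c d * aHess2 D g gi h d b a c)
        - (∑ c, ∑ d, gi c d * aHess2 D g gi h c d a b)
        - (∑ c, ∑ d, gi c d * aHess2 D g gi h a b c d)
        - 2 * algebraMap ℂ R Λ * h a b
        + (algebraMap ℂ R Λ * aTr gi h - linScal D g gi h) * g a b := by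
    intro a b
    have e1 : ∑ c, ∑ d, gi c d * (half R * (aHess2 D g gi h d a b c + aHess2 D g gi h d b a c))
        = half R * ((∑ c, ∑ d, gi c d * aHess2 D g gi h d a b c)
          + ∑ c, ∑ d, gi c d * aHess2 D g gi h d b a c) := by
      simp only [mul_add, Finset.mul_sum, ← Finset.sum_add_distrib]
      exact Finset.sum_congr rfl fun c _ => Finset.sum_congr rfl fun d _ => by ring
    rw [aLinEinstein, linRicci, e1, hessian_trace hf.hat.metric]
    linear_combination ((∑ c, ∑ d, gi c d * aHess2 D g gi h d a b c)
        + (∑ c, ∑ d, gi c d * aHess2 D g gi h d b a c)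
        - (∑ c, ∑ d, gi c d * aHess2 D g gi h c d a b)
        - (∑ c, ∑ d, gi c d * aHess2 D g gi h a b c d)
        + (algebraMap ℂ R Λ * aTr gi h - linScal D g gi h) * g a b) * two_mul_half (R := R)
  have e2 : 2 * con2 E (aLinEinstein D g gi h Λ) k l
      = con2 E (fun a b => 2 * aLinEinstein D g gi h Λ a b) k l := by
    simp only [con2, con_mul]
  have e3 : con2 E (fun a b => ∑ c, ∑ d, gi c d * aHess2 D g gi h d a b c) k l
      = ∑ m, ∑ n, etaR R m n * con4 E (aHess2 D g gi h) n k l m := by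
    rw [con4_trace hf.hat fun c d a b => aHess2 D g gi h d a b c]
    refine Finset.sum_congr rfl fun m _ => Finset.sum_congr rfl fun n _ => ?_
    obtain ⟨X, hX⟩ : ∃ X, aHess2 D g gi h = X := ⟨_, rfl⟩
    rw [hX, con4_swap12 fun a b c d => X a c d b, con4_swap23 fun a b c d => X a b d c,
      con4_swap34]
  have e4 : con2 E (fun a b => ∑ c, ∑ d, gi c d * aHess2 D g gi h d b a c) k l
      = ∑ m, ∑ n, etaR R m n * con4 E (aHess2 D g gi h) n l k m := by
    rw [con4_trace hf.hat fun c d a b => aHess2 D g gi h d b a c]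
    refine Finset.sum_congr rfl fun m _ => Finset.sum_congr rfl fun n _ => ?_
    obtain ⟨X, hX⟩ : ∃ X, aHess2 D g gi h = X := ⟨_, rfl⟩
    rw [hX, con4_swap34 fun a b c d => X b c d a, con4_swap12 fun a b c d => X a c d b,
      con4_swap23 fun a b c d => X a b d c, con4_swap34]
  have e5 : con2 E (fun a b => ∑ c, ∑ d, gi c d * aHess2 D g gi h a b c d) k l
      = ∑ m, ∑ n, etaR R m n * con4 E (aHess2 D g gi h) k l m n := by
    rw [con4_trace hf.hat fun c d a b => aHess2 D g gi h a b c d]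
    refine Finset.sum_congr rfl fun m _ => Finset.sum_congr rfl fun n _ => ?_
    obtain ⟨X, hX⟩ : ∃ X, aHess2 D g gi h = X := ⟨_, rfl⟩
    rw [hX, con4_swap23 fun a b c d => X b d a c, con4_swap12 fun a b c d => X a d b c,
      con4_swap34 fun a b c d => X a c b d, con4_swap23 fun a b c d => X a b c d]
  have e6 := con4_trace hf.hat (aHess2 D g gi h) k l
  simp only [e2, e]
  have e7 : ∀ X1 X2 X3 X4 X5 X6 : Fin 4 → Fin 4 → R,
      con2 E (fun a b => X1 a b + X2 a b - X3 a b - X4 a b - X5 a b + X6 a b) k l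
        = con2 E X1 k l + con2 E X2 k l - con2 E X3 k l - con2 E X4 k l - con2 E X5 k l
          + con2 E X6 k l := by
    intro X1 X2 X3 X4 X5 X6
    simp only [con2, con_add, con_sub]
  have e8 : ∀ x : R, ∀ T : Fin 4 → Fin 4 → R, con2 E (fun a b => x * T a b) k l
      = x * con2 E T k l := by
    intro x T; simp only [con2, con_mul]
  rw [e7, e3, e4, e5, e6, e8, e8, hf.hat.eta, algebraMap_eq_six Λ]
  simp only [mul_sub, mul_add, Finset.sum_add_distrib, Finset.sum_sub_distrib]
  ring

lemma wBox_const_mul {D : Bisp → Derivation ℂ R R} {u up : Bisp → Fin 2 → Fin 2 → R} {x : R}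
    (hx : ∀ k, D k x = 0) (r ψ : R) : wBox D u up r (x * ψ) = x * wBox D u up r ψ := by
  have h1 : wDer D u r (x * ψ) = fun k => x * wDer D u r ψ k := by
    funext k
    simp only [wDer, Derivation.leibniz, smul_eq_mul, hx]
    ring
  simp only [wBox, h1, cov1, Derivation.leibniz, smul_eq_mul, hx, Finset.mul_sum]
  refine Finset.sum_congr rfl fun k _ => Finset.sum_congr rfl fun l _ => ?_
  simp only [mul_left_comm _ x, ← Finset.mul_sum]
  ring

/-- The operator identity relating the linearised Weyl tensor and the linearised Einstein
operator. -/
theorem IsSDEinsteinFrame.teukolsky {e : Fin 2 → Fin 2 → Fin 4 → R} {o ι : Fin 2 → R}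
    (hf : IsSDEinsteinFrame D g gi J (hatFrame e o ι) θ Λ)
    (he : ∀ A A' B B', ∑ a, ∑ b, g a b * e A A' a * e B B' b = epsR R A B * epsR R A' B')
    (hs : ∀ a b, h a b = h b a) (i : Fin 5) :
    aBox D g gi (aLee D (aChr D g gi) J) (aWeight D g gi J e o ι (-3) (4 - 2 * ((i : ℕ) : ℂ)))
        (symContr (con4 (hatFrame e o ι) (aLinWeyl D g gi h)) i)
      = -4 * symContr (con4 (hatFrame e o ι) fun a b c d =>
          aHess2 D g gi (aLinEinstein D g gi h Λ) a d b c
          - 4 * aLee D (aChr D g gi) J a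
            * cov2 D (aChr D g gi) (aLinEinstein D g gi h Λ) d b c) i := by
  -- The weight `p = 4 - 2i` is `2r` with `r = 2 - i`.
  have hq := hf.con_aWeight he (2 - ((i : ℕ) : ℂ))
  rw [show 2 * (2 - ((i : ℕ) : ℂ)) = 4 - 2 * ((i : ℕ) : ℂ) by ring] at hq
  have hr : algebraMap ℂ R (2 - ((i : ℕ) : ℂ)) = 2 - ((i : ℕ) : R) := by
    rw [map_sub, map_ofNat, map_natCast]
  rw [hr] at hq
  rw [hf.hat.aBox_eq_wBox hq hf.lee, hf.symContr_aLinWeyl hs]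
  have hlee := hf.lee
  generalize hatFrame e o ι = E at hf hlee
  -- The factor 2 comes from `symContr_aLinWeyl`; it turns the constant `-2` of `wBox_fullSym12`
  -- into `-4`.
  rw [wBox_const_mul (x := 2) fun k => derivation_ofNat _ 2]
  obtain ⟨c, hc⟩ := hf.con2_aLinEinstein (h := h) rfl
  have h0 : con4 E (aHess2 D g gi h) = cov3 (frameD E D)
      (spinΓ (hatU D g gi E θ) (hatUp D g gi E θ)) (cov2 (frameD E D)
        (spinΓ (hatU D g gi E θ) (hatUp D g gi E θ)) (con2 E h)) := by
    funext k l i j; exact hf.hat.con4_aHess2 k l i j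
  have key := wBox_fullSym12 hf.adapted (fun k => (frameD E D k).map_algebraMap _) hf.curv
    (con2_symm hs) (con2_symm (aLinEinstein_symm (Λ := Λ) hf.hat.metric hf.comm hs)) h0 hc rfl i
  have h3 : (con4 E fun a b c d => aHess2 D g gi (aLinEinstein D g gi h Λ) a d b c
          - 4 * aLee D (aChr D g gi) J a
            * cov2 D (aChr D g gi) (aLinEinstein D g gi h Λ) d b c)
      = fun a b c d => cov3 (frameD E D) (spinΓ (hatU D g gi E θ) (hatUp D g gi E θ))
          (cov2 (frameD E D) (spinΓ (hatU D g gi E θ) (hatUp D g gi E θ))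
            (con2 E (aLinEinstein D g gi h Λ))) a d b c
        - 4 * leeR (hatU D g gi E θ) a * cov2 (frameD E D)
          (spinΓ (hatU D g gi E θ) (hatUp D g gi E θ)) (con2 E (aLinEinstein D g gi h Λ)) d b c := by
    funext k l i j
    have e1 : ∀ X : Fin 4 → Fin 4 → Fin 4 → Fin 4 → R,
        con4 E (fun a b c d => X a d b c) k l i j = con4 E X k j l i := by
      intro X
      rw [con4_swap23 fun a b c d => X a d c b, con4_swap34 fun a b c d => X a c d b,
        con4_swap23 fun a b c d => X a b d c, con4_swap34]
    have e2 : con4 E (fun a b c d => 4 * aLee D (aChr D g gi) J a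
        * cov2 D (aChr D g gi) (aLinEinstein D g gi h Λ) d b c) k l i j
        = 4 * con E k (aLee D (aChr D g gi) J)
          * con3 E (cov2 D (aChr D g gi) (aLinEinstein D g gi h Λ)) j l i := by
      rw [← con3_rotate (fun b c d => cov2 D (aChr D g gi) (aLinEinstein D g gi h Λ) d b c) j l i]
      simp only [con4, con3, con2, con_mul, con_mul_right]
    rw [con4_sub, e1, e2, hlee, hf.hat.isFrameConn.cov2, hf.hat.con4_aHess2]
  simp only [symContr, h3]
  linear_combination 2 * key

end Identity

end SDEinstein

end

noncomputable section

namespace SDEinstein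

set_option linter.unusedSectionVars false
set_option linter.unusedSimpArgs false
set_option linter.unnecessarySeqFocus false

/-! ### Spin frames built from a tetrad and a pair of spinors -/

section HatOfTetrad

variable {R : Type*} [CommRing R] [Algebra ℂ R]
variable {g : Fin 4 → Fin 4 → R} {E : Bisp → Fin 4 → R} {e : Fin 2 → Fin 2 → Fin 4 → R}
variable {o ι : Fin 2 → R}

/-- The coframe obtained by lowering the indices of a spin frame. -/
def hatCoframe (g : Fin 4 → Fin 4 → R) (E : Bisp → Fin 4 → R) (a : Fin 4) (k : Bisp) : R :=
  ∑ l, con E l (g a) * etaR R l k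

/-- The inverse metric determined by a spin frame. -/
def hatInv (E : Bisp → Fin 4 → R) (a b : Fin 4) : R := ∑ k, ∑ l, etaR R k l * E k a * E l b

/-- The complex structure determined by a spin frame. -/
def hatJ (E : Bisp → Fin 4 → R) (θ : Fin 4 → Bisp → R) (a b : Fin 4) : R :=
  ∑ k, lamR R k * E k a * θ b k

/-- Lowering indices gives a one-sided inverse of the frame matrix; as there are four bispinor
pairs, the matrices are square and the inverse is two-sided. -/
lemma isDualFrame_hatCoframe (h : ∀ k l, con2 E g k l = etaR R k l) :
    IsDualFrame E (hatCoframe g E) := by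
  have hr : ∀ k l, ∑ a, E k a * hatCoframe g E a l = if k = l then 1 else 0 := by
    intro k l
    rw [← sum_etaR_etaR]
    simp only [← h k, con2, hatCoframe, Finset.mul_sum, con, Finset.sum_mul]
    rw [Finset.sum_comm]
    refine Finset.sum_congr rfl fun m _ => Finset.sum_congr rfl fun a _ =>
      Finset.sum_congr rfl fun b _ => by ring
  refine ⟨hr, fun a b => ?_⟩
  have h1 : (Matrix.of fun k a => E k a) * (Matrix.of fun a k => hatCoframe g E a k) = 1 := by
    ext k l
    simp only [Matrix.mul_apply, Matrix.of_apply, hr, Matrix.one_apply]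
  have h2 := (Matrix.mul_eq_one_comm_of_card_eq Bisp (Fin 4) R (by simp)).1 h1
  have h3 := congrFun (congrFun h2 a) b
  simpa only [Matrix.mul_apply, Matrix.of_apply, Matrix.one_apply] using h3

lemma isHatFrame_of_eta (hs : ∀ a b, g a b = g b a) (h : ∀ k l, con2 E g k l = etaR R k l) :
    IsHatFrame g (hatInv E) (hatJ E (hatCoframe g E)) E (hatCoframe g E) := by
  have hd := isDualFrame_hatCoframe h
  refine ⟨⟨hs, fun a b => ?_, fun a b => ?_⟩, hd, h, fun k a => ?_⟩
  · simp only [hatInv]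
    rw [Finset.sum_comm]
    exact Finset.sum_congr rfl fun k _ => Finset.sum_congr rfl fun l _ => by
      rw [etaR_symm]; ring
  · rw [← hd.left]
    simp only [hatInv, hatCoframe, con, Finset.mul_sum, Finset.sum_mul]
    calc _ = ∑ k, ∑ c, ∑ l, g a c * (etaR R k l * E k c * E l b) := Finset.sum_comm
      _ = ∑ k, ∑ l, ∑ c, g a c * (etaR R k l * E k c * E l b) :=
        Finset.sum_congr rfl fun k _ => Finset.sum_comm
      _ = _ := by
        rw [Finset.sum_comm]
        exact Finset.sum_congr rfl fun l _ => Finset.sum_congr rfl fun k _ =>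
          Finset.sum_congr rfl fun c _ => by ring
  · simp only [con, hatJ, Finset.mul_sum]
    rw [Finset.sum_comm]
    have : ∀ l b, E k b * (lamR R l * E l a * hatCoframe g E b l)
        = lamR R l * E l a * (E k b * hatCoframe g E b l) := fun l b => by ring
    simp only [this, ← Finset.mul_sum, hd.right, mul_ite, mul_one, mul_zero, Finset.sum_ite_eq,
      Finset.mem_univ, if_true]

/-- The normalisation `o_A ι^A = 1` makes the passage to the basis `o`, `ι` unimodular, so it
preserves `ε_{AB}`. -/
lemma con2_hatFrame
    (he : ∀ A A' B B', ∑ a, ∑ b, g a b * e A A' a * e B B' b = epsR R A B * epsR R A' B')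
    (hn : ∑ A, (∑ C, o C * epsR R C A) * ι A = 1) (k l : Bisp) :
    con2 (hatFrame e o ι) g k l = etaR R k l := by
  have h1 : con2 (hatFrame e o ι) g k l = ∑ A, ∑ B, (if k.1 = 0 then o A else ι A)
      * (if l.1 = 0 then o B else ι B) * (epsR R A B * epsR R k.2 l.2) := by
    simp only [← he, con2, con, hatFrame, Fin.sum_univ_two, Finset.mul_sum,
      ← Finset.sum_add_distrib]
    exact Finset.sum_congr rfl fun b _ => Finset.sum_congr rfl fun c _ => by ring
  obtain ⟨e1, e2, e3, e4⟩ := epsR_values (R := R)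
  simp only [Fin.sum_univ_two, e1, e2, e3, e4] at hn
  rw [h1, etaR]
  obtain ⟨k, k'⟩ := k
  obtain ⟨l, l'⟩ := l
  fin_cases k <;> fin_cases l <;> simp [Fin.sum_univ_two, e1, e2, e3, e4]
  · ring
  · linear_combination epsR R k' l' * hn
  · linear_combination -epsR R k' l' * hn
  · ring

/-- The components of a spinor with respect to the frame `o`, `ι`. -/
def hatSpinor (o ι : Fin 2 → R) (A B : Fin 2) : R := if A = 0 then o B else ι B

lemma con_hatFrame (k : Bisp) (v : Fin 4 → R) :
    con (hatFrame e o ι) k v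
      = ∑ A, hatSpinor o ι k.1 A * con (fun (k : Bisp) a => e k.1 k.2 a) (A, k.2) v := by
  simp only [con, hatFrame, hatSpinor, Finset.sum_mul, Finset.mul_sum]
  rw [Finset.sum_comm]
  exact Finset.sum_congr rfl fun A _ => Finset.sum_congr rfl fun a _ => by ring

lemma dblContr_slot1 (s : Fin 2 → Fin 2 → R) (K : Bisp → Bisp → Bisp → Bisp → R)
    (A B C F : Fin 2) : dblContr (fun a b c d => ∑ X, s a.1 X * K (X, a.2) b c d) A B C F
      = ∑ X, s A X * dblContr K X B C F := by
  simp only [dblContr, Fin.sum_univ_two]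
  ring

lemma dblContr_slot2 (s : Fin 2 → Fin 2 → R) (K : Bisp → Bisp → Bisp → Bisp → R)
    (A B C F : Fin 2) : dblContr (fun a b c d => ∑ X, s b.1 X * K a (X, b.2) c d) A B C F
      = ∑ X, s B X * dblContr K A X C F := by
  simp only [dblContr, Fin.sum_univ_two]
  ring

lemma dblContr_slot3 (s : Fin 2 → Fin 2 → R) (K : Bisp → Bisp → Bisp → Bisp → R)
    (A B C F : Fin 2) : dblContr (fun a b c d => ∑ X, s c.1 X * K a b (X, c.2) d) A B C F
      = ∑ X, s C X * dblContr K A B X F := by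
  simp only [dblContr, Fin.sum_univ_two]
  ring

lemma dblContr_slot4 (s : Fin 2 → Fin 2 → R) (K : Bisp → Bisp → Bisp → Bisp → R)
    (A B C F : Fin 2) : dblContr (fun a b c d => ∑ X, s d.1 X * K a b c (X, d.2)) A B C F
      = ∑ X, s F X * dblContr K A B C X := by
  simp only [dblContr, Fin.sum_univ_two]
  ring

/-- The change of frame affects unprimed indices only, so it commutes with the contraction of the
primed ones. The intermediate tensors `K0` to `K3` convert one index at a time. -/
lemma dblContr_hatFrame (T : Fin 4 → Fin 4 → Fin 4 → Fin 4 → R) (A B C F : Fin 2) :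
    dblContr (con4 (hatFrame e o ι) T) A B C F
      = ∑ W, hatSpinor o ι F W * ∑ Z, hatSpinor o ι C Z * ∑ Y, hatSpinor o ι B Y
        * ∑ X, hatSpinor o ι A X * dblContr (con4 (fun (k : Bisp) a => e k.1 k.2 a) T) X Y Z W := by
  obtain ⟨K0, h0⟩ : ∃ K : Bisp → Bisp → Bisp → Bisp → R,
    K = con4 (fun (k : Bisp) a => e k.1 k.2 a) T := ⟨_, rfl⟩
  obtain ⟨K1, h1⟩ : ∃ K : Bisp → Bisp → Bisp → Bisp → R, K = fun a b c d =>
    ∑ X, hatSpinor o ι a.1 X * K0 (X, a.2) b c d := ⟨_, rfl⟩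
  obtain ⟨K2, h2⟩ : ∃ K : Bisp → Bisp → Bisp → Bisp → R, K = fun a b c d =>
    ∑ X, hatSpinor o ι b.1 X * K1 a (X, b.2) c d := ⟨_, rfl⟩
  obtain ⟨K3, h3⟩ : ∃ K : Bisp → Bisp → Bisp → Bisp → R, K = fun a b c d =>
    ∑ X, hatSpinor o ι c.1 X * K2 a b (X, c.2) d := ⟨_, rfl⟩
  have h4 : con4 (hatFrame e o ι) T = fun a b c d => ∑ X, hatSpinor o ι d.1 X
      * K3 a b c (X, d.2) := by
    funext a b c d
    simp only [h3, h2, h1, h0, con4, con3, con2, con_hatFrame, con_sum, con_mul]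
  rw [h4, dblContr_slot4, h3]
  simp only [dblContr_slot3]
  rw [h2]
  simp only [dblContr_slot2]
  rw [h1]
  simp only [dblContr_slot1, h0]

variable {S : Type*} [CommRing S] [Algebra ℂ S] (f : R →+* S)

lemma map_epsR (A B : Fin 2) : f (epsR R A B) = epsR S A B := by
  unfold epsR; split_ifs <;> simp

lemma map_dblContr (H : Bisp → Bisp → Bisp → Bisp → R) (A B C F : Fin 2) :
    f (dblContr H A B C F) = dblContr (fun a b c d => f (H a b c d)) A B C F := by
  simp only [dblContr, map_sum, map_mul, map_epsR]

lemma map_symContr (H : Bisp → Bisp → Bisp → Bisp → R) (i : Fin 5) :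
    f (symContr H i) = symContr (fun a b c d => f (H a b c d)) i := by
  match i with
  | 0 | 1 | 2 | 3 | 4 =>
    simp only [symContr, fullSym12, Matrix.cons_val, ← map_dblContr, map_mul, map_add, map_ofNat]

lemma map_con4_hatFrame (T : Fin 4 → Fin 4 → Fin 4 → Fin 4 → R) (k l p q : Bisp) :
    f (con4 (hatFrame e o ι) T k l p q)
      = con4 (hatFrame (fun A A' a => f (e A A' a)) (fun A => f (o A)) fun A => f (ι A))
        (fun a b c d => f (T a b c d)) k l p q := by
  simp only [con4, con3, con2, con, hatFrame, map_sum, map_mul, apply_ite f]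

lemma sum_perm_four (K : Fin 2 → Fin 2 → Fin 2 → Fin 2 → R) (i : Fin 5) :
    ∑ σ : Equiv.Perm (Fin 4), K (if ((σ 0 : Fin 4) : ℕ) < (i : ℕ) then 1 else 0)
      (if ((σ 1 : Fin 4) : ℕ) < (i : ℕ) then 1 else 0)
      (if ((σ 2 : Fin 4) : ℕ) < (i : ℕ) then 1 else 0)
      (if ((σ 3 : Fin 4) : ℕ) < (i : ℕ) then 1 else 0) = 2 * fullSym12 K i := by
  -- The 24 permutations are enumerated by successive images so that the sum can be expanded. Every
  -- placement of the `i` factors `ι` is hit `i! (4-i)!` times.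
  have h : ∀ G : Equiv.Perm (Fin 4) → R, ∑ σ, G σ = ∑ p : Fin 4, ∑ q : Fin 3, ∑ r : Fin 2,
      G (Equiv.Perm.decomposeFin.symm (p, Equiv.Perm.decomposeFin.symm (q,
        Equiv.Perm.decomposeFin.symm (r, 1)))) := by
    intro G
    rw [← Equiv.Perm.decomposeFin.symm.sum_comp, Fintype.sum_prod_type]
    refine Finset.sum_congr rfl fun p _ => ?_
    rw [← Equiv.Perm.decomposeFin.symm.sum_comp, Fintype.sum_prod_type]
    refine Finset.sum_congr rfl fun q _ => ?_
    rw [← Equiv.Perm.decomposeFin.symm.sum_comp, Fintype.sum_prod_type]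
    refine Finset.sum_congr rfl fun r _ => ?_
    simp
  rw [h]
  match i with
  | 0 | 1 | 2 | 3 | 4 =>
    simp +decide only [Fin.sum_univ_four, Fin.sum_univ_three, Fin.sum_univ_two, if_true, if_false,
      fullSym12, Matrix.cons_val]
    ring

end HatOfTetrad

end SDEinstein

end

noncomputable section

namespace SDEinstein

open TopologicalSpace (Opens)

set_option linter.unusedSectionVars false
set_option linter.unusedSimpArgs false

/-! ### Contraction with the tensors `W_i` -/

section Contraction

lemma sum_sum_mul_four {κ α : Type*} [Fintype κ] [Fintype α] (f : κ → α → α → α → α → ℂ)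
    (X : α → α → α → α → ℂ) :
    ∑ a, ∑ b, ∑ c, ∑ d, (∑ k, f k a b c d) * X a b c d
      = ∑ k, ∑ a, ∑ b, ∑ c, ∑ d, f k a b c d * X a b c d := by
  simp only [Finset.sum_mul]
  calc _ = ∑ a, ∑ b, ∑ c, ∑ k, ∑ d, f k a b c d * X a b c d :=
        Finset.sum_congr rfl fun a _ => Finset.sum_congr rfl fun b _ =>
          Finset.sum_congr rfl fun c _ => Finset.sum_comm
    _ = ∑ a, ∑ b, ∑ k, ∑ c, ∑ d, f k a b c d * X a b c d :=
        Finset.sum_congr rfl fun a _ => Finset.sum_congr rfl fun b _ => Finset.sum_comm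
    _ = ∑ a, ∑ k, ∑ b, ∑ c, ∑ d, f k a b c d * X a b c d :=
        Finset.sum_congr rfl fun a _ => Finset.sum_comm
    _ = _ := Finset.sum_comm

lemma con4_apply {R : Type*} [CommRing R] (E : Bisp → Fin 4 → R)
    (X : Fin 4 → Fin 4 → Fin 4 → Fin 4 → R) (k l p q : Bisp) :
    con4 E X k l p q = ∑ a, ∑ b, ∑ c, ∑ d, E k a * E l b * E p c * E q d * X a b c d := by
  simp only [con4, con3, con2, con, Finset.mul_sum, mul_assoc]

lemma sum_tensorW_mul_eq_dblContr (e : Tetrad) (o ι : Spinor) (i : Fin 5) (y : E4)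
    (X : Fin 4 → Fin 4 → Fin 4 → Fin 4 → ℂ) :
    ∑ a, ∑ b, ∑ c, ∑ d, tensorW e o ι i a b c d y * X a b c d
      = ∑ A, ∑ B, ∑ C, ∑ F, symS o ι i A B C F y
        * dblContr (con4 (fun (k : Bisp) a => e k.1 k.2 a y) X) A B C F := by
  delta tensorW
  rw [sum_sum_mul_four]
  refine Finset.sum_congr rfl fun A _ => ?_
  rw [sum_sum_mul_four]
  refine Finset.sum_congr rfl fun B _ => ?_
  rw [sum_sum_mul_four]
  refine Finset.sum_congr rfl fun C _ => ?_
  rw [sum_sum_mul_four]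
  refine Finset.sum_congr rfl fun F _ => ?_
  rw [sum_sum_mul_four]
  simp only [dblContr, Finset.mul_sum]
  refine Finset.sum_congr rfl fun A' _ => ?_
  rw [sum_sum_mul_four]
  refine Finset.sum_congr rfl fun B' _ => ?_
  rw [sum_sum_mul_four]
  refine Finset.sum_congr rfl fun C' _ => ?_
  rw [sum_sum_mul_four]
  refine Finset.sum_congr rfl fun F' _ => ?_
  rw [con4_apply]
  simp only [Finset.mul_sum]
  refine Finset.sum_congr rfl fun a _ => Finset.sum_congr rfl fun b _ =>
    Finset.sum_congr rfl fun c _ => Finset.sum_congr rfl fun d _ => ?_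
  change symS o ι i A B C F y * eps A' B' * eps C' F' * e A A' a y * e B B' b y * e C C' c y
    * e F F' d y * X a b c d = symS o ι i A B C F y * (eps A' B' * (eps C' F'
      * (e A A' a y * e B B' b y * e C C' c y * e F F' d y * X a b c d)))
  ring

/-- The constant is `1/12 = 2/24`: the permutation average has the factor `1/24`, and the sum over
permutations is twice `fullSym12`. -/
lemma sum_tensorW_mul (e : Tetrad) (o ι : Spinor) (i : Fin 5) (y : E4)
    (X : Fin 4 → Fin 4 → Fin 4 → Fin 4 → ℂ) :
    ∑ a, ∑ b, ∑ c, ∑ d, tensorW e o ι i a b c d y * X a b c d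
      = (1 / 12) * symContr (con4 (hatFrame (fun A A' a => e A A' a y) (fun A => o A y)
        fun A => ι A y) X) i := by
  have h2 := sum_perm_four (dblContr (con4 (hatFrame (fun A A' a => e A A' a y) (fun A => o A y)
        fun A => ι A y) X)) i
  rw [sum_tensorW_mul_eq_dblContr, symContr]
  simp only [dblContr_hatFrame] at h2
  generalize dblContr (con4 (fun (k : Bisp) a => e k.1 k.2 a y) X) = P at h2 ⊢
  generalize fullSym12 (R := ℂ) _ i = q at h2 ⊢
  have h3 : ∀ (c : Prop) [Decidable c] (A : Fin 2), hatSpinor (fun A => o A y) (fun A => ι A y)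
      (if c then 1 else 0) A = (if c then ι else o) A y := by
    intro c _ A
    by_cases hc : c <;> simp [hatSpinor, hc]
  simp only [h3] at h2
  have h4 : ∀ A B C F, symS o ι i A B C F y * P A B C F
      = (∑ σ : Equiv.Perm (Fin 4), (1 / 24) * ∏ k, (if ((σ k : Fin 4) : ℕ) < (i : ℕ) then ι else o)
        (![A, B, C, F] k) y) * P A B C F := by
    intro A B C F
    rw [symS, Finset.mul_sum]
  simp only [h4, sum_sum_mul_four]
  rw [show (1 / 12 : ℂ) * q = (1 / 24) * (2 * q) by ring, ← h2, Finset.mul_sum]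
  refine Finset.sum_congr rfl fun σ _ => ?_
  simp only [Fin.prod_univ_four, Matrix.cons_val, Fin.sum_univ_two]
  ring

end Contraction

/-! ### The coordinate expressions in terms of the ring of smooth functions -/

section Rep

variable {U : Opens (E4 × ℝ)} {G J H : Tensor2} {e : Tetrad} {o ι : Spinor}
variable {g gi j k : Fin 4 → Fin 4 → SmoothRing U} {e' : Fin 2 → Fin 2 → Fin 4 → SmoothRing U}
variable {o' ι' : Fin 2 → SmoothRing U}

lemma val_epsR (A B : Fin 2) (x : U) : (epsR (SmoothRing U) A B).1 x = eps A B :=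
  map_epsR (SmoothRing.evalHom x) A B

lemma rep_lee (hG : ∀ a b, Rep U (fun _ => G a b) (g a b)) (hg : IsMetricPair g gi)
    (hJ : ∀ a b, Rep U (fun _ => J a b) (j a b)) (a : Fin 4) :
    Rep U (fun _ => lee G J a) (aLee (dc U) (aChr (dc U) g gi) j a) := by
  intro y ε hy
  simp only [lee, aLee, nablaEnd, covEnd, SmoothRing.val_mul, SmoothRing.val_sum,
    SmoothRing.val_sub, SmoothRing.val_add, SmoothRing.val_neg, val_half,
    rep_christoffel (G := fun _ => G) hG hg _ _ _ y ε hy, (hJ _ _).pd _ y ε hy, hJ _ _ y ε hy]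

lemma rep_nijenhuis (hJ : ∀ a b, Rep U (fun _ => J a b) (j a b)) (c a b : Fin 4) :
    Rep U (fun _ => nijenhuis J c a b) (aNijenhuis (dc U) j c a b) := by
  intro y ε hy
  simp only [nijenhuis, aNijenhuis, SmoothRing.val_mul, SmoothRing.val_sum,
    SmoothRing.val_sub, (hJ _ _).pd _ y ε hy, hJ _ _ y ε hy]

lemma rep_spinConn (hG : ∀ a b, Rep U (fun _ => G a b) (g a b)) (hg : IsMetricPair g gi)
    (he : ∀ A A' a, Rep U (fun _ => e A A' a) (e' A A' a)) (a : Fin 4) (A B : Fin 2) :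
    Rep U (fun _ => spinConn G e a A B) (aSpinConn (dc U) g gi e' a A B) := by
  intro y ε hy
  simp only [spinConn, aSpinConn, SmoothRing.val_mul, SmoothRing.val_sum,
    SmoothRing.val_add, val_half, val_epsR, hG _ _ y ε hy,
    rep_christoffel (G := fun _ => G) hG hg _ _ _ y ε hy, (he _ _ _).pd _ y ε hy, he _ _ _ y ε hy]

lemma rep_ghp (hG : ∀ a b, Rep U (fun _ => G a b) (g a b)) (hg : IsMetricPair g gi)
    (he : ∀ A A' a, Rep U (fun _ => e A A' a) (e' A A' a))
    (ho : ∀ A, Rep U (fun _ => o A) (o' A)) (hι : ∀ A, Rep U (fun _ => ι A) (ι' A)) (a : Fin 4) :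
    Rep U (fun _ => ghp G e o ι a) (aGhp (dc U) g gi e' o' ι' a) := by
  intro y ε hy
  simp only [ghp, lower, nablaSpinor, aGhp, SmoothRing.val_mul, SmoothRing.val_sum,
    SmoothRing.val_add, val_epsR, rep_spinConn hG hg he _ _ _ y ε hy,
    (ho _).pd _ y ε hy, ho _ y ε hy, hι _ y ε hy]

lemma rep_formP (hG : ∀ a b, Rep U (fun _ => G a b) (g a b)) (hg : IsMetricPair g gi)
    (hJ : ∀ a b, Rep U (fun _ => J a b) (j a b))
    (he : ∀ A A' a, Rep U (fun _ => e A A' a) (e' A A' a))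
    (ho : ∀ A, Rep U (fun _ => o A) (o' A)) (hι : ∀ A, Rep U (fun _ => ι A) (ι' A)) (a : Fin 4) :
    Rep U (fun _ => formP G J e o ι a) (aFormP (dc U) g gi j e' o' ι' a) := by
  intro y ε hy
  simp only [formP, aFormP, SmoothRing.val_mul, SmoothRing.val_sum, SmoothRing.val_sub,
    val_half, SmoothRing.val_algebraMap, rep_ghp hG hg he ho hι _ y ε hy,
    rep_lee hG hg hJ _ y ε hy, hJ _ _ y ε hy]

lemma rep_boxC (hG : ∀ a b, Rep U (fun _ => G a b) (g a b)) (hg : IsMetricPair g gi)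
    (hJ : ∀ a b, Rep U (fun _ => J a b) (j a b))
    (he : ∀ A A' a, Rep U (fun _ => e A A' a) (e' A A' a))
    (ho : ∀ A, Rep U (fun _ => o A) (o' A)) (hι : ∀ A, Rep U (fun _ => ι A) (ι' A)) (w p : ℂ)
    {ψ : E4 → ℂ} {ψ' : SmoothRing U} (hψ : Rep U (fun _ => ψ) ψ') :
    Rep U (fun _ => boxC G J e o ι w p ψ) (aBox (dc U) g gi (aLee (dc U) (aChr (dc U) g gi) j)
      (aWeight (dc U) g gi j e' o' ι' w p) ψ') := by
  have h1 : ∀ a, Rep U (fun _ => cScalar G J e o ι w p ψ a)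
      (aScalarDer (dc U) (aWeight (dc U) g gi j e' o' ι' w p) ψ' a) := by
    intro a y ε hy
    simp only [cScalar, aScalarDer, aWeight, SmoothRing.val_mul, SmoothRing.val_add,
      SmoothRing.val_algebraMap, hψ.pd _ y ε hy, hψ y ε hy, rep_lee hG hg hJ _ y ε hy,
      rep_formP hG hg hJ he ho hι _ y ε hy]
  refine rep_tr (G := fun _ => G) (T := fun _ => cCovector G J e o ι w p _) hG hg fun a b => ?_
  intro y ε hy
  have h2 := rep_nabla1 (G := fun _ => G) (v := fun _ => cScalar G J e o ι w p ψ) hG hg h1 a b y ε hy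
  simp only [cCovector, aCovectorDer, SmoothRing.val_mul, SmoothRing.val_add, SmoothRing.val_sub,
    SmoothRing.val_sum, ← h2]
  simp only [aWeight, SmoothRing.val_mul, SmoothRing.val_add,
    SmoothRing.val_algebraMap, hG _ _ y ε hy, ← h1 _ y ε hy, rep_lee hG hg hJ _ y ε hy,
    rep_ginv (G := fun _ => G) hG hg _ _ y ε hy, rep_formP hG hg hJ he ho hι _ y ε hy]

lemma rep_sum_tensorW_mul (he : ∀ A A' a, Rep U (fun _ => e A A' a) (e' A A' a))
    (ho : ∀ A, Rep U (fun _ => o A) (o' A)) (hι : ∀ A, Rep U (fun _ => ι A) (ι' A)) (i : Fin 5)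
    {X : Tensor4} {x : Fin 4 → Fin 4 → Fin 4 → Fin 4 → SmoothRing U}
    (hX : ∀ a b c d, Rep U (fun _ => X a b c d) (x a b c d)) :
    Rep U (fun _ y => ∑ a, ∑ b, ∑ c, ∑ d, tensorW e o ι i a b c d y * X a b c d y)
      (algebraMap ℂ _ (1 / 12) * symContr (con4 (hatFrame e' o' ι') x) i) := by
  intro y ε hy
  simp only [sum_tensorW_mul e o ι i y fun a b c d => X a b c d y]
  rw [SmoothRing.val_mul, SmoothRing.val_algebraMap, ← SmoothRing.evalHom_apply ⟨(y, ε), hy⟩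
    (symContr _ _), map_symContr]
  simp only [map_con4_hatFrame, SmoothRing.evalHom_apply, ← he _ _ _ y ε hy, ← ho _ y ε hy,
    ← hι _ y ε hy, ← hX _ _ _ _ y ε hy]

lemma rep_sourceOp (hG : ∀ a b, Rep U (fun _ => G a b) (g a b)) (hg : IsMetricPair g gi)
    (hJ : ∀ a b, Rep U (fun _ => J a b) (j a b))
    (he : ∀ A A' a, Rep U (fun _ => e A A' a) (e' A A' a))
    (ho : ∀ A, Rep U (fun _ => o A) (o' A)) (hι : ∀ A, Rep U (fun _ => ι A) (ι' A)) (i : Fin 5)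
    {T : Tensor2} {t : Fin 4 → Fin 4 → SmoothRing U} (hT : ∀ a b, Rep U (fun _ => T a b) (t a b)) :
    Rep U (fun _ => sourceOp G J e o ι i T)
      (algebraMap ℂ _ (1 / 12) * symContr (con4 (hatFrame e' o' ι') fun a b c d =>
        aHess2 (dc U) g gi t a d b c - 4 * aLee (dc U) (aChr (dc U) g gi) j a
          * cov2 (dc U) (aChr (dc U) g gi) t d b c) i) := by
  refine rep_sum_tensorW_mul (X := fun a b c d y => hess2 G T a d b c y
    - 4 * lee G J a y * nabla2 G T d b c y) he ho hι i fun a b c d => ?_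
  intro y ε hy
  rw [SmoothRing.val_sub, SmoothRing.val_mul, SmoothRing.val_mul, ← rep_lee hG hg hJ _ y ε hy,
    ← rep_hess2 (G := fun _ => G) (T := fun _ => T) hG hg hT _ _ _ _ y ε hy,
    ← rep_nabla2 (G := fun _ => G) (T := fun _ => T) hG hg hT _ _ _ y ε hy]
  rfl

lemma rep_weylComponent {V : Opens E4} {g gi k : Fin 4 → Fin 4 → SmoothRing (cylinder V)}
    {e' : Fin 2 → Fin 2 → Fin 4 → SmoothRing (cylinder V)} {o' ι' : Fin 2 → SmoothRing (cylinder V)}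
    (hG : ∀ a b, Rep (cylinder V) (fun _ => G a b) (g a b)) (hg : IsMetricPair g gi)
    (hH : ∀ a b, Rep (cylinder V) (fun _ => H a b) (k a b)) (hk : ∀ a b, k a b = k b a)
    (he : ∀ A A' a, Rep (cylinder V) (fun _ => e A A' a) (e' A A' a))
    (ho : ∀ A, Rep (cylinder V) (fun _ => o A) (o' A))
    (hι : ∀ A, Rep (cylinder V) (fun _ => ι A) (ι' A)) (i : Fin 5) :
    Rep (cylinder V) (fun _ => weylComponent G e o ι i H)
      (algebraMap ℂ _ (1 / 12) * symContr (con4 (hatFrame e' o' ι')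
        (aLinWeyl (dc (cylinder V)) g gi k)) i) := by
  refine rep_sum_tensorW_mul (X := linWeyl G H) he ho hι i fun a b c d y ε hy => ?_
  have hy0 : (y, (0 : ℝ)) ∈ cylinder V := ⟨hy.1, trivial⟩
  refine (hasDerivAt_weyl hG hH hg hk hy0 a b c d).deriv.trans ?_
  -- The linearised Weyl tensor is a derivative at `ε = 0`, while a constant family is represented
  -- on the whole cylinder; the value is moved from `ε = 0` to an arbitrary `ε`.
  exact aLinWeyl_val_congr (F := fun _ => G) (F' := fun _ => G) hG hg hH hG hg hH rfl hy0 hy a b c d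

lemma aBox_const_mul (D : Fin 4 → Derivation ℂ (SmoothRing U) (SmoothRing U))
    (f q : Fin 4 → SmoothRing U) (c : ℂ) (ψ : SmoothRing U) :
    aBox D g gi f q (algebraMap ℂ _ c * ψ) = algebraMap ℂ _ c * aBox D g gi f q ψ := by
  have h1 : ∀ a, aScalarDer D q (algebraMap ℂ _ c * ψ) a = algebraMap ℂ _ c * aScalarDer D q ψ a := by
    intro a
    simp only [aScalarDer, Derivation.leibniz, Derivation.map_algebraMap, smul_eq_mul, mul_zero,
      add_zero]
    ring
  simp only [aBox, aTr, Finset.mul_sum]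
  refine Finset.sum_congr rfl fun a _ => Finset.sum_congr rfl fun b _ => ?_
  simp only [aCovectorDer, cov1, h1, Derivation.leibniz, Derivation.map_algebraMap, smul_eq_mul,
    mul_zero, add_zero]
  have h2 : ∀ m, aChr D g gi m a b * (algebraMap ℂ _ c * aScalarDer D q ψ m)
      = algebraMap ℂ _ c * (aChr D g gi m a b * aScalarDer D q ψ m) := fun m => by ring
  have h3 : ∀ m n, gi m n * f n * (algebraMap ℂ _ c * aScalarDer D q ψ m)
      = algebraMap ℂ _ c * (gi m n * f n * aScalarDer D q ψ m) := fun m n => by ring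
  simp only [h2, h3, ← Finset.mul_sum]
  ring

end Rep

end SDEinstein

end

noncomputable section

namespace SDEinstein

/-! ### Smoothness of the components of a tensor field -/

section Smoothness

variable {M : Type*} [TopologicalSpace M] [ChartedSpace E4 M] [IsManifold (𝓡 4) ∞ M]
variable {φ : OpenPartialHomeomorph M E4}

/-- The coordinate vector field is the image of a constant section under the tangent map of the
inverse chart. -/
lemma contMDiffOn_coordVec (hφ : φ ∈ IsManifold.maximalAtlas (𝓡 4) ∞ M) (a : Fin 4) :
    ContMDiffOn (𝓡 4) ((𝓡 4).prod 𝓘(ℝ, E4)) ∞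
      (fun y => TotalSpace.mk' E4 (E := fun x : M => TangentSpace (𝓡 4) x) (φ.symm y)
        (coordVec φ a y)) φ.target := by
  have h1 := contMDiffOn_symm_of_mem_maximalAtlas hφ
  have h2 := h1.contMDiffOn_tangentMapWithin (m := ∞) (by simp) φ.open_target.uniqueMDiffOn
  have h3 : ContMDiffOn (𝓡 4) (𝓡 4).tangent ∞
      (fun y : E4 => (⟨y, EuclideanSpace.single a (1 : ℝ)⟩ : TangentBundle (𝓡 4) E4)) φ.target := by
    intro y hy
    exact contMDiffWithinAt_vectorSpace_iff_contDiffWithinAt.2 contDiffWithinAt_const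
  have h4 := h2.comp h3 (fun y hy => hy)
  refine h4.congr fun y hy => ?_
  simp only [Function.comp, tangentMapWithin, coordVec]
  rw [mfderivWithin_of_isOpen φ.open_target hy]

variable {F : Type*} [NormedAddCommGroup F] [NormedSpace ℝ F]

lemma contDiffOn_bilinear (hφ : φ ∈ IsManifold.maximalAtlas (𝓡 4) ∞ M)
    {T : ∀ x : M, TangentSpace (𝓡 4) x →L[ℝ] TangentSpace (𝓡 4) x →L[ℝ] F}
    (hT : ContMDiff (𝓡 4) ((𝓡 4).prod 𝓘(ℝ, E4 →L[ℝ] E4 →L[ℝ] F)) ∞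
      (fun x => TotalSpace.mk' (E4 →L[ℝ] E4 →L[ℝ] F) x (T x))) (a b : Fin 4) :
    ContDiffOn ℝ ∞ (fun y => T (φ.symm y) (coordVec φ a y) (coordVec φ b y)) φ.target := by
  intro y hy
  have h1 := contMDiffOn_symm_of_mem_maximalAtlas hφ y hy
  have h2 : ContMDiffWithinAt (𝓡 4) ((𝓡 4).prod 𝓘(ℝ, F)) ∞
      (fun y => TotalSpace.mk' F (E := Bundle.Trivial M F) (φ.symm y)
        (T (φ.symm y) (coordVec φ a y) (coordVec φ b y))) φ.target y := by
    apply ContMDiffWithinAt.clm_bundle_apply₂ (F₁ := E4) (F₂ := E4)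
    · exact ContMDiffAt.comp_contMDiffWithinAt y hT.contMDiffAt h1
    · exact contMDiffOn_coordVec hφ a y hy
    · exact contMDiffOn_coordVec hφ b y hy
  simp only [contMDiffWithinAt_totalSpace] at h2
  exact h2.2.contDiffWithinAt

lemma contDiffOn_formComp (hφ : φ ∈ IsManifold.maximalAtlas (𝓡 4) ∞ M)
    {h : ∀ x : M, TangentSpace (𝓡 4) x →L[ℝ] TangentSpace (𝓡 4) x →L[ℝ] ℂ}
    (hh : IsSymmTensorField h) (a b : Fin 4) : ContDiffOn ℝ ∞ (formComp φ h a b) φ.target :=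
  contDiffOn_bilinear hφ hh.smooth a b

lemma contDiffOn_metricComp (hφ : φ ∈ IsManifold.maximalAtlas (𝓡 4) ∞ M) (g : Metric M)
    (a b : Fin 4) : ContDiffOn ℝ ∞ (metricComp φ g a b) φ.target :=
  Complex.ofRealCLM.contDiff.comp_contDiffOn (contDiffOn_bilinear hφ g.contMDiff a b)

end Smoothness

end SDEinstein

end

noncomputable section

namespace SDEinstein

open TopologicalSpace (Opens)

set_option linter.unusedSectionVars false
set_option linter.unusedSimpArgs false

/-! ### The frame of a quaternionic-Kähler manifold with a complex structure -/

section Frame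

variable {V : Opens E4}

/-- A smooth function of the coordinates as an element of the ring of families. -/
def SmoothRing.ofBase (F : E4 → ℂ) (hF : ContDiffOn ℝ ∞ F V) : SmoothRing (cylinder V) :=
  SmoothRing.of (fun p : E4 × ℝ => F p.1) (hF.comp contDiff_fst.contDiffOn fun _ hp => hp.1)

lemma rep_ofBase (F : E4 → ℂ) (hF : ContDiffOn ℝ ∞ F V) :
    Rep (cylinder V) (fun _ => F) (SmoothRing.ofBase F hF) := fun _ _ _ => rfl

lemma sum_mul_hatFrame_of_principal {J : Tensor2} {e : Tetrad} {o ι : Spinor} {y : E4}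
    (hn : ∑ A, lower o A y * ι A y = 1)
    (hp : ∀ B B' a, ∑ b, J a b y * e B B' b y
      = Complex.I * ∑ A, (o A y * lower ι B y + ι A y * lower o B y) * e A B' a y)
    (k : Bisp) (a : Fin 4) :
    ∑ b, J a b y * hatFrame (fun A A' a => e A A' a y) (fun A => o A y) (fun A => ι A y) k b
      = lamR ℂ k * hatFrame (fun A A' a => e A A' a y) (fun A => o A y) (fun A => ι A y) k a := by
  have h1 : ∑ b, J a b y
      * hatFrame (fun A A' a => e A A' a y) (fun A => o A y) (fun A => ι A y) k b
      = ∑ A, (if k.1 = 0 then o A y else ι A y) * ∑ b, J a b y * e A k.2 b y := by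
    simp only [hatFrame, Finset.mul_sum]
    rw [Finset.sum_comm]
    exact Finset.sum_congr rfl fun A _ => Finset.sum_congr rfl fun b _ => by ring
  rw [h1]
  simp only [hp, hatFrame, lamR]
  obtain ⟨k, k'⟩ := k
  simp only [lower, Fin.sum_univ_two] at hn ⊢
  have e1 : eps 0 0 = 0 := by simp [eps]
  have e2 : eps 0 1 = 1 := by simp [eps]
  have e3 : eps 1 0 = -1 := by simp [eps]
  have e4 : eps 1 1 = 0 := by simp [eps]
  simp only [e1, e2, e3, e4] at hn ⊢
  fin_cases k
  · simp
    linear_combination -Complex.I * (o 0 y * e 0 k' a y + o 1 y * e 1 k' a y) * hn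
  · simp
    linear_combination Complex.I * (ι 0 y * e 0 k' a y + ι 1 y * e 1 k' a y) * hn

variable {M : Type*} [TopologicalSpace M] [ChartedSpace E4 M] [IsManifold (𝓡 4) ∞ M]

lemma metricComp_symm (φ : OpenPartialHomeomorph M E4) (g : Metric M) (a b : Fin 4) :
    metricComp φ g a b = metricComp φ g b a := by
  funext y
  simp only [metricComp]
  rw [g.symm]

/-- Lifts the data on `V` to the cylinder as families constant in `ε`, and verifies the algebraic
hypotheses pointwise from the geometric ones. -/
lemma exists_isSDEinsteinFrame {g : Metric M}
    {J : ∀ x : M, TangentSpace (𝓡 4) x →L[ℝ] TangentSpace (𝓡 4) x} {Λ : ℝ}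
    (hJ : IsComplexStructure g J) (hg : IsQuaternionicKahler g J Λ)
    {φ : OpenPartialHomeomorph M E4} (hφ : φ ∈ IsManifold.maximalAtlas (𝓡 4) ∞ M)
    (hVφ : (V : Set E4) ⊆ φ.target) {e : Tetrad} {o ι : Spinor}
    (he : IsSpinFrame (metricComp φ g) V e) (hoι : IsPrincipalPair (endComp φ J) V e o ι) :
    ∃ (γ γi j : Fin 4 → Fin 4 → SmoothRing (cylinder V))
      (e' : Fin 2 → Fin 2 → Fin 4 → SmoothRing (cylinder V))
      (o' ι' : Fin 2 → SmoothRing (cylinder V)) (θ : Fin 4 → Bisp → SmoothRing (cylinder V)),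
      (∀ a b, Rep (cylinder V) (fun _ => metricComp φ g a b) (γ a b)) ∧
      (∀ a b, Rep (cylinder V) (fun _ => endComp φ J a b) (j a b)) ∧
      (∀ A A' a, Rep (cylinder V) (fun _ => e A A' a) (e' A A' a)) ∧
      (∀ A, Rep (cylinder V) (fun _ => o A) (o' A)) ∧
      (∀ A, Rep (cylinder V) (fun _ => ι A) (ι' A)) ∧
      (∀ A A' B B', ∑ a, ∑ b, γ a b * e' A A' a * e' B B' b
        = epsR (SmoothRing (cylinder V)) A B * epsR (SmoothRing (cylinder V)) A' B') ∧
      IsSDEinsteinFrame (dc (cylinder V)) γ γi j (hatFrame e' o' ι') θ (Λ : ℂ) := by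
  have hGs : ∀ a b, ContDiffOn ℝ ∞ (metricComp φ g a b) V := fun a b =>
    (contDiffOn_metricComp hφ g a b).mono hVφ
  obtain ⟨γ, hγ⟩ : ∃ γ : Fin 4 → Fin 4 → SmoothRing (cylinder V),
      ∀ a b, Rep (cylinder V) (fun _ => metricComp φ g a b) (γ a b) :=
    ⟨fun a b => SmoothRing.ofBase _ (hGs a b), fun a b => rep_ofBase _ (hGs a b)⟩
  obtain ⟨e', he'⟩ : ∃ e' : Fin 2 → Fin 2 → Fin 4 → SmoothRing (cylinder V),
      ∀ A A' a, Rep (cylinder V) (fun _ => e A A' a) (e' A A' a) :=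
    ⟨fun A A' a => SmoothRing.ofBase _ (he.smooth A A' a),
      fun A A' a => rep_ofBase _ (he.smooth A A' a)⟩
  obtain ⟨o', ho'⟩ : ∃ o' : Fin 2 → SmoothRing (cylinder V),
      ∀ A, Rep (cylinder V) (fun _ => o A) (o' A) :=
    ⟨fun A => SmoothRing.ofBase _ (hoι.smooth_o A), fun A => rep_ofBase _ (hoι.smooth_o A)⟩
  obtain ⟨ι', hι'⟩ : ∃ ι' : Fin 2 → SmoothRing (cylinder V),
      ∀ A, Rep (cylinder V) (fun _ => ι A) (ι' A) :=
    ⟨fun A => SmoothRing.ofBase _ (hoι.smooth_ι A), fun A => rep_ofBase _ (hoι.smooth_ι A)⟩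
  have hs : ∀ a b, γ a b = γ b a := fun a b =>
    (hγ a b).unique (by rw [metricComp_symm]; exact hγ b a)
  have hm : ∀ A A' B B', ∑ a, ∑ b, γ a b * e' A A' a * e' B B' b
      = epsR (SmoothRing (cylinder V)) A B * epsR (SmoothRing (cylinder V)) A' B' := by
    intro A A' B B'
    ext ⟨⟨y, ε⟩, hy⟩
    simp only [SmoothRing.val_sum, SmoothRing.val_mul, val_epsR, ← hγ _ _ y ε hy,
      ← he' _ _ _ y ε hy]
    exact he.metric y hy.1 A A' B B'
  have hn : ∑ A, (∑ C, o' C * epsR (SmoothRing (cylinder V)) C A) * ι' A = 1 := by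
    ext ⟨⟨y, ε⟩, hy⟩
    simp only [SmoothRing.val_sum, SmoothRing.val_mul, val_epsR, ← ho' _ y ε hy,
      ← hι' _ y ε hy]
    exact hoι.normalised y hy.1
  have hf := isHatFrame_of_eta hs (con2_hatFrame hm hn)
  -- The components of `J` are rebuilt from its eigenframe and coframe, so they belong to the smooth
  -- ring because the spinors and the tetrad do.
  have hj : ∀ a b, Rep (cylinder V) (fun _ => endComp φ J a b)
      (hatJ (hatFrame e' o' ι') (hatCoframe γ (hatFrame e' o' ι')) a b) := by
    intro a b y ε hy
    have h1 := sum_mul_hatFrame_of_principal (hoι.normalised y hy.1) (hoι.principal y hy.1)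
    have h2 : ∀ k a, hatFrame (fun A A' a => e A A' a y) (fun A => o A y) (fun A => ι A y) k a
        = SmoothRing.evalHom ⟨(y, ε), hy⟩ (hatFrame e' o' ι' k a) := by
      intro k a
      simp only [hatFrame, map_sum, map_mul, apply_ite (SmoothRing.evalHom ⟨(y, ε), hy⟩),
        SmoothRing.evalHom_apply, he' _ _ _ y ε hy, ho' _ y ε hy, hι' _ y ε hy]
    have h3 : ∀ c, ∑ k, SmoothRing.evalHom ⟨(y, ε), hy⟩ (hatCoframe γ (hatFrame e' o' ι') b k)
        * SmoothRing.evalHom ⟨(y, ε), hy⟩ (hatFrame e' o' ι' k c) = if b = c then 1 else 0 := by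
      intro c
      have := congrArg (SmoothRing.evalHom ⟨(y, ε), hy⟩) (hf.dual.left b c)
      simpa only [map_sum, map_mul, apply_ite (SmoothRing.evalHom ⟨(y, ε), hy⟩), map_one,
        map_zero] using this
    calc endComp φ J a b y = ∑ c, endComp φ J a c y * (if b = c then 1 else 0) := by simp
      _ = ∑ k, SmoothRing.evalHom ⟨(y, ε), hy⟩ (hatCoframe γ (hatFrame e' o' ι') b k)
          * ∑ c, endComp φ J a c y * SmoothRing.evalHom ⟨(y, ε), hy⟩ (hatFrame e' o' ι' k c) := by
        simp only [← h3, Finset.mul_sum]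
        rw [Finset.sum_comm]
        exact Finset.sum_congr rfl fun k _ => Finset.sum_congr rfl fun c _ => by ring
      _ = SmoothRing.evalHom ⟨(y, ε), hy⟩
          (hatJ (hatFrame e' o' ι') (hatCoframe γ (hatFrame e' o' ι')) a b) := by
        simp only [← h2, h1]
        simp only [h2, hatJ, map_sum, map_mul]
        exact Finset.sum_congr rfl fun k _ => by
          rw [show SmoothRing.evalHom ⟨(y, ε), hy⟩ (lamR (SmoothRing (cylinder V)) k) = lamR ℂ k
            from rfl]
          ring
  refine ⟨γ, _, _, e', o', ι', _, hγ, hj, he', ho', hι', hm, hf, ?_, ?_, ?_, ?_⟩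
  · exact fun a b f => SmoothRing.dir_comm _ _ f
  · intro c a b
    ext ⟨⟨y, ε⟩, hy⟩
    rw [← rep_nijenhuis hj c a b y ε hy]
    exact hJ.integrable φ hφ y (hVφ hy.1) c a b
  · intro a b
    ext ⟨⟨y, ε⟩, hy⟩
    rw [SmoothRing.val_mul, ← rep_ricci (G := fun _ => metricComp φ g) hγ hf.metric a b y ε hy,
      ← hγ a b y ε hy]
    exact hg.einstein φ hφ y (hVφ hy.1) a b
  · intro A B C F
    ext ⟨⟨y, ε⟩, hy⟩
    rw [← SmoothRing.evalHom_apply, map_dblContr]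
    simp only [map_con4_hatFrame, SmoothRing.evalHom_apply, ← he' _ _ _ y ε hy, ← ho' _ y ε hy,
      ← hι' _ y ε hy,
      ← rep_weyl (G := fun _ => metricComp φ g) hγ hf.metric _ _ _ _ y ε hy]
    -- Self-duality is given in the original tetrad and carried to the adapted frame by
    -- `dblContr_hatFrame`.
    have h1 : ∀ A B C F, dblContr (con4 (fun (k : Bisp) a => e k.1 k.2 a y)
        fun a b c d => weyl (metricComp φ g) a b c d y) A B C F = 0 := by
      intro A B C F
      have h2 := hg.selfDual φ hφ V hVφ V.isOpen e o ι he hoι y hy.1 A B C F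
      rw [weylSpinor, mul_eq_zero, or_iff_right (by norm_num)] at h2
      rw [← h2, dblContr]
      simp only [con4_apply, Finset.mul_sum]
      refine Finset.sum_congr rfl fun A' _ => Finset.sum_congr rfl fun B' _ =>
        Finset.sum_congr rfl fun C' _ => Finset.sum_congr rfl fun F' _ =>
        Finset.sum_congr rfl fun a _ => Finset.sum_congr rfl fun b _ =>
        Finset.sum_congr rfl fun c _ => Finset.sum_congr rfl fun d _ => ?_
      rw [show epsR ℂ A' B' = eps A' B' from rfl, show epsR ℂ C' F' = eps C' F' from rfl]
      ring
    have h3 := dblContr_hatFrame (e := fun A A' a => e A A' a y) (o := fun A => o A y)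
      (ι := fun A => ι A y) (fun a b c d => weyl (metricComp φ g) a b c d y) A B C F
    simp only [h1, mul_zero, Finset.sum_const_zero] at h3
    exact h3

end Frame

end SDEinstein

end

noncomputable section

namespace SDEinstein

open TopologicalSpace (Opens)

/-! ### The operator identity in coordinates -/

section Coordinates

variable {V : Opens E4} {M : Type*} [TopologicalSpace M] [ChartedSpace E4 M]
variable [IsManifold (𝓡 4) ∞ M]

lemma IsSymmTensorField.formComp_symm
    {h : ∀ x : M, TangentSpace (𝓡 4) x →L[ℝ] TangentSpace (𝓡 4) x →L[ℝ] ℂ}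
    (hh : IsSymmTensorField h) (φ : OpenPartialHomeomorph M E4) (a b : Fin 4) :
    formComp φ h a b = formComp φ h b a :=
  funext fun _ => hh.symm _ _ _

lemma exists_rep_formComp {φ : OpenPartialHomeomorph M E4}
    (hφ : φ ∈ IsManifold.maximalAtlas (𝓡 4) ∞ M) (hVφ : (V : Set E4) ⊆ φ.target)
    {h : ∀ x : M, TangentSpace (𝓡 4) x →L[ℝ] TangentSpace (𝓡 4) x →L[ℝ] ℂ}
    (hh : IsSymmTensorField h) :
    ∃ k : Fin 4 → Fin 4 → SmoothRing (cylinder V),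
      (∀ a b, Rep (cylinder V) (fun _ => formComp φ h a b) (k a b)) ∧ ∀ a b, k a b = k b a := by
  have hs : ∀ a b, ContDiffOn ℝ ∞ (formComp φ h a b) V := fun a b =>
    (contDiffOn_formComp hφ hh a b).mono hVφ
  refine ⟨fun a b => SmoothRing.ofBase _ (hs a b), fun a b => rep_ofBase _ (hs a b), fun a b => ?_⟩
  refine (rep_ofBase _ (hs a b)).unique ?_
  rw [hh.formComp_symm]
  exact rep_ofBase _ (hs b a)

lemma boxC_weylComponent {g : Metric M}
    {J : ∀ x : M, TangentSpace (𝓡 4) x →L[ℝ] TangentSpace (𝓡 4) x} {Λ : ℝ}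
    (hJ : IsComplexStructure g J) (hg : IsQuaternionicKahler g J Λ)
    {h : ∀ x : M, TangentSpace (𝓡 4) x →L[ℝ] TangentSpace (𝓡 4) x →L[ℝ] ℂ}
    (hh : IsSymmTensorField h) {φ : OpenPartialHomeomorph M E4}
    (hφ : φ ∈ IsManifold.maximalAtlas (𝓡 4) ∞ M)
    (hVφ : (V : Set E4) ⊆ φ.target) {e : Tetrad} {o ι : Spinor}
    (he : IsSpinFrame (metricComp φ g) V e) (hoι : IsPrincipalPair (endComp φ J) V e o ι)
    (i : Fin 5) (c : ℂ) {y : E4} (hy : y ∈ V) :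
    boxC (metricComp φ g) (endComp φ J) e o ι (-3) (4 - 2 * ((i : ℕ) : ℂ))
        (fun z => c * weylComponent (metricComp φ g) e o ι i (formComp φ h) z) y
      = -4 * c * sourceOp (metricComp φ g) (endComp φ J) e o ι i
        (linEinstein (metricComp φ g) Λ (formComp φ h)) y := by
  obtain ⟨γ, γi, j, e', o', ι', θ, hγ, hj, he', ho', hι', hm, hf⟩ :=
    exists_isSDEinsteinFrame hJ hg hφ hVφ he hoι
  obtain ⟨k, hk, hks⟩ := exists_rep_formComp hφ hVφ hh
  have hp := hf.hat.metric
  have hE := rep_linEinstein (G := fun _ => metricComp φ g) (T := fun _ => formComp φ h)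
    hγ hp hk (Λ : ℂ)
  have hy0 : (y, (0 : ℝ)) ∈ cylinder V := ⟨hy, trivial⟩
  have hψ : Rep (cylinder V) (fun _ z => c * weylComponent (metricComp φ g) e o ι i
      (formComp φ h) z) (algebraMap ℂ _ c * (algebraMap ℂ _ (1 / 12)
        * symContr (con4 (hatFrame e' o' ι') (aLinWeyl (dc (cylinder V)) γ γi k)) i)) := by
    intro z ε hz
    rw [SmoothRing.val_mul, SmoothRing.val_algebraMap,
      ← rep_weylComponent hγ hp hk hks he' ho' hι' i z ε hz]
  refine (rep_boxC hγ hp hj he' ho' hι' _ _ hψ y 0 hy0).trans ?_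
  have hS := rep_sourceOp hγ hp hj he' ho' hι' i hE y 0 hy0
  dsimp only at hS
  rw [hS, aBox_const_mul, aBox_const_mul,
    hf.teukolsky hm hks i, show (-4 : SmoothRing (cylinder V)) = algebraMap ℂ _ (-4) by
      rw [map_neg, map_ofNat]]
  simp only [SmoothRing.val_mul, SmoothRing.val_algebraMap]
  ring

/-- The tensor vanishes on an open set, hence so do its derivatives there. -/
lemma sourceOp_eq_zero {G J T : Tensor2} {e : Tetrad} {o ι : Spinor}
    (hT : ∀ y ∈ V, ∀ a b, T a b y = 0) (i : Fin 5) {y : E4} (hy : y ∈ V) :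
    sourceOp G J e o ι i T y = 0 := by
  have hpd : ∀ F : E4 → ℂ, (∀ z ∈ V, F z = 0) → ∀ a, ∀ z ∈ V, pd a F z = 0 := by
    intro F hF a z hz
    have h1 : F =ᶠ[nhds z] fun _ => 0 := by
      filter_upwards [V.isOpen.mem_nhds hz] with w hw using hF w hw
    rw [pd, h1.fderiv_eq]
    simp
  have h2 : ∀ z ∈ V, ∀ a b c, nabla2 G T a b c z = 0 := by
    intro z hz a b c
    simp [nabla2, hpd _ (fun w hw => hT w hw b c) a z hz, hT z hz]
  have h3 : ∀ z ∈ V, ∀ a b c d, hess2 G T a b c d z = 0 := by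
    intro z hz a b c d
    simp [hess2, nabla3, hpd _ (fun w hw => h2 w hw b c d) a z hz, h2 z hz]
  simp [sourceOp, h2 y hy, h3 y hy]

end Coordinates

end SDEinstein

end

/-! ### The theorem: linearisation, operator identity and Teukolsky equations -/

open SDEinstein in
theorem mainTheorem6
    {M : Type*} [TopologicalSpace M] [ChartedSpace E4 M] [IsManifold (𝓡 4) ∞ M]
    -- a quaternionic-Kähler 4-manifold with an integrable complex structure
    (g : Metric M) (J : ∀ x : M, TangentSpace (𝓡 4) x →L[ℝ] TangentSpace (𝓡 4) x) (Λ : ℝ)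
    (hJ : IsComplexStructure g J) (hg : IsQuaternionicKahler g J Λ)
    -- an arbitrary symmetric tensor field
    (h : ∀ x : M, TangentSpace (𝓡 4) x →L[ℝ] TangentSpace (𝓡 4) x →L[ℝ] ℂ)
    (hh : IsSymmTensorField h)
    -- a chart, and a spin frame and principal spinors of `J` on an open part of it
    (φ : OpenPartialHomeomorph M E4) (hφ : φ ∈ IsManifold.maximalAtlas (𝓡 4) ∞ M)
    (V : Set E4) (hV : IsOpen V) (hVφ : V ⊆ φ.target)
    (e : Tetrad) (o ι : Spinor)
    (he : IsSpinFrame (metricComp φ g) V e)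
    (hoι : IsPrincipalPair (endComp φ J) V e o ι)
    -- the auxiliary constant conformal factor
    (Ω : ℝ) (hΩ : 0 < Ω) :
    -- `linEinstein` is the linearisation of `G_{ab} + Λ g_{ab}`
    (∀ y ∈ V, ∀ a b,
      HasDerivAt (fun ε : ℝ => einstein (perturb (metricComp φ g) (formComp φ h) ε) a b y
          + (Λ : ℂ) * perturb (metricComp φ g) (formComp φ h) ε a b y)
        (linEinstein (metricComp φ g) Λ (formComp φ h) a b y) 0) ∧
    -- the Weyl tensor can be linearised
    (∀ y ∈ V, ∀ a b c d, DifferentiableAt ℝ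
      (fun ε : ℝ => weyl (perturb (metricComp φ g) (formComp φ h) ε) a b c d y) 0) ∧
    -- the operator identity
    (∀ i : Fin 5, ∀ y ∈ V,
      -((Ω : ℂ)⁻¹ * sourceOp (metricComp φ g) (endComp φ J) e o ι i
          (linEinstein (metricComp φ g) Λ (formComp φ h)) y)
        = (1 / 4) * boxC (metricComp φ g) (endComp φ J) e o ι (-3) (4 - 2 * ((i : ℕ) : ℂ))
            (fun z => (Ω : ℂ)⁻¹ *
              weylComponent (metricComp φ g) e o ι i (formComp φ h) z) y) ∧
    -- the Teukolsky equations for linearised Einstein solutions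
    ((∀ y ∈ V, ∀ a b, linEinstein (metricComp φ g) Λ (formComp φ h) a b y = 0) →
      ∀ i : Fin 5, ∀ y ∈ V,
        boxC (metricComp φ g) (endComp φ J) e o ι (-3) (4 - 2 * ((i : ℕ) : ℂ))
          (fun z => (1 / 4) * ((Ω : ℂ)⁻¹ *
            weylComponent (metricComp φ g) e o ι i (formComp φ h) z)) y = 0) := by
  have hy0 : ∀ y ∈ V, (y, (0 : ℝ)) ∈ cylinder ⟨V, hV⟩ := fun y hy => ⟨hy, trivial⟩
  obtain ⟨γ, γi, j, e', o', ι', θ, hγ, -, -, -, -, -, hf⟩ :=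
    exists_isSDEinsteinFrame (V := ⟨V, hV⟩) hJ hg hφ hVφ he hoι
  obtain ⟨k, hk, hks⟩ := exists_rep_formComp (V := ⟨V, hV⟩) hφ hVφ hh
  refine ⟨fun y hy a b => ?_, fun y hy a b c d => ?_, fun i y hy => ?_, fun hE i y hy => ?_⟩
  · exact hasDerivAt_einstein hγ hk hf.hat.metric hks Λ (hy0 y hy)
      (fun a b => hg.einstein φ hφ y (hVφ hy) a b) a b
  · exact (hasDerivAt_weyl hγ hk hf.hat.metric hks (hy0 y hy) a b c d).differentiableAt
  · rw [boxC_weylComponent (V := ⟨V, hV⟩) hJ hg hh hφ hVφ he hoι i _ hy]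
    ring
  -- The constants `1/4` and `Ω⁻¹` are merged into the single factor `c` of `boxC_weylComponent`.
  · simp only [← mul_assoc]
    rw [boxC_weylComponent (V := ⟨V, hV⟩) hJ hg hh hφ hVφ he hoι i _ hy,
      sourceOp_eq_zero (V := ⟨V, hV⟩) hE i hy, mul_zero]
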